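/- Algorithms are randomized (probabilistic Turing machines, or any model that simulates them and is simulated by them with polynomial overhead); time bounds hold for every outcome of the coins. **Strongish Planted Clique Hypothesis.** Let $\mathcal{G}(N,\tfrac12)$ be the random graph on $N$ vertices in which each pair of vertices is an edge independently with probability $\tfrac12$, and let $\mathcal{G}(N,\tfrac12,\kappa)$ be the random graph obtained from $\mathcal{G}(N,\tfrac12)$ by making a uniformly random set of $\kappa$ vertices a clique. The hypothesis says that there is $\delta\in(0,1)$ such that no algorithm $\mathbb{A}$ running in time $N^{o(\log N)}$ on graphs with $N$ vertices satisfies, for all sufficiently large $N$, both $$\Pr_{G\sim\mathcal{G}(N,1/2,\lceil N^\delta\rceil)}[\mathbb{A}(G)=1]\ge \tfrac23 \quad\text{and}\quad \Pr_{G\sim\mathcal{G}(N,1/2)}[\mathbb{A}(G)=1]\le \tfrac13 ,$$ the probabilities being over $G$ and the coins of $\mathbb{A}$. **FPT approximation.** A finite nonempty concept class $\mathcal{C}\subseteq\{0,1\}^X$ is given explicitly as an $|X|\times|\mathcal{C}|$ binary matrix, of size $n=|X|\cdot|\mathcal{C}|$. $\mathrm{VC}(\mathcal{C})$ is the size of a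 largest $S\subseteq X$ such that the restrictions of the concepts to $S$ are all the functions $S\to\{0,1\}$; $\mathrm{Ldim}(\mathcal{C})$ is the minimum, over all online learning algorithms (which predict the label of the current point from the previous points and their correct labels), of the maximum number of wrong predictions on a sequence of distinct points whose labels agree with some $c\in\mathcal{C}$. For $\alpha:\mathbb{N}\to[1,\infty)$, an $\alpha$-approximation FPT algorithm for VC Dimension is an algorithm that, given $k\in\mathbb{N}$ and $\mathcal{C}$, runs in time $f(k)\cdot n^{O(1)}$ for some computable $f:\mathbb{N}\to\mathbb{N}$, answers YES with probability at least $\tfrac23$ if $\mathrm{VC}(\mathcal{C})\ge k$, and answers NO with probability at least $\tfrac23$ if $\mathrm{VC}(\mathcal{C})<k/\alpha(k)$. For Littlestone's Dimension, replace $\mathrm{VC}$ by $\mathrm{Ldim}$. **Corollary.** Assume the Strongish Planted Clique Hypothesis. Then for every computable $\alpha:\mathbb{N}\to[1,\infty)$ with $\alpha(k)=o(k)$ there is no $\alpha$-approximation FPT algorithm for VC Dimension, and there is no $\alpha$-approximation FPT algorithm for Littlestone's Dimension. -/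

import Mathlib

open Finset Filter Asymptotics
open scoped BigOperators

namespace VCHard

/-! ### The machine model

Algorithms are WHILE-programs over binary trees (the data of LISP): programs build and take apart
trees, test whether a tree is `nil`, loop, and flip fair coins. Every elementary operation and
every control step costs one unit of time. Since trees may share subtrees, a run of `t` steps
touches at most `t` new nodes, so this model and (probabilistic, multitape) Turing machines
simulate each other with polynomial overhead. -/

/-- Binary trees, the only data type of the machine model. -/
inductive Data : Type
  | nil : Data
  | cons : Data → Data → Data
  deriving DecidableEq

/-- Programs; each one maps a tree to a (random) tree. -/
inductive Prog : Type
  /-- return the input -/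
  | id : Prog
  /-- return `nil` -/
  | nil : Prog
  /-- left subtree of the input (`nil` on `nil`) -/
  | hd : Prog
  /-- right subtree of the input (`nil` on `nil`) -/
  | tl : Prog
  /-- a fair coin: `nil` or `cons nil nil`, with probability one half each -/
  | flip : Prog
  /-- run both programs on the input, return the tree whose subtrees are the two results -/
  | pair : Prog → Prog → Prog
  /-- run the first program, then the second one on its result -/
  | seq : Prog → Prog → Prog
  /-- run the first program on the input; if the result is not `nil`, run the second program on
  the input, otherwise the third one -/
  | ite : Prog → Prog → Prog → Prog
  /-- `loop c p`: while `c` returns a result other than `nil` on the current tree, replace the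
  current tree by the result of `p`; at the end return the current tree -/
  | loop : Prog → Prog → Prog

/-- Left subtree, `nil` for the tree `nil`. -/
def Data.hd : Data → Data
  | .nil => .nil
  | .cons a _ => a

/-- Right subtree, `nil` for the tree `nil`. -/
def Data.tl : Data → Data
  | .nil => .nil
  | .cons _ b => b

/-- A bit as a tree. -/
def Data.ofBool : Bool → Data
  | false => .nil
  | true => .cons .nil .nil

/-- A list as a tree. -/
def Data.ofList {β : Type*} (enc : β → Data) : List β → Data
  | [] => .nil
  | a :: l => .cons (enc a) (Data.ofList enc l)

/-- A natural number in unary, as a list of `nil`s. -/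
def Data.ofNat : ℕ → Data
  | 0 => .nil
  | n + 1 => .cons .nil (Data.ofNat n)

/-- The distribution of the outcome of a run: the result together with the running time, or
`none` if the run was cut off. -/
abbrev Outcome : Type := PMF (Option (Data × ℕ))

/-- Return `y` in time `s`. -/
noncomputable def Outcome.ret (y : Data) (s : ℕ) : Outcome := PMF.pure (some (y, s))

/-- Add `s` to the running time. -/
noncomputable def Outcome.delay (s : ℕ) (P : Outcome) : Outcome :=
  P.map (Option.map fun q => (q.1, s + q.2))

/-- Feed the result into `F`; the running times add up. -/
noncomputable def Outcome.andThen (P : Outcome) (F : Data → Outcome) : Outcome :=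
  P.bind fun o => match o with
    | none => PMF.pure none
    | some q => Outcome.delay q.2 (F q.1)

/-- While-loop with condition `c` and body `p`, cut off when the condition would be evaluated more
than `n` times (the first argument). -/
noncomputable def Outcome.iterate (c p : Data → Outcome) : ℕ → Data → Outcome
  | 0, _ => PMF.pure none
  | n + 1, x => Outcome.delay 1 ((c x).andThen fun b =>
      if b = .nil then Outcome.ret x 0 else (p x).andThen (Outcome.iterate c p n))

/-- The outcome of a program on an input, every loop being cut off when its condition would be
evaluated more than `n` times. As every evaluation of a condition takes time, the cut-off does
not affect runs of at most `n` steps. -/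
noncomputable def Prog.run (n : ℕ) : Prog → Data → Outcome
  | .id, x => Outcome.ret x 1
  | .nil, _ => Outcome.ret .nil 1
  | .hd, x => Outcome.ret x.hd 1
  | .tl, x => Outcome.ret x.tl 1
  | .flip, _ => (PMF.uniformOfFintype Bool).map fun b => some (Data.ofBool b, 1)
  | .pair p q, x => Outcome.delay 1 ((p.run n x).andThen fun a =>
      (q.run n x).andThen fun b => Outcome.ret (.cons a b) 0)
  | .seq p q, x => Outcome.delay 1 ((p.run n x).andThen (q.run n))
  | .ite c p q, x => Outcome.delay 1 ((c.run n x).andThen fun b =>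
      if b = .nil then q.run n x else p.run n x)
  | .loop c p, x => Outcome.iterate (c.run n) (p.run n) n x

/-- Whatever the coins, `p` halts on input `x` after at most `t` steps. -/
def Prog.HaltsWithin (p : Prog) (x : Data) (t : ℕ) : Prop :=
  ∀ o ∈ (p.run t x).support, ∃ y s, o = some (y, s) ∧ s ≤ t

/-- A run accepts (answers YES, or 1) if it halts with a result other than `nil`; a halting run
with the result `nil` rejects (answers NO, or 0). -/
def accepts : Option (Data × ℕ) → Bool
  | none => false
  | some q => decide (q.1 ≠ .nil)

/-- The probability, over the coins of `p`, that `p` accepts `x`. It is only used for `t` with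
`p.HaltsWithin x t`, and then does not depend on `t`. -/
noncomputable def Prog.acceptProb (p : Prog) (x : Data) (t : ℕ) : ℝ :=
  (((p.run t x).map accepts) true).toReal

/-! ### The Strongish Planted Clique Hypothesis -/

open Classical in
/-- A graph on `N` vertices, given to a program by the rows of its adjacency matrix. -/
noncomputable def encodeGraph {N : ℕ} (G : SimpleGraph (Fin N)) : Data :=
  Data.ofList (fun i => Data.ofList (fun j => Data.ofBool (decide (G.Adj i j))) (List.finRange N))
    (List.finRange N)

/-- `G` with a clique planted on the vertex set `S`. -/
def plantClique {N : ℕ} (G : SimpleGraph (Fin N)) (S : Finset (Fin N)) : SimpleGraph (Fin N) :=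
  G ⊔ SimpleGraph.fromRel fun u v => u ∈ S ∧ v ∈ S

/-- The Erdős–Rényi distribution `𝒢(N, 1/2)` on the graphs with vertex set `Fin N`. -/
noncomputable def randomGraph (N : ℕ) : MeasureTheory.Measure (SimpleGraph (Fin N)) :=
  SimpleGraph.binomialRandom (Fin N) ⟨1 / 2, by norm_num, by norm_num⟩

/-- The probability that `p` accepts a graph from `𝒢(N, 1/2)`. -/
noncomputable def acceptProbRandom (p : Prog) (N t : ℕ) : ℝ :=
  ∫ G, p.acceptProb (encodeGraph G) t ∂(randomGraph N)

/-- The probability that `p` accepts a graph from `𝒢(N, 1/2, κ)`: a graph from `𝒢(N, 1/2)` with a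
clique planted on a uniformly random set of `κ` vertices (where `κ ≤ N`). -/
noncomputable def acceptProbPlanted (p : Prog) (N κ t : ℕ) : ℝ :=
  𝔼 S ∈ powersetCard κ (univ : Finset (Fin N)),
    ∫ G, p.acceptProb (encodeGraph (plantClique G S)) t ∂(randomGraph N)

/-- For some `0 < δ < 1`, no (randomized) algorithm which runs in time `T(N) ≤ N ^ ε(N)` with
`ε(N) = o(log N)` distinguishes, for all large `N`, between `𝒢(N, 1/2, ⌈N ^ δ⌉)` and
`𝒢(N, 1/2)`. -/
def StrongishPlantedCliqueHypothesis : Prop :=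
  ∃ δ : ℝ, 0 < δ ∧ δ < 1 ∧ ¬ ∃ (p : Prog) (T : ℕ → ℕ) (ε : ℕ → ℝ),
    ε =o[atTop] (fun N : ℕ => Real.log N) ∧
    ∀ᶠ N : ℕ in atTop,
      (T N : ℝ) ≤ (N : ℝ) ^ ε N ∧
      (∀ G : SimpleGraph (Fin N), p.HaltsWithin (encodeGraph G) (T N)) ∧
      2 / 3 ≤ acceptProbPlanted p N ⌈(N : ℝ) ^ δ⌉₊ (T N) ∧
      acceptProbRandom p N (T N) ≤ 1 / 3

/-! ### Littlestone's dimension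

A concept on `X` is given by the set of the points with label 1. The VC dimension is Mathlib's
`Finset.vcDim`. -/

/-- An online learning algorithm predicts the label of the current point from the previous
points with their correct labels (in order). -/
abbrev OnlineAlgorithm (X : Type*) : Type _ := List (X × Bool) → X → Bool

/-- The number of incorrect predictions of `A` on a sequence of labelled points that comes after
the given history. -/
def OnlineAlgorithm.mistakes {X : Type*} (A : OnlineAlgorithm X) :
    List (X × Bool) → List (X × Bool) → ℕ
  | _, [] => 0
  | hist, (x, y) :: s => (if A hist x = y then 0 else 1) + mistakes A (hist ++ [(x, y)]) s

/-- Some concept of the class has all the labels of the sequence. -/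
def Realizable {X : Type*} [DecidableEq X] (C : Finset (Finset X)) (s : List (X × Bool)) : Prop :=
  ∃ c ∈ C, ∀ q ∈ s, q.2 = decide (q.1 ∈ c)

/-- Littlestone's dimension: the least mistake bound of an online algorithm, over all realizable
sequences of distinct points. -/
noncomputable def ldim {X : Type*} [DecidableEq X] (C : Finset (Finset X)) : ℕ :=
  sInf {d : ℕ | ∃ A : OnlineAlgorithm X, ∀ s : List (X × Bool),
    (s.map Prod.fst).Nodup → Realizable C s → A.mistakes [] s ≤ d}

/-! ### Parameterized approximation -/

/-- The concept class of a binary matrix, whose rows are the points of the domain and whose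
columns are the concepts. -/
def conceptClass {m c : ℕ} (M : Matrix (Fin m) (Fin c) Bool) : Finset (Finset (Fin m)) :=
  univ.image fun j => univ.filter fun i => M i j = true

/-- A parameter (in unary) and a binary matrix (column by column) as the input of a program. -/
def encodeInstance (k : ℕ) {m c : ℕ} (M : Matrix (Fin m) (Fin c) Bool) : Data :=
  .cons (Data.ofNat k) (Data.ofList
    (fun j => Data.ofList (fun i => Data.ofBool (M i j)) (List.finRange m)) (List.finRange c))

/-- `p` is an `α`-approximation FPT algorithm for the dimension `dim`: in time
`f(k) * n ^ O(1)`, with `f` computable and `n` the size of the matrix, it distinguishes (with error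
probability at most `1 / 3`) between the nonempty classes with `dim ≥ k` and those with
`dim < k / α(k)`. Classes are given without repeated columns. -/
def IsFPTApprox (dim : ∀ {m : ℕ}, Finset (Finset (Fin m)) → ℕ) (α : ℕ → ℝ) (p : Prog) : Prop :=
  ∃ (f : ℕ → ℕ) (e : ℕ), Computable f ∧
    ∀ (k m c : ℕ) (M : Matrix (Fin m) (Fin c) Bool), 0 < c → Function.Injective M.transpose →
      p.HaltsWithin (encodeInstance k M) (f k * (m * c + 1) ^ e) ∧
      (k ≤ dim (conceptClass M) →
        2 / 3 ≤ p.acceptProb (encodeInstance k M) (f k * (m * c + 1) ^ e)) ∧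
      ((dim (conceptClass M) : ℝ) < k / α k →
        p.acceptProb (encodeInstance k M) (f k * (m * c + 1) ^ e) ≤ 1 / 3)

/-- A sequence of nonnegative reals is computable: rational approximations of any precision can be
computed. -/
def ComputableSeq (α : ℕ → ℝ) : Prop :=
  ∃ a : ℕ → ℕ → ℕ, Computable₂ a ∧ ∀ k r, |α k - a k r / (r + 1)| ≤ 1 / (r + 1)

end VCHard

/-! ### Probabilistic semantics of programs: halting, folds, independence of the cut-off. -/

namespace VCHard

/-! ### Runs of programs -/

/-! From an approximation algorithm `p` one builds a distinguisher for planted cliques. Given a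
graph on `N` vertices, take a very slowly growing `k = κ(N)`, a tuple length `l = o(log N)` and a
marking probability `2 ^ (-j)`. The rows of a matrix are the pairs of a unit vector of length `k`
and an `l`-tuple of vertices; the columns are the pairs of a vector in `{0,1}^k` and an `l`-tuple.
Every row and every column is marked independently. An entry is 1 if row and column are marked,
their vectors have a common 1, and every vertex of one tuple is equal or adjacent to every vertex of
the other. Unmarked candidates stay in the matrix, so that its dimensions are not random, and an
identity block at the bottom makes the columns distinct.

Completeness (`reduction_complete`, `le_vcDim`): if there is a clique with about `N ^ δ` vertices,
then with high probability each of the vectors has a marked tuple inside the clique. For these rows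
and columns the adjacency condition is void, so the `k` rows are shattered and the VC dimension is
at least `k`.

Soundness (`reduction_sound`, `ldim_matrixOf_le`): a random graph has no two disjoint completely
joined sets of size `h = 4 * Nat.log 2 N` (`randomGraph_exists_biclique_le`), and with high
probability no `s` marked tuples lie within `2 * h` vertices (`mark_crowded_le`). An all-1 submatrix
of size `s × s` outside the identity block would give two completely joined sets of size at least `2
* h`, up to equal vertices, and hence a forbidden pair. A class without `s` points common to more
than `s` concepts has Littlestone dimension at most `2 * s` (`ldim_le`): predict 0 until `s` ones
have appeared, then halve the few remaining concepts.

Since `VC ≤ Ldim` (`vcDim_le_ldim`), both dimensions are treated at once. As `α(k) = o(k)`, one can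
choose a computable `s` tending to infinity with `2 * s < k / α(k)`, and then `l` of order `log N /
s` suffices (`exists_parameters`). The matrix has size `N ^ O(l)`, so the distinguisher runs in time
`N ^ o(log N)`. A majority of three runs of `p` (`Prog.Computes.seq_majority`) makes room for the
errors of the reduction.

The rest shows that the distinguisher is a program. `PolyTime` and `PolyTimeR` form a calculus of
polynomial-time functions, and `exists_slow` supplies `κ`: it searches for the largest parameter at
which the given computable functions can be evaluated with loops of at most `N` rounds. -/

theorem _root_.PMF.bind_congr_support {A B : Type*} {P : PMF A} {F G : A → PMF B}
    (h : ∀ a ∈ P.support, F a = G a) : P.bind F = P.bind G := by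
  ext b
  simp only [PMF.bind_apply]
  refine tsum_congr fun a => ?_
  by_cases ha : P a = 0
  · simp [ha]
  · rw [h a ((PMF.mem_support_iff _ _).2 ha)]

/-- The outcome `O` always halts within `t` steps, with result distributed as `P`. -/
structure Outcome.Yields (O : Outcome) (P : PMF Data) (t : ℕ) : Prop where
  halts : ∀ o ∈ O.support, ∃ y s, o = some (y, s) ∧ s ≤ t
  result : O.map (Option.map Prod.fst) = P.map some

namespace Outcome.Yields

variable {O : Outcome} {P : PMF Data} {s t : ℕ}

theorem mono (h : O.Yields P s) (hst : s ≤ t) : O.Yields P t :=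
  ⟨fun o ho => let ⟨y, r, e, hr⟩ := h.halts o ho; ⟨y, r, e, hr.trans hst⟩, h.result⟩

theorem ret (y : Data) (s : ℕ) : (Outcome.ret y s).Yields (PMF.pure y) s := by
  constructor
  · intro o ho
    rw [Outcome.ret, PMF.mem_support_pure_iff] at ho
    exact ⟨y, s, ho, le_rfl⟩
  · simp [Outcome.ret, PMF.pure_map]

theorem delay (h : O.Yields P t) (s : ℕ) : (Outcome.delay s O).Yields P (s + t) := by
  constructor
  · intro o ho
    rw [Outcome.delay, PMF.mem_support_map_iff] at ho
    obtain ⟨o', ho', rfl⟩ := ho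
    obtain ⟨y, r, rfl, hr⟩ := h.halts o' ho'
    exact ⟨y, s + r, rfl, by lia⟩
  · rw [Outcome.delay, PMF.map_comp, ← h.result]
    congr 1
    funext o
    cases o <;> rfl

theorem mem_support (h : O.Yields P t) {y : Data} {r : ℕ} (ho : some (y, r) ∈ O.support) :
    y ∈ P.support := by
  have : some y ∈ (P.map some).support := by
    rw [← h.result, PMF.mem_support_map_iff]
    exact ⟨_, ho, rfl⟩
  rw [PMF.mem_support_map_iff] at this
  obtain ⟨z, hz, e⟩ := this
  cases e
  exact hz

theorem andThen (h : O.Yields P t) {F : Data → Outcome} {G : Data → PMF Data}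
    (hF : ∀ y ∈ P.support, (F y).Yields (G y) s) :
    (O.andThen F).Yields (P.bind G) (t + s) := by
  constructor
  · intro o ho
    rw [Outcome.andThen, PMF.mem_support_bind_iff] at ho
    obtain ⟨o', ho', ho⟩ := ho
    obtain ⟨y, r, rfl, hr⟩ := h.halts o' ho'
    obtain ⟨z, q, e, hq⟩ := ((hF y (h.mem_support ho')).delay r).halts o ho
    exact ⟨z, q, e, by lia⟩
  · rw [Outcome.andThen, PMF.map_bind, PMF.map_bind]
    have : (P.bind fun y => (G y).map some) = (P.map some).bind
        (fun o => match o with | none => PMF.pure none | some y => (G y).map some) := by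
      rw [PMF.bind_map]; rfl
    rw [this, ← h.result, PMF.bind_map]
    refine PMF.bind_congr_support fun o ho => ?_
    obtain ⟨y, r, rfl, hr⟩ := h.halts o ho
    exact ((hF y (h.mem_support ho)).delay r).result

end Outcome.Yields

/-- Independently of any cut-off, the program `p` halts on input `x` within `t` steps, and its
result is distributed as `P`. -/
def Prog.Computes (p : Prog) (x : Data) (P : PMF Data) (t : ℕ) : Prop :=
  ∀ n, t ≤ n → (p.run n x).Yields P t

namespace Prog.Computes

variable {p q c : Prog} {x : Data} {P : PMF Data} {s t : ℕ}

theorem mono (h : p.Computes x P s) (hst : s ≤ t) : p.Computes x P t :=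
  fun n hn => (h n (hst.trans hn)).mono hst

theorem haltsWithin (h : p.Computes x P t) : p.HaltsWithin x t := (h t le_rfl).halts

theorem acceptProb (h : p.Computes x P t) :
    p.acceptProb x t = (P.toOuterMeasure {y | y ≠ .nil}).toReal := by
  have e : (p.run t x).map accepts
      = ((p.run t x).map (Option.map Prod.fst)).map
        (fun o => match o with | none => false | some y => decide (y ≠ Data.nil)) := by
    rw [PMF.map_comp]
    congr 1
    funext o
    cases o <;> rfl
  rw [Prog.acceptProb, e, (h t le_rfl).result, PMF.map_comp, ← PMF.toOuterMeasure_apply_singleton,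
    PMF.toOuterMeasure_map_apply]
  congr 2
  ext y
  simp

theorem id (x : Data) : Prog.id.Computes x (PMF.pure x) 1 := fun _ _ => .ret _ _
theorem nil (x : Data) : Prog.nil.Computes x (PMF.pure .nil) 1 := fun _ _ => .ret _ _
theorem hd (x : Data) : Prog.hd.Computes x (PMF.pure x.hd) 1 := fun _ _ => .ret _ _
theorem tl (x : Data) : Prog.tl.Computes x (PMF.pure x.tl) 1 := fun _ _ => .ret _ _

theorem flip (x : Data) :
    Prog.flip.Computes x ((PMF.uniformOfFintype Bool).map Data.ofBool) 1 := by
  intro n _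
  constructor
  · intro o ho
    rw [Prog.run, PMF.mem_support_map_iff] at ho
    obtain ⟨b, -, rfl⟩ := ho
    exact ⟨_, _, rfl, le_rfl⟩
  · rw [Prog.run, PMF.map_comp, PMF.map_comp]
    rfl

theorem seq {F : Data → PMF Data} (hp : p.Computes x P s)
    (hq : ∀ y ∈ P.support, q.Computes y (F y) t) :
    (Prog.seq p q).Computes x (P.bind F) (1 + (s + t)) := by
  intro n hn
  exact ((hp n (by lia)).andThen fun y hy => hq y hy n (by lia)).delay 1

theorem pair {Q : PMF Data} (hp : p.Computes x P s) (hq : q.Computes x Q t) :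
    (Prog.pair p q).Computes x (P.bind fun a => Q.map fun b => .cons a b) (1 + (s + t)) := by
  intro n hn
  refine Outcome.Yields.delay ((hp n (by lia)).andThen fun y hy => ?_) 1
  exact (hq n (by lia)).andThen (s := 0) fun b _ => .ret (Data.cons y b) 0

theorem ite {C Q : PMF Data} {r : ℕ} (hc : c.Computes x C r) (hp : p.Computes x P s)
    (hq : q.Computes x Q t) :
    (Prog.ite c p q).Computes x (C.bind fun b => if b = .nil then Q else P)
      (1 + (r + max s t)) := by
  intro n hn
  refine Outcome.Yields.delay ((hc n (by lia)).andThen fun y hy => ?_) 1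
  split_ifs
  · exact (hq n (by lia)).mono (le_max_right _ _)
  · exact (hp n (by lia)).mono (le_max_left _ _)

end Prog.Computes

/-! ### Folds -/

/-- A fold with random steps. -/
noncomputable def foldP {A S : Type*} (F : A → S → PMF S) : List A → S → PMF S
  | [], s => PMF.pure s
  | a :: l, s => (F a s).bind (foldP F l)

theorem foldP_append {A S : Type*} (F : A → S → PMF S) (l l' : List A) (s : S) :
    foldP F (l ++ l') s = (foldP F l s).bind (foldP F l') := by
  induction l generalizing s with
  | nil => simp [foldP, PMF.pure_bind]
  | cons a l ih => simp only [List.cons_append, foldP, PMF.bind_bind]; congr 1; funext s; exact ih s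

theorem foldP_pure {A S : Type*} (f : A → S → S) (l : List A) (s : S) :
    foldP (fun a s => PMF.pure (f a s)) l s = PMF.pure (l.foldl (fun s a => f a s) s) := by
  induction l generalizing s with
  | nil => rfl
  | cons a l ih => simp [foldP, PMF.pure_bind, ih]

/-- This serves both to pass from trees to the objects they encode and to rename the vertices in the
reduction. -/
theorem foldP_map {A S B T : Type*} {F : A → S → PMF S} {G : B → T → PMF T} (e : A → B)
    (u : S → T) (h : ∀ a s, G (e a) (u s) = (F a s).map u) (l : List A) (s : S) :
    foldP G (l.map e) (u s) = (foldP F l s).map u := by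
  induction l generalizing s with
  | nil => simp [foldP, PMF.pure_map]
  | cons a l ih =>
    simp only [List.map_cons, foldP, h, PMF.bind_map, PMF.map_bind]
    congr 1; funext s; exact ih s

/-- The tree whose right spine carries the given list. -/
def Data.list : List Data → Data := Data.ofList fun d => d

/-- The state of a program that folds over a list: the context, the accumulator, and the part of
the list that is still to be processed. -/
def foldState (env : Data) (l : List Data) (a : Data) : Data := .cons (.cons env a) (Data.list l)

/-- The invariant `Inv` restricts the assumption on the body to accumulators that can really occur;
the running time of the body is under control only there. Each round costs `1 + tc + tp`, and the
last test costs `1 + tc`. -/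
theorem Outcome.Yields.iterate {c p : Data → Outcome} {F : Data → Data → PMF Data} (env : Data)
    {tc tp : ℕ} {Inv : List Data → Data → Prop}
    (hc : ∀ l a, (c (foldState env l a)).Yields (PMF.pure (Data.list l)) tc)
    (hp : ∀ d l a, Inv (d :: l) a →
      (p (foldState env (d :: l) a)).Yields ((F d a).map (foldState env l)) tp)
    (hInv : ∀ d l a, Inv (d :: l) a → ∀ b ∈ (F d a).support, Inv l b)
    (l : List Data) (a : Data) (ha : Inv l a) {n : ℕ} (hn : l.length + 1 ≤ n) :
    (Outcome.iterate c p n (foldState env l a)).Yields ((foldP F l a).map (foldState env []))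
      (l.length * (1 + tc + tp) + 1 + tc) := by
  induction l generalizing a n with
  | nil =>
    obtain ⟨n, rfl⟩ : ∃ m, n = m + 1 := ⟨n - 1, by simp at hn; lia⟩
    rw [Outcome.iterate]
    have := ((hc [] a).andThen (s := 0) (F := fun b => if b = .nil then
      Outcome.ret (foldState env [] a) 0 else (p (foldState env [] a)).andThen
        (Outcome.iterate c p n)) (G := fun _ => PMF.pure (foldState env [] a)) (by
        intro y hy
        rw [PMF.mem_support_pure_iff] at hy
        subst hy
        rw [if_pos (by rfl)]
        exact .ret _ _)).delay 1
    rw [PMF.pure_bind] at this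
    simpa [foldP, PMF.pure_map] using this
  | cons d l ih =>
    obtain ⟨n, rfl⟩ : ∃ m, n = m + 1 := ⟨n - 1, by simp at hn; lia⟩
    rw [Outcome.iterate]
    have := ((hc (d :: l) a).andThen (s := tp + (l.length * (1 + tc + tp) + 1 + tc))
      (F := fun b => if b = .nil then
      Outcome.ret (foldState env (d :: l) a) 0 else (p (foldState env (d :: l) a)).andThen
        (Outcome.iterate c p n))
      (G := fun _ => ((F d a).map (foldState env l)).bind fun y => (foldP F l y.hd.tl).map
        (foldState env [])) (by
        intro y hy
        rw [PMF.mem_support_pure_iff] at hy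
        subst hy
        rw [if_neg (by simp [Data.list, Data.ofList])]
        refine (hp d l a ha).andThen fun y hy => ?_
        rw [PMF.mem_support_map_iff] at hy
        obtain ⟨b, hb, rfl⟩ := hy
        exact ih b (hInv d l a ha b hb) (by simp at hn ⊢; lia))).delay 1
    rw [PMF.pure_bind, PMF.bind_map] at this
    rw [foldP, PMF.map_bind]
    refine Outcome.Yields.mono this ?_
    simp only [List.length_cons]
    ring_nf
    rfl

/-- Fold the program `p` over the list which the program `l` computes, starting from the result of
`s`. The program `p` is given the context, the entry of the list, and the accumulator. -/
def Prog.fold (l s p : Prog) : Prog :=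
  .seq (.seq (.pair (.pair .id s) l)
    (.loop .tl (.pair (.pair (.seq .hd .hd)
      (.seq (.pair (.pair (.seq .hd .hd) (.seq .tl .hd)) (.seq .hd .tl)) p)) (.seq .tl .tl))))
    (.seq .hd .tl)

/-- The body is timed only on accumulators that are reachable after a proper prefix of `L`. This is
the place where bounds for intermediate results can enter. -/
theorem Prog.Computes.fold {pl ps p : Prog} {x : Data} {S : PMF Data} {tl ts tp : ℕ}
    {L : List Data} {F : Data → Data → PMF Data} (hl : pl.Computes x (PMF.pure (Data.list L)) tl)
    (hs : ps.Computes x S ts)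
    (hp : ∀ l₁ d l₂, L = l₁ ++ d :: l₂ → ∀ a ∈ (S.bind (foldP F l₁)).support,
      p.Computes (.cons (.cons x d) a) (F d a) tp) :
    (Prog.fold pl ps p).Computes x (S.bind (foldP F L))
      (30 * (L.length + 1) + tl + ts + L.length * tp) := by
  have h1 := (Prog.Computes.id x).pair hs |>.pair hl
  have e1 : ((PMF.pure x).bind fun a => S.map fun b => Data.cons a b).bind
      (fun a => (PMF.pure (Data.list L)).map fun b => a.cons b) = S.map (foldState x L) := by
    simp only [PMF.pure_bind, PMF.pure_map, PMF.bind_map, Function.comp_def]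
    rfl
  rw [e1] at h1
  set B : Prog := .pair (.pair (.seq .hd .hd)
      (.seq (.pair (.pair (.seq .hd .hd) (.seq .tl .hd)) (.seq .hd .tl)) p)) (.seq .tl .tl)
  have hB : ∀ l₁ d l₂, L = l₁ ++ d :: l₂ → ∀ a ∈ (S.bind (foldP F l₁)).support,
      B.Computes (foldState x (d :: l₂) a) ((F d a).map (foldState x l₂)) (tp + 24) := by
    intro l₁ d l₂ hL a ha
    set y := foldState x (d :: l₂) a with hy
    have a1 := (Prog.Computes.hd y).seq (F := fun y => PMF.pure y.hd) (fun z _ => .hd z)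
    have a2 := (Prog.Computes.tl y).seq (F := fun y => PMF.pure y.hd) (fun z _ => .hd z)
    have a3 := (Prog.Computes.hd y).seq (F := fun y => PMF.pure y.tl) (fun z _ => .tl z)
    have a4 := (Prog.Computes.tl y).seq (F := fun y => PMF.pure y.tl) (fun z _ => .tl z)
    have a5 := (a1.pair a2).pair a3
    simp only [PMF.pure_bind, PMF.pure_map] at a5 a1 a4
    have a6 := a5.seq (F := fun _ => F d a) (t := tp) (q := p) (by
      intro z hz
      rw [PMF.mem_support_pure_iff] at hz
      subst hz
      exact hp l₁ d l₂ hL a ha)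
    have a7 := (a1.pair a6).pair a4
    simp only [PMF.pure_bind, PMF.pure_map, PMF.bind_map] at a7
    refine Prog.Computes.mono a7 (by lia)
  have h2 : ∀ y ∈ (S.map (foldState x L)).support, (Prog.loop .tl B).Computes y
      ((foldP F L y.hd.tl).map (foldState x [])) (L.length * (1 + 1 + (tp + 24)) + 1 + 1) := by
    intro y hy n hn
    rw [PMF.mem_support_map_iff] at hy
    obtain ⟨a, ha, rfl⟩ := hy
    refine Outcome.Yields.iterate x (tc := 1) (tp := tp + 24) (F := F)
      (Inv := fun l₂ a => ∃ l₁, L = l₁ ++ l₂ ∧ a ∈ (S.bind (foldP F l₁)).support)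
      (fun l a => .ret _ _) ?_ ?_ L a ⟨[], rfl, ?_⟩ ?_
    · rintro d l b ⟨l₁, e, hb⟩
      -- The cut-off `n` is at least the time for the whole loop. The list is nonempty here, so `n`
      -- exceeds the time of one round and the second case is void.
      rcases le_or_gt (tp + 24) n with h | h
      · exact hB l₁ d l e b hb n h
      · have : 1 ≤ L.length := by rw [e, List.length_append, List.length_cons]; lia
        have : 1 * (1 + 1 + (tp + 24)) ≤ L.length * (1 + 1 + (tp + 24)) :=
          Nat.mul_le_mul_right _ this
        lia
    · rintro d l b ⟨l₁, e, hb⟩ b' hb'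
      refine ⟨l₁ ++ [d], by simp [e], ?_⟩
      have : foldP F (l₁ ++ [d]) = fun s => (foldP F l₁ s).bind (F d) := by
        funext s
        rw [foldP_append]
        congr 1
        funext s
        simp [foldP]
      rw [this, ← PMF.bind_bind, PMF.mem_support_bind_iff]
      exact ⟨b, hb, hb'⟩
    · simpa [foldP] using ha
    · nlinarith
  have h3 := h1.seq h2
  rw [PMF.bind_map] at h3
  have h4 := h3.seq (F := fun y => PMF.pure y.hd.tl) (t := 3) (q := .seq .hd .tl) (by
    intro y _
    have := (Prog.Computes.hd y).seq (F := fun y => PMF.pure y.tl) (fun z _ => .tl z)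
    rwa [PMF.pure_bind] at this)
  rw [PMF.bind_bind] at h4
  have e2 : (fun a => ((((fun y : Data => (foldP F L y.hd.tl).map (foldState x [])) ∘
      foldState x L) a).bind fun y => PMF.pure y.hd.tl)) = foldP F L := by
    funext a
    simp only [Function.comp_def, PMF.bind_map]
    exact PMF.bind_pure _
  rw [e2] at h4
  refine Prog.Computes.mono h4 ?_
  ring_nf
  lia

/-! ### The cut-off does not matter for halting runs -/

/-- `P` and `Q` agree but for some mass of `P` on `none` which `Q` moves elsewhere. -/
def Outcome.Below (P Q : Outcome) : Prop := ∀ q, P (some q) ≤ Q (some q)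

namespace Outcome.Below

theorem refl (P : Outcome) : P.Below P := fun _ => le_rfl

theorem pure_none (P : Outcome) : Outcome.Below (PMF.pure none) P := fun q => by
  rw [PMF.pure_apply_of_ne _ _ (by simp)]; exact zero_le

/-- Mass that `P` has on `none` may sit anywhere in `Q`; this does no harm because `F` keeps a
cut-off run cut off. -/
theorem bind {P Q : Outcome} {F G : Option (Data × ℕ) → Outcome} (h : P.Below Q)
    (hF : F none = PMF.pure none) (hFG : ∀ q, (F (some q)).Below (G (some q))) :
    Outcome.Below (P.bind F) (Q.bind G) := by
  intro q
  simp only [PMF.bind_apply]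
  refine ENNReal.tsum_le_tsum fun o => ?_
  cases o with
  | none => rw [hF, PMF.pure_apply_of_ne _ _ (by simp), mul_zero]; exact zero_le
  | some r => exact mul_le_mul' (h r) (hFG r q)

theorem delay {P Q : Outcome} (h : P.Below Q) (s : ℕ) :
    (Outcome.delay s P).Below (Outcome.delay s Q) := by
  refine h.bind rfl fun q => refl _

theorem andThen {P Q : Outcome} {F G : Data → Outcome} (h : P.Below Q)
    (hFG : ∀ y, (F y).Below (G y)) : (P.andThen F).Below (Q.andThen G) :=
  h.bind rfl fun q => (hFG q.1).delay q.2

theorem iterate {c c' p p' : Data → Outcome} (hc : ∀ x, (c x).Below (c' x))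
    (hp : ∀ x, (p x).Below (p' x)) {n n' : ℕ} (hn : n ≤ n') (x : Data) :
    (Outcome.iterate c p n x).Below (Outcome.iterate c' p' n' x) := by
  induction n generalizing n' x with
  | zero => exact pure_none _
  | succ n ih =>
    obtain ⟨n', rfl⟩ : ∃ m, n' = m + 1 := ⟨n' - 1, by lia⟩
    rw [Outcome.iterate, Outcome.iterate]
    refine ((hc x).andThen fun y => ?_).delay 1
    split_ifs
    · exact refl _
    · exact (hp x).andThen fun y => ih (by lia) y

theorem run {n n' : ℕ} (hn : n ≤ n') (p : Prog) (x : Data) : (p.run n x).Below (p.run n' x) := by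
  induction p generalizing x with
  | id | nil | hd | tl | flip => exact refl _
  | pair p q hp hq =>
    exact Outcome.Below.delay ((hp x).andThen fun a => (hq x).andThen fun b => refl _) 1
  | seq p q hp hq => exact Outcome.Below.delay ((hp x).andThen hq) 1
  | ite c p q hc hp hq =>
    refine Outcome.Below.delay ((hc x).andThen fun b => ?_) 1
    split_ifs
    · exact hq x
    · exact hp x
  | loop c p hc hp => exact iterate hc hp hn x

/-- Without mass on `none` the inequality holds at every point, and two distributions of total mass
1 cannot satisfy it strictly anywhere. -/
theorem eq_of_support {P Q : Outcome} (h : P.Below Q) (hP : P none = 0) : P = Q := by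
  have hle : ∀ o, P o ≤ Q o := by
    intro o
    cases o with
    | none => rw [hP]; exact zero_le
    | some q => exact h q
  ext o
  refine le_antisymm (hle o) ?_
  by_contra hlt
  rw [not_le] at hlt
  have h1 : ∑' o, P o < ∑' o, Q o :=
    ENNReal.tsum_lt_tsum (by rw [P.tsum_coe]; simp) hle hlt
  rw [P.tsum_coe, Q.tsum_coe] at h1
  exact lt_irrefl _ h1

end Outcome.Below

/-- Halting is defined at the single cut-off `t`. A larger cut-off can only move mass away from
`none`, and there is none to move. -/
theorem Prog.HaltsWithin.computes {p : Prog} {x : Data} {t : ℕ} (h : p.HaltsWithin x t) :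
    ∃ P, p.Computes x P t := by
  have key : (p.run t x).Yields ((p.run t x).map fun o => (o.map Prod.fst).getD .nil) t := by
    refine ⟨h, ?_⟩
    rw [PMF.map_comp]
    refine PMF.bind_congr_support fun o ho => ?_
    obtain ⟨y, s, rfl, -⟩ := h o ho
    rfl
  refine ⟨(p.run t x).map fun o => (o.map Prod.fst).getD .nil, fun n hn => ?_⟩
  rw [← (Outcome.Below.run hn p x).eq_of_support]
  · exact key
  · by_contra hne
    obtain ⟨y, s, e, -⟩ := h none ((PMF.mem_support_iff _ _).2 hne)
    cases e

end VCHard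

/-! ### Sizes of encodings and a calculus of randomized polynomial time. -/

namespace VCHard

theorem Outcome.Yields.eq_map {O : Outcome} {P : PMF Data} {t : ℕ} (h : O.Yields P t) :
    P = O.map fun o => (o.map Prod.fst).getD .nil := by
  have := congrArg (PMF.map fun o => o.getD Data.nil) h.result
  rw [PMF.map_comp, PMF.map_comp] at this
  rw [show (fun o : Option (Data × ℕ) => (o.map Prod.fst).getD .nil)
    = (fun o => o.getD Data.nil) ∘ Option.map Prod.fst from rfl, this]
  exact (PMF.map_id P).symm

theorem Prog.Computes.unique {p : Prog} {x : Data} {P Q : PMF Data} {s t : ℕ}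
    (hP : p.Computes x P s) (hQ : p.Computes x Q t) : P = Q :=
  (hP (max s t) (le_max_left _ _)).eq_map.trans (hQ (max s t) (le_max_right _ _)).eq_map.symm

/-! ### Encodings and sizes -/

/-- The number of nodes of a tree. -/
def Data.size : Data → ℕ
  | .nil => 1
  | .cons a b => a.size + b.size + 1

/-- An encoding of the elements of a type as trees. -/
class Enc (A : Type) where
  /-- the tree that encodes an element -/
  enc : A → Data

open Enc (enc)

instance : Enc Unit := ⟨fun _ => .nil⟩
instance : Enc Bool := ⟨Data.ofBool⟩
instance : Enc ℕ := ⟨Data.ofNat⟩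
instance {A B : Type} [Enc A] [Enc B] : Enc (A × B) := ⟨fun q => .cons (enc q.1) (enc q.2)⟩
instance {A : Type} [Enc A] : Enc (List A) := ⟨Data.ofList enc⟩
instance {A : Type} [Enc A] : Enc (Option A) :=
  ⟨fun o => enc o.toList⟩

/-- The size of an encoding. -/
def sz {A : Type} [Enc A] (a : A) : ℕ := (enc a).size

section Size

variable {A B : Type} [Enc A] [Enc B]

theorem sz_pair (q : A × B) : sz q = sz q.1 + sz q.2 + 1 := rfl
theorem sz_nil : sz ([] : List A) = 1 := rfl
theorem sz_cons (a : A) (l : List A) : sz (a :: l) = sz a + sz l + 1 := rfl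
theorem sz_none : sz (none : Option A) = 1 := rfl
theorem sz_some (a : A) : sz (some a) = sz a + 2 := rfl
theorem sz_bool (b : Bool) : sz b ≤ 3 := by cases b <;> decide
theorem sz_pos (a : A) : 1 ≤ sz a := by
  rw [sz]; cases enc a <;> simp [Data.size]

theorem sz_nat (n : ℕ) : sz n = 2 * n + 1 := by
  induction n with
  | zero => rfl
  | succ n ih => have : sz (n + 1) = 1 + sz n + 1 := rfl
                 lia

theorem sz_append (l l' : List A) : sz (l ++ l') + 1 = sz l + sz l' := by
  induction l with
  | nil => simp [sz_nil, add_comm]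
  | cons a l ih => simp only [List.cons_append, sz_cons]; lia

theorem length_le_sz (l : List A) : l.length + 1 ≤ sz l := by
  induction l with
  | nil => simp [sz_nil]
  | cons a l ih => simp only [List.length_cons, sz_cons]; lia

theorem sz_le_of_mem {a : A} {l : List A} (h : a ∈ l) : sz a + 1 ≤ sz l := by
  induction l with
  | nil => simp at h
  | cons b l ih =>
    have := sz_pos b
    have := sz_pos l
    rw [sz_cons]
    rcases List.mem_cons.1 h with rfl | h
    · lia
    · have := ih h; lia

theorem sz_list_le {l : List A} {b : ℕ} (h : ∀ a ∈ l, sz a ≤ b) :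
    sz l ≤ l.length * (b + 1) + 1 := by
  induction l with
  | nil => simp [sz_nil]
  | cons a l ih =>
    have h1 := ih fun a ha => h a (List.mem_cons_of_mem _ ha)
    have h2 := h a List.mem_cons_self
    rw [sz_cons, List.length_cons, add_mul]
    lia

theorem sz_prefix {l l' : List A} (h : l' <+: l) : sz l' ≤ sz l := by
  obtain ⟨r, rfl⟩ := h
  have := sz_append l' r
  have := sz_pos r
  lia

theorem sz_reverse (l : List A) : sz l.reverse = sz l := by
  induction l with
  | nil => rfl
  | cons a l ih =>
    have := sz_append l.reverse [a]
    rw [sz_cons, sz_nil] at this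
    rw [List.reverse_cons, sz_cons]
    lia

end Size

/-! ### Polynomially bounded functions -/

/-- `b` is bounded by a polynomial in `w`. -/
def PolyIn {X : Type*} (w b : X → ℕ) : Prop := ∃ c, ∀ x, b x ≤ (w x + 2) ^ c

namespace PolyIn

variable {X : Type*} {w b b' : X → ℕ}

theorem mono (h : PolyIn w b') (hb : ∀ x, b x ≤ b' x) : PolyIn w b :=
  let ⟨c, hc⟩ := h; ⟨c, fun x => (hb x).trans (hc x)⟩

theorem self (w : X → ℕ) : PolyIn w w := ⟨1, fun x => by lia⟩

theorem add (h : PolyIn w b) (h' : PolyIn w b') : PolyIn w (fun x => b x + b' x) := by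
  obtain ⟨c, hc⟩ := h
  obtain ⟨c', hc'⟩ := h'
  -- The base is at least 2, so one more factor absorbs the sum of two powers.
  refine ⟨max c c' + 1, fun x => ?_⟩
  have h1 := (hc x).trans (Nat.pow_le_pow_right (by lia : 0 < w x + 2) (le_max_left c c'))
  have h2 := (hc' x).trans (Nat.pow_le_pow_right (by lia : 0 < w x + 2) (le_max_right c c'))
  rw [pow_succ, mul_add]
  have : 0 ≤ (w x + 2) ^ max c c' * w x := Nat.zero_le _
  lia

theorem mul (h : PolyIn w b) (h' : PolyIn w b') : PolyIn w (fun x => b x * b' x) := by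
  obtain ⟨c, hc⟩ := h
  obtain ⟨c', hc'⟩ := h'
  refine ⟨c + c', fun x => ?_⟩
  rw [pow_add]
  exact Nat.mul_le_mul (hc x) (hc' x)

theorem const (w : X → ℕ) (k : ℕ) : PolyIn w (fun _ => k) :=
  ⟨k, fun x => (Nat.lt_two_pow_self (n := k)).le.trans (Nat.pow_le_pow_left (by lia) _)⟩

theorem pow (h : PolyIn w b) (k : ℕ) : PolyIn w (fun x => b x ^ k) := by
  obtain ⟨c, hc⟩ := h
  refine ⟨c * k, fun x => ?_⟩
  rw [pow_mul]
  exact Nat.pow_le_pow_left (hc x) _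

theorem comp (h : PolyIn w b) (k : ℕ) : PolyIn w (fun x => (b x + 2) ^ k) :=
  (h.add (const w 2)).pow k

end PolyIn

/-! ### Polynomial time

A function is computed in polynomial time relative to a weight `w` if time and output size are
bounded by a polynomial in the weight. -/

section Poly

variable {X A B C S : Type} [Enc X] [Enc A] [Enc B] [Enc C] [Enc S] {w : X → ℕ}

/-- A program computes the random function `f` in time polynomial in `w`; the weight dominates the
size of the input. -/
def PolyTimeR (w : X → ℕ) (f : X → PMF B) : Prop :=
  PolyIn w sz ∧ ∃ (p : Prog) (b : X → ℕ), PolyIn w b ∧ ∀ x,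
    p.Computes (enc x) ((f x).map enc) (b x) ∧ ∀ y ∈ (f x).support, sz y ≤ b x

/-- A program computes the function `f` in time polynomial in `w`. -/
def PolyTime (w : X → ℕ) (f : X → B) : Prop := PolyTimeR w fun x => PMF.pure (f x)

theorem PolyTime.weight {f : X → B} (h : PolyTime w f) : PolyIn w sz := h.1

theorem PolyTime.mk (hw : PolyIn w sz) {f : X → B} {p : Prog} {b : X → ℕ} (hb : PolyIn w b)
    (h : ∀ x, p.Computes (enc x) (PMF.pure (enc (f x))) (b x)) (hs : ∀ x, sz (f x) ≤ b x) :
    PolyTime w f := by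
  refine ⟨hw, p, b, hb, fun x => ⟨?_, fun y hy => ?_⟩⟩
  · rw [PMF.pure_map]; exact h x
  · rw [PMF.mem_support_pure_iff] at hy
    rw [hy]; exact hs x

theorem PolyTime.size {f : X → B} (h : PolyTime w f) : PolyIn w fun x => sz (f x) := by
  obtain ⟨hw, p, b, hb, h⟩ := h
  exact hb.mono fun x => (h x).2 _ (by simp)

theorem PolyTime.of_enc_eq (hw : PolyIn w sz) {f : X → B} (h : ∀ x, enc (f x) = enc x) :
    PolyTime w f :=
  .mk (p := .id) (b := fun x => 1 + sz x) hw ((PolyIn.const w 1).add hw)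
    (fun x => by rw [h]; exact (Prog.Computes.id _).mono (by lia))
    (fun x => by rw [sz, h]; exact Nat.le_add_left _ _)

theorem PolyTime.id (hw : PolyIn w sz) : PolyTime w (fun x => x) := .of_enc_eq hw fun _ => rfl

/-- Polynomials compose: the weight bounds the size of the intermediate result, and `g` is
polynomial in that size. -/
theorem PolyTimeR.comp {f : X → PMF A} {g : A → PMF B} (hg : PolyTimeR sz g)
    (hf : PolyTimeR w f) : PolyTimeR w (fun x => (f x).bind g) := by
  obtain ⟨-, q, b', ⟨c, hc⟩, hq⟩ := hg
  obtain ⟨hw, p, b, hb, hp⟩ := hf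
  have hle : ∀ x, ∀ y ∈ (f x).support, b' y ≤ (b x + 2) ^ c := fun x y hy =>
    (hc y).trans (Nat.pow_le_pow_left (Nat.add_le_add_right ((hp x).2 y hy) 2) c)
  refine ⟨hw, .seq p q, fun x => 1 + (b x + (b x + 2) ^ c),
    (PolyIn.const w 1).add (hb.add (hb.comp c)), fun x => ⟨?_, fun y hy => ?_⟩⟩
  -- Encodings are not assumed injective. The distribution of `q` on a tree is therefore read off
  -- from a run with a cut-off that suffices for some preimage; by `Prog.Computes.unique` the choice
  -- of the preimage is immaterial.
  · have := Prog.Computes.seq (q := q) (t := (b x + 2) ^ c)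
      (F := fun y => (q.run (Classical.epsilon fun t => ∃ a ∈ (f x).support, enc a = y ∧ b' a ≤ t) y).map fun o => (o.map Prod.fst).getD .nil) (hp x).1 (by
        intro y hy
        rw [PMF.mem_support_map_iff] at hy
        obtain ⟨a, ha, rfl⟩ := hy
        have := Classical.epsilon_spec (p := fun t => ∃ a' ∈ (f x).support, enc a' = enc a ∧ b' a' ≤ t)
          ⟨b' a, a, ha, rfl, le_rfl⟩
        obtain ⟨a', ha', e, ht⟩ := this
        have h1 := (hq a').1 _ ht
        rw [e] at h1
        rw [← h1.eq_map, ← e]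
        exact (hq a').1.mono (hle x a' ha'))
    rw [PMF.bind_map] at this
    rw [PMF.map_bind]
    convert this using 1
    refine PMF.bind_congr_support fun a ha => ?_
    have := Classical.epsilon_spec (p := fun t => ∃ a' ∈ (f x).support, enc a' = enc a ∧ b' a' ≤ t)
          ⟨b' a, a, ha, rfl, le_rfl⟩
    obtain ⟨a', ha', e, ht⟩ := this
    have h1 := (hq a').1 _ ht
    rw [e] at h1
    simp only [Function.comp]
    rw [← h1.eq_map]
    have h2 := (hq a').1
    rw [e] at h2
    exact (hq a).1.unique h2
  · rw [PMF.mem_support_bind_iff] at hy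
    obtain ⟨a, ha, hy⟩ := hy
    have := (hq a).2 y hy
    have := hle x a ha
    lia

theorem PolyTime.compR {f : X → A} {g : A → PMF B} (hg : PolyTimeR sz g) (hf : PolyTime w f) :
    PolyTimeR w (fun x => g (f x)) := by
  have := PolyTimeR.comp hg hf
  simpa only [PMF.pure_bind] using this

theorem PolyTimeR.map {f : X → PMF A} {g : A → B} (hg : PolyTime sz g) (hf : PolyTimeR w f) :
    PolyTimeR w (fun x => (f x).map g) := PolyTimeR.comp hg hf

theorem PolyTime.comp {f : X → A} {g : A → B} (hg : PolyTime sz g) (hf : PolyTime w f) :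
    PolyTime w (fun x => g (f x)) :=
  PolyTime.compR (g := fun a => PMF.pure (g a)) hg hf

theorem PolyTimeR.prodMk {f : X → PMF A} {g : X → PMF B} (hf : PolyTimeR w f)
    (hg : PolyTimeR w g) :
    PolyTimeR w (fun x => (f x).bind fun a => (g x).map fun b => (a, b)) := by
  obtain ⟨hw, p, b, hb, hp⟩ := hf
  obtain ⟨-, q, b', hb', hq⟩ := hg
  refine ⟨hw, .pair p q, fun x => 1 + (b x + b' x), (PolyIn.const w 1).add (hb.add hb'),
    fun x => ⟨?_, fun y hy => ?_⟩⟩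
  · have := (hp x).1.pair (hq x).1
    rw [PMF.bind_map] at this
    rw [PMF.map_bind]
    simp only [PMF.map_comp, Function.comp_def] at this ⊢
    exact this
  · rw [PMF.mem_support_bind_iff] at hy
    obtain ⟨a, ha, hy⟩ := hy
    rw [PMF.mem_support_map_iff] at hy
    obtain ⟨c, hc, rfl⟩ := hy
    have := (hp x).2 a ha
    have := (hq x).2 c hc
    rw [sz_pair]
    lia

theorem PolyTime.prodMk {f : X → A} {g : X → B} (hf : PolyTime w f) (hg : PolyTime w g) :
    PolyTime w (fun x => (f x, g x)) := by
  have := PolyTimeR.prodMk hf hg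
  simp only [PMF.pure_bind, PMF.pure_map] at this
  exact this

theorem PolyTime.fst : PolyTime sz (Prod.fst : A × B → A) :=
  .mk (p := .hd) (b := fun x => sz x) (PolyIn.self _) (PolyIn.self _)
    (fun x => (Prog.Computes.hd _).mono (sz_pos x)) (fun x => by rw [sz_pair]; lia)

theorem PolyTime.snd : PolyTime sz (Prod.snd : A × B → B) :=
  .mk (p := .tl) (b := fun x => sz x) (PolyIn.self _) (PolyIn.self _)
    (fun x => (Prog.Computes.tl _).mono (sz_pos x)) (fun x => by rw [sz_pair]; lia)

theorem Prog.exists_const (d : Data) : ∃ (p : Prog) (t : ℕ), ∀ x, p.Computes x (PMF.pure d) t := by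
  induction d with
  | nil => exact ⟨.nil, 1, fun x => .nil x⟩
  | cons a b ha hb =>
    obtain ⟨p, s, hp⟩ := ha
    obtain ⟨q, t, hq⟩ := hb
    refine ⟨.pair p q, 1 + (s + t), fun x => ?_⟩
    have := (hp x).pair (hq x)
    rwa [PMF.pure_bind, PMF.pure_map] at this

theorem PolyTime.const (hw : PolyIn w sz) (y : B) : PolyTime w (fun _ => y) := by
  obtain ⟨p, t, hp⟩ := Prog.exists_const (enc y)
  exact .mk (p := p) (b := fun _ => t + sz y) hw (PolyIn.const w _)
    (fun x => (hp _).mono (by lia)) (fun x => by lia)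

theorem PolyTimeR.cond {c : X → Bool} {f g : X → PMF B} (hc : PolyTime w c) (hf : PolyTimeR w f)
    (hg : PolyTimeR w g) : PolyTimeR w (fun x => if c x then f x else g x) := by
  obtain ⟨hw, r, b'', hb'', hr⟩ := hc
  obtain ⟨-, p, b, hb, hp⟩ := hf
  obtain ⟨-, q, b', hb', hq⟩ := hg
  refine ⟨hw, .ite r p q, fun x => 1 + (b'' x + (b x + b' x)),
    (PolyIn.const w 1).add (hb''.add (hb.add hb')), fun x => ⟨?_, fun y hy => ?_⟩⟩
  · have := (hr x).1.ite (hp x).1 (hq x).1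
    rw [PMF.pure_map, PMF.pure_bind] at this
    refine Prog.Computes.mono (s := 1 + (b'' x + max (b x) (b' x))) ?_ (by lia)
    convert this using 1
    cases h : c x <;> simp [h, enc, Data.ofBool]
  · have h1 := (hp x).2 y
    have h2 := (hq x).2 y
    dsimp only at hy
    split_ifs at hy
    · have := h1 hy; lia
    · have := h2 hy; lia

theorem PolyTime.cond {c : X → Bool} {f g : X → B} (hc : PolyTime w c) (hf : PolyTime w f)
    (hg : PolyTime w g) : PolyTime w (fun x => if c x then f x else g x) := by
  have := PolyTimeR.cond hc hf hg
  refine Eq.mp ?_ this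
  rw [PolyTime]
  congr 1
  funext x
  split_ifs <;> rfl

theorem enc_list (l : List A) : enc l = Data.list (l.map enc) := by
  induction l with
  | nil => rfl
  | cons a l ih =>
    change Data.cons (enc a) (enc l) = Data.cons (enc a) (Data.list (l.map enc))
    rw [ih]

/-- The bound `b` for all intermediate accumulators is essential: a polynomial-time body that
doubles its accumulator would otherwise reach exponential size. -/
theorem PolyTimeR.fold {l : X → List A} {s : X → PMF S} {F : X → A → S → PMF S}
    (hl : PolyTime w l) (hs : PolyTimeR w s)
    (hF : PolyTimeR sz fun q : (X × A) × S => F q.1.1 q.1.2 q.2) {b : X → ℕ} (hb : PolyIn w b)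
    (hsz : ∀ x l', l' <+: l x → ∀ y ∈ ((s x).bind (foldP (F x) l')).support, sz y ≤ b x) :
    PolyTimeR w (fun x => (s x).bind (foldP (F x) (l x))) := by
  have hlsz := hl.size
  obtain ⟨hw, pl, bl, hbl, hpl⟩ := hl
  obtain ⟨-, ps, bs, hbs, hps⟩ := hs
  obtain ⟨-, p, bF, ⟨c, hc⟩, hp⟩ := hF
  classical
  refine ⟨hw, .fold pl ps p, fun x => 30 * (sz (l x) + 1) + bl x + bs x +
    sz (l x) * (sz x + sz (l x) + b x + 2 + 2) ^ c + b x, ?_, fun x => ⟨?_, fun y hy => ?_⟩⟩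
  · exact (((((PolyIn.const w 30).mul (hlsz.add (.const w 1))).add hbl).add hbs).add
      (hlsz.mul ((((hw.add hlsz).add hb).add (.const w 2)).comp c))).add hb
  -- The step on arbitrary trees is whatever distribution `p` computes there. The default `nil`
  -- never matters, since only encodings occur.
  · set FD : Data → Data → PMF Data := fun d a =>
      if h : ∃ P t, p.Computes (.cons (.cons (enc x) d) a) P t then h.choose else PMF.pure .nil
    have hFD : ∀ a t, FD (enc a) (enc t) = (F x a t).map enc := by
      intro a t
      have h := (hp ((x, a), t)).1
      have h' : ∃ P t', p.Computes (.cons (.cons (enc x) (enc a)) (enc t)) P t' := ⟨_, _, h⟩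
      simp only [FD]
      rw [dif_pos h']
      obtain ⟨t', ht'⟩ := h'.choose_spec
      exact ht'.unique h
    have hfold : ∀ l' : List A, ((s x).map enc).bind (foldP FD (l'.map enc))
        = ((s x).bind (foldP (F x) l')).map enc := by
      intro l'
      rw [PMF.bind_map, PMF.map_bind]
      congr 1
      funext t
      exact foldP_map enc enc hFD l' t
    have h1 := (hpl x).1
    rw [PMF.pure_map, enc_list] at h1
    have h2 := Prog.Computes.fold (p := p) (F := FD)
      (tp := (sz x + sz (l x) + b x + 2 + 2) ^ c) h1 (hps x).1 (by
        intro l₁ d l₂ hL t ht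
        obtain ⟨m₁, m₂', e₁, rfl, e₂⟩ := List.map_eq_append_iff.1 hL
        obtain ⟨a, m₂, rfl, rfl, rfl⟩ := List.map_eq_cons_iff.1 e₂
        rw [hfold, PMF.mem_support_map_iff] at ht
        obtain ⟨t, ht, rfl⟩ := ht
        rw [hFD]
        refine (hp ((x, a), t)).1.mono ((hc _).trans (Nat.pow_le_pow_left ?_ c))
        have i1 := hsz x m₁ ⟨_, e₁.symm⟩ t ht
        have i2 : sz a + 1 ≤ sz (l x) := sz_le_of_mem (by rw [e₁]; simp)
        rw [sz_pair, sz_pair]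
        simp only
        lia)
    rw [hfold, List.length_map] at h2
    refine h2.mono ?_
    have := length_le_sz (l x)
    have := Nat.mul_le_mul_right ((sz x + sz (l x) + b x + 2 + 2) ^ c)
      (by lia : (l x).length ≤ sz (l x))
    lia
  · have := hsz x (l x) List.prefix_rfl y hy
    lia

theorem PolyTime.foldl {l : X → List A} {s : X → S} {f : X → S → A → S}
    (hl : PolyTime w l) (hs : PolyTime w s)
    (hf : PolyTime sz fun q : (X × A) × S => f q.1.1 q.2 q.1.2) {b : X → ℕ} (hb : PolyIn w b)
    (hsz : ∀ x l', l' <+: l x → sz (l'.foldl (f x) (s x)) ≤ b x) :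
    PolyTime w (fun x => (l x).foldl (f x) (s x)) := by
  have := PolyTimeR.fold (F := fun x a s => PMF.pure (f x s a)) hl hs hf hb (by
    intro x l' hl' y hy
    rw [PMF.pure_bind, foldP_pure, PMF.mem_support_pure_iff] at hy
    rw [hy]
    exact hsz x l' hl')
  simp only [PMF.pure_bind, foldP_pure] at this
  exact this

end Poly

end VCHard

/-! ### Polynomial-time operations on lists, Booleans and unary numbers. -/

namespace VCHard
open Enc (enc)

namespace PolyTime

variable {X A B C S : Type} [Enc X] [Enc A] [Enc B] [Enc C] [Enc S] {w : X → ℕ}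

theorem size_mem {l : X → List A} {f : X → A → B} (hl : PolyTime w l)
    (hf : PolyTime sz fun q : X × A => f q.1 q.2) :
    ∃ b : X → ℕ, PolyIn w b ∧ ∀ x, ∀ a ∈ l x, sz (f x a) ≤ b x := by
  obtain ⟨c, hc⟩ := hf.size
  refine ⟨fun x => (sz x + sz (l x) + 2) ^ c, (hl.weight.add hl.size).comp c, fun x a ha => ?_⟩
  refine (hc (x, a)).trans (Nat.pow_le_pow_left ?_ c)
  have := sz_le_of_mem ha
  rw [sz_pair]
  simp only
  lia

theorem cons {a : X → A} {l : X → List A} (ha : PolyTime w a) (hl : PolyTime w l) :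
    PolyTime w (fun x => a x :: l x) :=
  (of_enc_eq (w := sz) (f := fun q : A × List A => q.1 :: q.2) (.self _) fun _ => rfl).comp
    (ha.prodMk hl)

theorem fst_comp {f : X → A × B} (h : PolyTime w f) : PolyTime w (fun x => (f x).1) := fst.comp h

theorem snd_comp {f : X → A × B} (h : PolyTime w f) : PolyTime w (fun x => (f x).2) := snd.comp h

theorem reverse {l : X → List A} (hl : PolyTime w l) : PolyTime w (fun x => (l x).reverse) := by
  have e : ∀ l : List A, l.foldl (fun s a => a :: s) [] = l.reverse := fun l => by simp
  have := hl.foldl (s := fun _ => ([] : List A)) (f := fun _ s a => a :: s)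
    (const hl.weight _) (fst.snd_comp.cons snd) hl.size (fun x l' hl' => by
      rw [e, sz_reverse]; exact sz_prefix hl')
  simpa only [e] using this

theorem append {l l' : X → List A} (hl : PolyTime w l) (hl' : PolyTime w l') :
    PolyTime w (fun x => l x ++ l' x) := by
  have e : ∀ l l' : List A, l.foldl (fun s a => a :: s) l' = l.reverse ++ l' := fun l l' => by simp
  have := hl.reverse.foldl (f := fun _ s a => a :: s) hl' (fst.snd_comp.cons snd)
    (hl.size.add hl'.size) (fun x r hr => by
      rw [e]
      have h1 := sz_append r.reverse (l' x)
      have h2 := sz_prefix hr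
      rw [sz_reverse] at h1 h2
      lia)
  simpa only [e, List.reverse_reverse] using this

theorem map {l : X → List A} {f : X → A → B} (hl : PolyTime w l)
    (hf : PolyTime sz fun q : X × A => f q.1 q.2) : PolyTime w (fun x => (l x).map (f x)) := by
  obtain ⟨b, hb, hf'⟩ := hl.size_mem hf
  have e : ∀ x (l : List A), l.foldl (fun s a => f x a :: s) [] = (l.map (f x)).reverse :=
    fun x l => by simp
  have := hl.foldl (s := fun _ => ([] : List B)) (f := fun x s a => f x a :: s)
    (const hl.weight _) ((hf.comp fst).cons snd)
    ((hl.size.mul (hb.add (.const w 1))).add (.const w 1)) (fun x l' hl' => by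
      rw [e, sz_reverse]
      refine (sz_list_le (b := b x) fun y hy => ?_).trans ?_
      · obtain ⟨a, ha, rfl⟩ := List.mem_map.1 hy
        exact hf' x a (hl'.subset ha)
      · rw [List.length_map]
        refine Nat.add_le_add_right (Nat.mul_le_mul_right _ ?_) 1
        have := hl'.length_le
        have := length_le_sz (l x)
        lia)
  simpa only [e, List.reverse_reverse] using this.reverse

theorem flatMap {l : X → List A} {f : X → A → List B} (hl : PolyTime w l)
    (hf : PolyTime sz fun q : X × A => f q.1 q.2) : PolyTime w (fun x => (l x).flatMap (f x)) := by
  obtain ⟨b, hb, hf'⟩ := hl.size_mem hf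
  have e : ∀ x (l : List A), l.foldl (fun s a => s ++ f x a) [] = l.flatMap (f x) := fun x l => by
    have : ∀ s : List B, l.foldl (fun s a => s ++ f x a) s = s ++ l.flatMap (f x) := by
      induction l with
      | nil => simp
      | cons a l ih => intro s; simp [ih]
    simpa using this []
  have hsz : ∀ (l : List A) x, (∀ a ∈ l, sz (f x a) ≤ b x) →
      sz (l.flatMap (f x)) ≤ l.length * b x + 1 := by
    intro l x h
    induction l with
    | nil => simp [sz_nil]
    | cons a l ih =>
      have h1 := ih fun a ha => h a (List.mem_cons_of_mem _ ha)
      have h2 := h a List.mem_cons_self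
      have h3 := sz_append (f x a) (l.flatMap (f x))
      rw [List.flatMap_cons, List.length_cons, add_mul]
      lia
  have := hl.foldl (s := fun _ => ([] : List B)) (f := fun x s a => s ++ f x a)
    (const hl.weight _) (snd.append (hf.comp fst))
    ((hl.size.mul hb).add (.const w 1)) (fun x l' hl' => by
      rw [e]
      refine (hsz l' x fun a ha => hf' x a (hl'.subset ha)).trans
        (Nat.add_le_add_right (Nat.mul_le_mul_right _ ?_) 1)
      have := hl'.length_le
      have := length_le_sz (l x)
      lia)
  simpa only [e] using this

theorem and {f g : X → Bool} (hf : PolyTime w f) (hg : PolyTime w g) :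
    PolyTime w (fun x => f x && g x) := by
  have := hf.cond hg (const hf.weight false)
  convert this using 2 with x
  cases f x <;> simp

theorem or {f g : X → Bool} (hf : PolyTime w f) (hg : PolyTime w g) :
    PolyTime w (fun x => f x || g x) := by
  have := hf.cond (const hf.weight true) hg
  convert this using 2 with x
  cases f x <;> simp

theorem all {l : X → List A} {f : X → A → Bool} (hl : PolyTime w l)
    (hf : PolyTime sz fun q : X × A => f q.1 q.2) : PolyTime w (fun x => (l x).all (f x)) := by
  have e : ∀ x (l : List A) b, l.foldl (fun s a => s && f x a) b = (b && l.all (f x)) := by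
    intro x l
    induction l with
    | nil => simp
    | cons a l ih => intro b; simp [ih, Bool.and_assoc]
  have := hl.foldl (s := fun _ => true) (f := fun x s a => s && f x a)
    (const hl.weight _) (snd.and (hf.comp fst)) (.const w 3) (fun x l' hl' => sz_bool _)
  simpa only [e, Bool.true_and] using this

theorem tail {l : X → List A} (hl : PolyTime w l) : PolyTime w (fun x => (l x).tail) := by
  refine PolyTime.comp (g := List.tail) (.mk (p := .tl) (b := sz) (.self _) (.self _)
    (fun x => ?_) (fun x => ?_)) hl
  · have := (Prog.Computes.tl (enc x)).mono (sz_pos x)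
    cases x <;> exact this
  · cases x with
    | nil => exact le_rfl
    | cons a x => rw [List.tail_cons, sz_cons]; lia

/-- The program `hd` returns `nil` on the empty list, so the default has to be encoded by `nil`. -/
theorem headD {l : X → List A} (hl : PolyTime w l) {a : A} (ha : enc a = .nil) :
    PolyTime w (fun x => (l x).headD a) := by
  refine PolyTime.comp (g := fun l : List A => l.headD a) (.mk (p := .hd) (b := sz) (.self _) (.self _)
    (fun x => ?_) (fun x => ?_)) hl
  · have := (Prog.Computes.hd (enc x)).mono (sz_pos x)
    cases x with
    | nil => simpa [ha, Data.hd, enc, Data.ofList] using this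
    | cons b x => exact this
  · cases x with
    | nil => rw [List.headD_nil, sz, ha]; exact le_rfl
    | cons b x => rw [List.headD_cons, sz_cons]; lia

theorem isEmpty {l : X → List A} (hl : PolyTime w l) : PolyTime w (fun x => (l x).isEmpty) := by
  refine PolyTime.comp (g := fun l : List A => l.isEmpty) (.mk (p := .ite .id .nil (.pair .nil .nil))
    (b := fun x => sz x + 10) (.self _) ((PolyIn.self _).add (.const _ 10)) (fun x => ?_)
    (fun x => (sz_bool _).trans (by lia))) hl
  have := (Prog.Computes.id (enc x)).ite (.nil _) ((Prog.Computes.nil (enc x)).pair (.nil _))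
  simp only [PMF.pure_bind, PMF.pure_map] at this
  refine Prog.Computes.mono (s := 1 + (1 + max 1 (1 + (1 + 1)))) ?_ (by norm_num)
  cases x <;> exact this

/-- A unary number and a list of units are the same tree. Hence list programs provide arithmetic,
and numbers can control loops. -/
theorem units {n : X → ℕ} (hn : PolyTime w n) :
    PolyTime w (fun x => List.replicate (n x) ()) := by
  refine PolyTime.comp (g := fun n : ℕ => List.replicate n ()) (of_enc_eq (.self _) fun n => ?_) hn
  induction n with
  | zero => rfl
  | succ n ih =>
    change Data.cons .nil (enc (List.replicate n ())) = .cons .nil (enc n)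
    rw [ih]

theorem length {l : X → List A} (hl : PolyTime w l) : PolyTime w (fun x => (l x).length) := by
  have h1 := hl.map (f := fun _ _ => ()) (const (.self _) _)
  have h2 : PolyTime sz fun l : List Unit => l.length := of_enc_eq (.self _) fun l => by
    induction l with
    | nil => rfl
    | cons a l ih =>
      change Data.cons .nil (enc l.length) = .cons .nil (enc l)
      rw [ih]
  simpa only [List.length_map] using h2.comp h1

theorem iterate {n : X → ℕ} {s : X → S} {f : X → S → S} (hn : PolyTime w n) (hs : PolyTime w s)
    (hf : PolyTime sz fun q : X × S => f q.1 q.2) {b : X → ℕ} (hb : PolyIn w b)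
    (hsz : ∀ x, ∀ i ≤ n x, sz ((f x)^[i] (s x)) ≤ b x) :
    PolyTime w (fun x => (f x)^[n x] (s x)) := by
  have e : ∀ x (l : List Unit), l.foldl (fun s _ => f x s) (s x) = (f x)^[l.length] (s x) :=
    fun x l => List.foldl_const _ _ _
  have := hn.units.foldl (f := fun x s _ => f x s) hs
    (hf.comp ((fst.fst_comp (f := fun q : (X × Unit) × S => q.1)).prodMk snd)) hb (fun x l' hl' => by
      rw [e]
      refine hsz x _ ?_
      simpa using hl'.length_le)
  simpa only [e, List.length_replicate] using this

/-- The tree of `n + 1` is the pair of `nil` and the tree of `n`, so pairing with the unit is the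
successor. -/
theorem succ {n : X → ℕ} (hn : PolyTime w n) : PolyTime w (fun x => n x + 1) :=
  (of_enc_eq (w := sz) (f := fun q : Unit × ℕ => q.2 + 1) (.self _) fun _ => rfl).comp
    ((const hn.weight ()).prodMk hn)

theorem pred {n : X → ℕ} (hn : PolyTime w n) : PolyTime w (fun x => n x - 1) := by
  have := hn.units.tail.length
  simpa using this

theorem isZero {n : X → ℕ} (hn : PolyTime w n) : PolyTime w (fun x => decide (n x = 0)) := by
  have := hn.units.isEmpty
  convert this using 2 with x
  cases n x <;> simp [List.replicate_succ]

theorem sub {m n : X → ℕ} (hm : PolyTime w m) (hn : PolyTime w n) :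
    PolyTime w (fun x => m x - n x) := by
  have e : ∀ m i : ℕ, (fun k => k - 1)^[i] m = m - i := by
    intro m i
    induction i with
    | zero => rfl
    | succ i ih => rw [Function.iterate_succ_apply', ih]; lia
  have := hn.iterate (f := fun _ k => k - 1) hm (pred snd) hm.size (fun x i _ => by
    rw [e, sz_nat, sz_nat]; lia)
  simpa only [e] using this

theorem add {m n : X → ℕ} (hm : PolyTime w m) (hn : PolyTime w n) :
    PolyTime w (fun x => m x + n x) := by
  have := (hm.units.append hn.units).length
  simpa using this

theorem mul {m n : X → ℕ} (hm : PolyTime w m) (hn : PolyTime w n) :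
    PolyTime w (fun x => m x * n x) := by
  have h : PolyTime sz fun q : ℕ × ℕ => q.1 * q.2 := by
    have := (fst (A := ℕ) (B := ℕ)).units.flatMap (f := fun q _ => List.replicate q.2 ())
      fst.snd_comp.units
    simpa using this.length
  exact h.comp (hm.prodMk hn)

theorem le {m n : X → ℕ} (hm : PolyTime w m) (hn : PolyTime w n) :
    PolyTime w (fun x => decide (m x ≤ n x)) := by
  have := (hm.sub hn).isZero
  simpa only [Nat.sub_eq_zero_iff_le] using this

end PolyTime

end VCHard

/-! ### Options, and evaluation of recursive functions with bounded loops. -/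

namespace VCHard
open Enc (enc)
open Turing.ToPartrec (Code)

/-- An option is encoded as a list with at most one entry; a fold over this list replaces the
default at most once. -/
theorem PolyTime.elim {X A B : Type} [Enc X] [Enc A] [Enc B] {w : X → ℕ} {o : X → Option A}
    {f : X → B} {g : X → A → B} (ho : PolyTime w o) (hf : PolyTime w f)
    (hg : PolyTime sz fun q : X × A => g q.1 q.2) :
    PolyTime w (fun x => (o x).elim (f x) (g x)) := by
  have hl : PolyTime w (fun x => (o x).toList) :=
    (of_enc_eq (w := sz) (f := fun o : Option A => o.toList) (.self _) fun _ => rfl).comp ho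
  obtain ⟨b, hb, hb'⟩ := hl.size_mem hg
  have := hl.foldl (f := fun x _ a => g x a) hf (hg.comp fst) (hf.size.add hb) (fun x l' hl' => by
    have h := hb' x
    cases ho : o x with
    | none =>
      rw [ho, Option.toList_none, List.prefix_nil] at hl'
      rw [hl']
      exact Nat.le_add_right _ _
    | some a =>
      rw [ho, Option.toList_some] at hl' h
      rcases l' with _ | ⟨a', l'⟩
      · exact Nat.le_add_right _ _
      · obtain ⟨rfl, h'⟩ := List.cons_prefix_cons.1 hl'
        rw [List.prefix_nil] at h'
        subst h'
        exact (h a' (by simp)).trans (Nat.le_add_left _ _))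
  convert this using 2 with x
  cases o x <;> rfl

theorem PolyTime.some {X A : Type} [Enc X] [Enc A] {w : X → ℕ} {f : X → A} (hf : PolyTime w f) :
    PolyTime w (fun x => some (f x)) := by
  have h : PolyTime sz fun l : List A => l.head? := by
    refine .mk (p := .ite .id (.pair .hd .nil) .nil) (b := fun x => sz x + 10) (.self _)
      ((PolyIn.self _).add (.const _ 10)) (fun x => ?_) (fun x => ?_)
    · have := (Prog.Computes.id (enc x)).ite ((Prog.Computes.hd (enc x)).pair (.nil _)) (.nil _)
      simp only [PMF.pure_bind, PMF.pure_map] at this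
      refine Prog.Computes.mono (s := 1 + (1 + max (1 + (1 + 1)) 1)) ?_ (by norm_num)
      cases x <;> exact this
    · cases x with
      | nil => exact Nat.le_add_right _ _
      | cons a l => rw [List.head?_cons, sz_some, sz_cons]; lia
  exact h.comp (f := fun x => [f x]) (hf.cons (const hf.weight []))

/-! ### Bounded evaluation of recursive functions -/

/-- One round of the loop of `Code.fix`; the Boolean records whether the loop is over. -/
def fixStep (F : List ℕ → Option (List ℕ)) (o : Option (Bool × List ℕ)) :
    Option (Bool × List ℕ) :=
  o.elim none fun r => if r.1 then some r else
    (F r.2).elim none fun u => some (decide (u.headI = 0), u.tail)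

/-- The evaluation of a code where each loop has at most `n` rounds. -/
def evalBounded (n : ℕ) : Code → List ℕ → Option (List ℕ)
  | .zero', v => some (0 :: v)
  | .succ, v => some [v.headI + 1]
  | .tail, v => some v.tail
  | .cons f fs, v => (evalBounded n f v).elim none fun u =>
      (evalBounded n fs v).elim none fun us => some (u.headI :: us)
  | .comp f g, v => (evalBounded n g v).elim none fun u => evalBounded n f u
  | .case f g, v => if decide (v.headI = 0) then evalBounded n f v.tail
      else evalBounded n g ((v.headI - 1) :: v.tail)
  | .fix f, v => ((fixStep (evalBounded n f))^[n] (some (false, v))).elim none fun r =>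
      if r.1 then some r.2 else none

theorem elim_none_eq_some {A B : Type*} {o : Option A} {g : A → Option B} {b : B} :
    o.elim none g = some b ↔ ∃ a, o = some a ∧ g a = some b := by
  cases o <;> simp

theorem fixStep_done (F : List ℕ → Option (List ℕ)) (i : ℕ) (u : List ℕ) :
    (fixStep F)^[i] (some (true, u)) = some (true, u) := by
  induction i with
  | zero => rfl
  | succ i ih => rw [Function.iterate_succ_apply]; exact ih

theorem fixStep_none (F : List ℕ → Option (List ℕ)) (i : ℕ) : (fixStep F)^[i] none = none := by
  induction i with
  | zero => rfl
  | succ i ih => rw [Function.iterate_succ_apply]; exact ih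

theorem fixStep_running {F : List ℕ → Option (List ℕ)} {v u : List ℕ} (h : F v = some u) :
    fixStep F (some (false, v)) = some (decide (u.headI = 0), u.tail) := by
  simp [fixStep, h]

theorem evalBounded_sound (n : ℕ) (c : Code) {v u : List ℕ} (h : evalBounded n c v = some u) :
    u ∈ c.eval v := by
  induction c generalizing v u with
  | zero' | succ | tail => simpa [evalBounded, eq_comm] using h
  | cons f fs hf hfs =>
    simp only [evalBounded, elim_none_eq_some] at h
    obtain ⟨a, ha, b, hb, e⟩ := h
    cases e
    rw [Code.cons_eval]
    exact Part.mem_bind (hf ha) (Part.mem_bind (hfs hb) (Part.mem_some _))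
  | comp f g hf hg =>
    simp only [evalBounded, elim_none_eq_some] at h
    obtain ⟨a, ha, h⟩ := h
    rw [Code.comp_eval]
    exact Part.mem_bind (hg ha) (hf h)
  | case f g hf hg =>
    rw [evalBounded] at h
    rw [Code.case_eval]
    dsimp only
    cases e : v.headI with
    | zero => rw [e] at h; exact hf (by simpa using h)
    | succ y => rw [e] at h; exact hg (by simpa using h)
  | fix f hf =>
    simp only [evalBounded, elim_none_eq_some] at h
    obtain ⟨⟨b, u'⟩, h, hb⟩ := h
    cases b with
    | false => simp at hb
    | true =>
      simp only [if_true, Option.some.injEq] at hb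
      subst hb
      rw [Code.fix_eval]
      generalize hi : n = i at h
      -- The number of rounds is separated from the bound `n` inside the body, which makes induction
      -- on it possible.
      have key : ∀ i v, (fixStep (evalBounded n f))^[i] (some (false, v)) = some (true, u') →
          u' ∈ (Code.fix f).eval v := by
        intro i
        induction i with
        | zero => intro v h; simp at h
        | succ i ih =>
          intro v h
          rw [Function.iterate_succ_apply] at h
          cases e : evalBounded n f v with
          | none =>
            have : fixStep (evalBounded n f) (some (false, v)) = none := by simp [fixStep, e]
            rw [this, fixStep_none] at h
            simp at h
          | some u =>
            rw [fixStep_running e] at h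
            rw [Code.fix_eval]
            refine PFun.mem_fix_iff.2 ?_
            by_cases h0 : u.headI = 0
            · rw [decide_eq_true h0, fixStep_done] at h
              left
              refine Part.mem_map_iff _ |>.2 ⟨u, hf e, ?_⟩
              simpa [h0] using h
            · rw [decide_eq_false h0] at h
              right
              refine ⟨u.tail, Part.mem_map_iff _ |>.2 ⟨u, hf e, by simp [h0]⟩, ?_⟩
              have := ih _ h
              rwa [Code.fix_eval] at this
      have := key i v (by rw [← hi] at h ⊢; exact h)
      rwa [Code.fix_eval] at this

/-- A halting evaluation uses finitely many rounds of each loop, and superfluous rounds leave a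
finished state unchanged; therefore all large bounds give the same value. -/
theorem evalBounded_complete (c : Code) {v u : List ℕ} (h : u ∈ c.eval v) :
    ∃ n₀, ∀ n, n₀ ≤ n → evalBounded n c v = some u := by
  induction c generalizing v u with
  | zero' | succ | tail => exact ⟨0, fun n _ => by simpa [evalBounded, eq_comm] using h⟩
  | cons f fs hf hfs =>
    rw [Code.cons_eval] at h
    obtain ⟨a, ha, h⟩ := Part.mem_bind_iff.1 h
    obtain ⟨b, hb, h⟩ := Part.mem_bind_iff.1 h
    obtain ⟨n₁, h₁⟩ := hf ha
    obtain ⟨n₂, h₂⟩ := hfs hb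
    refine ⟨max n₁ n₂, fun n hn => ?_⟩
    rw [evalBounded, h₁ n (by lia), h₂ n (by lia)]
    simpa [eq_comm] using h
  | comp f g hf hg =>
    rw [Code.comp_eval] at h
    obtain ⟨a, ha, h⟩ := Part.mem_bind_iff.1 h
    obtain ⟨n₁, h₁⟩ := hg ha
    obtain ⟨n₂, h₂⟩ := hf h
    refine ⟨max n₁ n₂, fun n hn => ?_⟩
    rw [evalBounded, h₁ n (by lia)]
    exact h₂ n (by lia)
  | case f g hf hg =>
    rw [Code.case_eval] at h
    dsimp only at h
    cases e : v.headI with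
    | zero =>
      rw [e] at h
      obtain ⟨n₁, h₁⟩ := hf h
      exact ⟨n₁, fun n hn => by rw [evalBounded, e]; simpa using h₁ n hn⟩
    | succ y =>
      rw [e] at h
      obtain ⟨n₁, h₁⟩ := hg h
      exact ⟨n₁, fun n hn => by rw [evalBounded, e]; simpa using h₁ n hn⟩
  | fix f hf =>
    rw [Code.fix_eval] at h
    -- The bound for nested loops and the number of rounds get independent thresholds; the maximum
    -- of the two serves when they are identified.
    have key : ∃ n₀ i₀, ∀ n, n₀ ≤ n → ∀ i, i₀ ≤ i →
        (fixStep (evalBounded n f))^[i] (some (false, v)) = some (true, u) := by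
      refine PFun.fixInduction' h (fun a ha => ?_) (fun a a' _ ha ih => ?_)
      · obtain ⟨x, hx, e⟩ := (Part.mem_map_iff _).1 ha
        split_ifs at e with h0
        cases e
        obtain ⟨n₁, h₁⟩ := hf hx
        refine ⟨n₁, 1, fun n hn i hi => ?_⟩
        obtain ⟨i, rfl⟩ := Nat.exists_eq_add_of_le' hi
        rw [Function.iterate_succ_apply, fixStep_running (h₁ n hn), decide_eq_true h0,
          fixStep_done]
      · obtain ⟨x, hx, e⟩ := (Part.mem_map_iff _).1 ha
        split_ifs at e with h0
        cases e
        obtain ⟨n₁, h₁⟩ := hf hx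
        obtain ⟨n₀, i₀, ih⟩ := ih
        refine ⟨max n₀ n₁, i₀ + 1, fun n hn i hi => ?_⟩
        obtain ⟨i, rfl⟩ : ∃ j, i = j + 1 := ⟨i - 1, by lia⟩
        rw [Function.iterate_succ_apply, fixStep_running (h₁ n (by lia)), decide_eq_false h0]
        exact ih n (by lia) i (by lia)
    obtain ⟨n₀, i₀, key⟩ := key
    refine ⟨max n₀ i₀, fun n hn => ?_⟩
    rw [evalBounded, key n (by lia) n (by lia)]
    rfl

/-- Length and entries are at most `K`. -/
def ListBdd (K : ℕ) (v : List ℕ) : Prop := v.length ≤ K ∧ ∀ a ∈ v, a ≤ K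

theorem ListBdd.mono {K K' : ℕ} {v : List ℕ} (h : ListBdd K v) (hK : K ≤ K') : ListBdd K' v :=
  ⟨h.1.trans hK, fun a ha => (h.2 a ha).trans hK⟩

theorem ListBdd.tail {K : ℕ} {v : List ℕ} (h : ListBdd K v) : ListBdd K v.tail :=
  ⟨by rw [List.length_tail]; have := h.1; lia, fun a ha => h.2 a (List.mem_of_mem_tail ha)⟩

theorem ListBdd.headI {K : ℕ} {v : List ℕ} (h : ListBdd K v) : v.headI ≤ K := by
  cases v with
  | nil => exact Nat.zero_le _
  | cons a v => exact h.2 a List.mem_cons_self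

theorem ListBdd.cons {K a : ℕ} {v : List ℕ} (h : ListBdd K v) (ha : a ≤ K + 1) :
    ListBdd (K + 1) (a :: v) :=
  ⟨Nat.succ_le_succ h.1, fun b hb => by
    rcases List.mem_cons.1 hb with rfl | hb
    · exact ha
    · exact (h.2 b hb).trans (Nat.le_succ _)⟩

theorem ListBdd.size {K : ℕ} {v : List ℕ} (h : ListBdd K v) : sz v ≤ K * (2 * K + 2) + 1 := by
  refine (sz_list_le (b := 2 * K + 1) fun a ha => ?_).trans
    (Nat.add_le_add_right (Nat.mul_le_mul_right _ h.1) 1)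
  rw [sz_nat]
  have := h.2 a ha
  lia

theorem ListBdd.of_sz (v : List ℕ) : ListBdd (sz v) v := by
  refine ⟨by have := length_le_sz v; lia, fun a ha => ?_⟩
  have := sz_le_of_mem ha
  rw [sz_nat] at this
  lia

theorem fixStep_growth {K : ℕ} {v : List ℕ} {F : List ℕ → Option (List ℕ)} {g : ℕ}
    (hF : ∀ K v u, ListBdd K v → F v = some u → ListBdd (K + g) u) (hv : ListBdd K v) (i : ℕ)
    {b : Bool} {u : List ℕ} (h : (fixStep F)^[i] (some (false, v)) = some (b, u)) :
    ListBdd (K + i * g) u := by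
  induction i generalizing b u with
  | zero => cases h; simpa using hv
  | succ i ih =>
    rw [Function.iterate_succ_apply'] at h
    rw [fixStep, elim_none_eq_some] at h
    obtain ⟨⟨b', u'⟩, h', h⟩ := h
    rw [add_mul, one_mul, ← add_assoc]
    split_ifs at h with hb'
    · cases h
      exact (ih h').mono (Nat.le_add_right _ _)
    · rw [elim_none_eq_some] at h
      obtain ⟨a, ha, h⟩ := h
      cases h
      exact (hF _ _ a (ih h') ha).tail

/-- The increment `g n` does not depend on `K`. It is at most 1 for the basic operations, it adds up
under composition, and `n` rounds of a loop multiply it by `n`. Hence values stay polynomial however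
deeply the loops are nested; growth by a factor would compound. -/
theorem evalBounded_growth (c : Code) : ∃ g : ℕ → ℕ, PolyIn (fun n => n) g ∧
    ∀ n K v u, ListBdd K v → evalBounded n c v = some u → ListBdd (K + g n) u := by
  induction c with
  | zero' =>
    refine ⟨fun _ => 1, .const _ 1, fun n K v u hv h => ?_⟩
    cases h
    exact hv.cons (Nat.zero_le _)
  | succ =>
    refine ⟨fun _ => 1, .const _ 1, fun n K v u hv h => ?_⟩
    cases h
    exact ListBdd.cons (v := []) ⟨Nat.zero_le _, by simp⟩ (Nat.succ_le_succ hv.headI)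
  | tail =>
    refine ⟨fun _ => 0, .const _ 0, fun n K v u hv h => ?_⟩
    cases h
    exact hv.tail
  | cons f fs hf hfs =>
    obtain ⟨g, hg, hf⟩ := hf
    obtain ⟨g', hg', hfs⟩ := hfs
    refine ⟨fun n => g n + g' n + 1, (hg.add hg').add (.const _ 1), fun n K v u hv h => ?_⟩
    simp only [evalBounded, elim_none_eq_some] at h
    obtain ⟨a, ha, b, hb, e⟩ := h
    cases e
    have h1 := (hf n K v a hv ha).headI
    refine ((hfs n K v b hv hb).mono (K' := K + (g n + g' n)) (by lia)).cons (by lia)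
  | comp f f' hf hf' =>
    obtain ⟨g, hg, hf⟩ := hf
    obtain ⟨g', hg', hf'⟩ := hf'
    refine ⟨fun n => g' n + g n, hg'.add hg, fun n K v u hv h => ?_⟩
    simp only [evalBounded, elim_none_eq_some] at h
    obtain ⟨a, ha, h⟩ := h
    rw [← add_assoc]
    exact hf n _ a u (hf' n K v a hv ha) h
  | case f f' hf hf' =>
    obtain ⟨g, hg, hf⟩ := hf
    obtain ⟨g', hg', hf'⟩ := hf'
    refine ⟨fun n => g n + (g' n + 1), hg.add (hg'.add (.const _ 1)), fun n K v u hv h => ?_⟩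
    rw [evalBounded] at h
    split_ifs at h
    · exact (hf n K _ u hv.tail h).mono (by lia)
    · refine (hf' n (K + 1) _ u (hv.tail.cons ?_) h).mono (by lia)
      have := hv.headI
      lia
  | fix f hf =>
    obtain ⟨g, hg, hf⟩ := hf
    refine ⟨fun n => n * g n, (PolyIn.self _).mul hg, fun n K v u hv h => ?_⟩
    simp only [evalBounded, elim_none_eq_some] at h
    obtain ⟨⟨b, u'⟩, h, hb⟩ := h
    have := fixStep_growth (hf n) hv n h
    split_ifs at hb
    cases hb
    exact this

theorem PolyTime.headI {X : Type} [Enc X] {w : X → ℕ} {l : X → List ℕ} (hl : PolyTime w l) :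
    PolyTime w (fun x => (l x).headI) := by
  have := hl.headD (a := 0) rfl
  convert this using 2 with x
  cases l x <;> rfl

theorem evalBounded_polyTime (c : Code) :
    PolyTime sz fun q : ℕ × List ℕ => evalBounded q.1 c q.2 := by
  induction c with
  | zero' => exact ((PolyTime.const (.self _) 0).cons .snd).some
  | succ => exact ((PolyTime.snd.headI.succ).cons (.const (.self _) [])).some
  | tail => exact PolyTime.snd.tail.some
  | cons f fs hf hfs =>
    refine hf.elim (.const (.self _) none) ?_
    refine PolyTime.elim (hfs.comp .fst) (.const (.self _) none) ?_
    exact (PolyTime.fst.snd_comp.headI.cons .snd).some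
  | comp f g hf hg =>
    exact hg.elim (.const (.self _) none) (hf.comp (.prodMk (PolyTime.fst.fst_comp) .snd))
  | case f g hf hg =>
    exact PolyTime.cond PolyTime.snd.headI.isZero (hf.comp (.prodMk .fst PolyTime.snd.tail))
      (hg.comp (.prodMk .fst (PolyTime.snd.headI.pred.cons PolyTime.snd.tail)))
  | fix f hf =>
    obtain ⟨g, ⟨e, hg⟩, hgr⟩ := evalBounded_growth f
    -- The loop starts from a list bounded by `sz q` and makes at most `sz q` rounds, each of which
    -- adds at most `(sz q + 2) ^ e`.
    set K : ℕ × List ℕ → ℕ := fun q => sz q + sz q * (sz q + 2) ^ e with hK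
    have hKp : PolyIn sz K := (PolyIn.self _).add ((PolyIn.self _).mul ((PolyIn.self _).comp e))
    have hit := PolyTime.iterate (w := sz) (n := fun q : ℕ × List ℕ => q.1)
      (s := fun q => some (false, q.2)) (f := fun q => fixStep (evalBounded q.1 f))
      (b := fun q => (K q * (2 * K q + 2) + 1) + 6)
      .fst ((PolyTime.const (.self _) false).prodMk .snd).some (by
        refine PolyTime.elim .snd (.const (.self _) none) ?_
        refine PolyTime.cond PolyTime.snd.fst_comp PolyTime.snd.some ?_
        refine PolyTime.elim (hf.comp (.prodMk (PolyTime.fst.fst_comp.fst_comp)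
          PolyTime.snd.snd_comp)) (.const (.self _) none) ?_
        exact (PolyTime.snd.headI.isZero.prodMk PolyTime.snd.tail).some)
      (((hKp.mul (((PolyIn.const _ 2).mul hKp).add (.const _ 2))).add (.const _ 1)).add
        (.const _ 6)) (by
        intro q i hi
        cases h : (fixStep (evalBounded q.1 f))^[i] (some (false, q.2)) with
        | none => rw [sz_none]; lia
        | some r =>
          have h1 := fixStep_growth (hgr q.1) (.of_sz q.2) i (b := r.1) (u := r.2) h
          have h2 : q.1 ≤ sz q := by rw [sz_pair, sz_nat]; lia
          have h3 : sz q.2 + i * g q.1 ≤ K q := by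
            refine Nat.add_le_add (by rw [sz_pair]; lia) (Nat.mul_le_mul (hi.trans h2) ?_)
            exact (hg q.1).trans (Nat.pow_le_pow_left (by lia) e)
          have h4 := (h1.mono h3).size
          have h5 := sz_bool r.1
          rw [sz_some, sz_pair]
          lia)
    exact hit.elim (.const (.self _) none)
      (PolyTime.cond PolyTime.snd.fst_comp PolyTime.snd.snd_comp.some (.const (.self _) none))

/-- A computable function is the limit of functions that can be evaluated in polynomial time (in
the unary parameters) and whose values are correct where they are defined. -/
theorem Computable.exists_approx {F : ℕ → ℕ} (hF : Computable F) :
    ∃ R : ℕ → ℕ → Option ℕ, PolyTime sz (fun q : ℕ × ℕ => R q.1 q.2) ∧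
      (∀ n x y, R n x = some y → y = F x) ∧
      ∀ x, ∃ n₀, ∀ n, n₀ ≤ n → R n x = some (F x) := by
  obtain ⟨c, hc⟩ := Code.exists_code ((Nat.Partrec'.part_iff₁ (f := (F : ℕ →. ℕ))).2 hF)
  have hc' : ∀ x, c.eval [x] = Part.some [F x] := fun x => by
    have := hc ⟨[x], rfl⟩
    rw [this]
    exact Part.map_some _ _
  refine ⟨fun n x => (evalBounded n c [x]).elim none fun u => some u.headI, ?_, ?_, ?_⟩
  · refine PolyTime.elim ((evalBounded_polyTime c).comp (PolyTime.fst.prodMk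
      (PolyTime.snd.cons (.const (.self _) [])))) (.const (.self _) none) ?_
    exact PolyTime.snd.headI.some
  · intro n x y h
    rw [elim_none_eq_some] at h
    obtain ⟨u, hu, h⟩ := h
    have := evalBounded_sound n c hu
    rw [hc', Part.mem_some_iff] at this
    subst this
    simpa [eq_comm] using h
  · intro x
    obtain ⟨n₀, h⟩ := evalBounded_complete c (v := [x]) (u := [F x]) (by
      rw [hc']; exact Part.mem_some _)
    exact ⟨n₀, fun n hn => by simp [h n hn]⟩

end VCHard

/-! ### Slow parameters, and the list programs from which the reduction is assembled. -/

namespace VCHard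
open Enc (enc)

/-! ### Slowly growing parameters -/

/-- Search for the largest number below a bound that passes a test: the state is the next candidate
together with the best number so far. -/
def searchStep (test : ℕ → Bool) (q : ℕ × ℕ) : ℕ × ℕ := (q.1 + 1, if test q.1 then q.1 else q.2)

theorem searchStep_iterate (test : ℕ → Bool) (n : ℕ) :
    ((searchStep test)^[n] (0, 0)).1 = n ∧ ((searchStep test)^[n] (0, 0)).2 ≤ n ∧
    (((searchStep test)^[n] (0, 0)).2 = 0 ∨ test ((searchStep test)^[n] (0, 0)).2) ∧
    ∀ i < n, test i → i ≤ ((searchStep test)^[n] (0, 0)).2 := by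
  induction n with
  | zero => simp
  | succ n ih =>
    rw [Function.iterate_succ_apply']
    obtain ⟨h1, h2, h3, h4⟩ := ih
    set q := (searchStep test)^[n] (0, 0)
    rw [searchStep, h1]
    refine ⟨rfl, ?_, ?_, fun i hi ht => ?_⟩ <;> dsimp only
    · split_ifs <;> lia
    · split_ifs with h
      · exact Or.inr h
      · exact h3
    · rcases Nat.lt_succ_iff_lt_or_eq.1 hi with hi | rfl
      · have := h4 i hi ht
        split_ifs <;> lia
      · rw [if_pos ht]

/-- For computable `f` and `s` there is a slowly growing `κ` that is computable in polynomial time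
such that `f ∘ κ` is at most the identity and `s ∘ κ` is computable in polynomial time, too. -/
theorem exists_slow {f s : ℕ → ℕ} (hf : Computable f) (hs : Computable s) :
    ∃ κ : ℕ → ℕ, PolyTime sz κ ∧ PolyTime sz (fun N => s (κ N)) ∧ Tendsto κ atTop atTop ∧
      ∀ᶠ N in atTop, f (κ N) ≤ N := by
  obtain ⟨R, hR, hR1, hR2⟩ := Computable.exists_approx hf
  obtain ⟨Q, hQ, hQ1, hQ2⟩ := Computable.exists_approx hs
  -- A candidate passes if both functions can be evaluated at it with loops of at most `N` rounds
  -- and the value of `f` is at most `N`. The value `κ N` will be the largest candidate below `N`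
  -- that passes.
  set test : ℕ → ℕ → Bool := fun N i =>
    (R N i).elim false (fun y => decide (y ≤ N)) && (Q N i).elim false (fun _ => true) with htest
  have ht : PolyTime sz fun q : ℕ × ℕ => test q.1 q.2 :=
    (hR.elim (.const (.self _) false) (PolyTime.snd.le PolyTime.fst.fst_comp)).and
      (hQ.elim (.const (.self _) false) (.const (.self _) true))
  have hspec : ∀ N i, test N i → f i ≤ N ∧ Q N i = some (s i) := by
    intro N i h
    simp only [htest, Bool.and_eq_true] at h
    cases e : R N i with
    | none => simp [e] at h
    | some y =>
      cases e' : Q N i with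
      | none => simp [e'] at h
      | some z =>
        rw [← hR1 _ _ _ e, ← hQ1 _ _ _ e']
        simpa [e, e'] using h
  set κ : ℕ → ℕ := fun N => ((searchStep (test N))^[N] (0, 0)).2 with hκ
  have hκP : PolyTime sz κ := by
    refine PolyTime.snd_comp (f := fun N => (searchStep (test N))^[N] (0, 0))
      (PolyTime.iterate (b := fun N => 2 * sz N + 10) (.id (.self _)) (.const (.self _) _) ?_
        (((PolyIn.const _ 2).mul (.self _)).add (.const _ _)) ?_)
    · refine PolyTime.prodMk PolyTime.snd.fst_comp.succ ?_
      exact PolyTime.cond (ht.comp (PolyTime.fst.prodMk PolyTime.snd.fst_comp))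
        PolyTime.snd.fst_comp PolyTime.snd.snd_comp
    · intro N i hi
      obtain ⟨h1, h2, -⟩ := searchStep_iterate (test N) i
      rw [sz_pair, sz_nat, sz_nat, sz_nat]
      lia
  have hκ1 : ∀ N, κ N = 0 ∨ test N (κ N) := fun N => (searchStep_iterate (test N) N).2.2.1
  refine ⟨κ, hκP, ?_, ?_, ?_⟩
  -- If the evaluation of `s` is cut off, then no candidate has passed and `κ N = 0`; hence the
  -- default `s 0`.
  · have h : PolyTime sz fun N => (Q N (κ N)).elim (s 0) fun y => y :=
      (hQ.comp ((PolyTime.id (.self _)).prodMk hκP)).elim (.const (.self _) _) .snd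
    convert h using 2 with N
    rcases hκ1 N with h | h
    · cases e : Q N (κ N) with
      | none => simp [h]
      | some y => simpa using (hQ1 _ _ _ e).symm
    · rw [(hspec N _ h).2]; rfl
  · refine tendsto_atTop.2 fun i => ?_
    obtain ⟨n₁, h₁⟩ := hR2 i
    obtain ⟨n₂, h₂⟩ := hQ2 i
    filter_upwards [eventually_ge_atTop (n₁ + n₂ + f i + i + 1)] with N hN
    refine (searchStep_iterate (test N) N).2.2.2 i (by lia) ?_
    simp only [htest, h₁ N (by lia), h₂ N (by lia)]
    simp only [Option.elim_some, Bool.and_true, decide_eq_true_eq]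
    lia
  · filter_upwards [eventually_ge_atTop (f 0)] with N hN
    rcases hκ1 N with h | h
    · rw [h]; exact hN
    · exact (hspec N _ h).1

/-! ### The reduction as a program -/

section Lists

variable {X A B : Type} [Enc X] [Enc A] [Enc B] {w : X → ℕ}

theorem zip_fold {A B : Type*} (d : B) (l : List A) : ∀ (l' : List B) (acc : List (A × B)),
    l.length ≤ l'.length →
    (l.foldl (fun (s : List B × List (A × B)) a => (s.1.tail, (a, s.1.headD d) :: s.2))
      (l', acc)).2 = (l.zip l').reverse ++ acc := by
  induction l with
  | nil => simp
  | cons a l ih =>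
    rintro (_ | ⟨b, l'⟩) acc h
    · simp at h
    · rw [List.foldl_cons, List.tail_cons, ih _ _ (by simpa using h)]
      simp

theorem PolyTime.zip {l : X → List A} {l' : X → List B} (hl : PolyTime w l) (hl' : PolyTime w l')
    {d : B} (hd : enc d = .nil) (h : ∀ x, (l x).length ≤ (l' x).length) :
    PolyTime w (fun x => (l x).zip (l' x)) := by
  have hfold := hl.foldl (S := List B × List (A × B)) (s := fun x => (l' x, []))
    (f := fun _ s a => (s.1.tail, (a, s.1.headD d) :: s.2))
    (hl'.prodMk (.const hl.weight _))
    (PolyTime.snd.fst_comp.tail.prodMk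
      ((PolyTime.fst.snd_comp.prodMk (PolyTime.snd.fst_comp.headD hd)).cons PolyTime.snd.snd_comp))
    (b := fun x => sz (l' x) + (sz (l x) * (sz (l x) + sz (l' x) + 2) + 1) + 1)
    ((hl'.size.add ((hl.size.mul ((hl.size.add hl'.size).add (.const w 2))).add (.const w 1))).add
      (.const w 1)) (by
      intro x r hr
      have h1 : (r.foldl (fun (s : List B × List (A × B)) a => (s.1.tail, (a, s.1.headD d) :: s.2))
          (l' x, [])).2 = (r.zip (l' x)).reverse := by
        rw [zip_fold d _ _ _ (hr.length_le.trans (h x)), List.append_nil]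
      have h2 : ∀ (r : List A) (s : List B × List (A × B)), sz (r.foldl (fun
          (s : List B × List (A × B)) a => (s.1.tail, (a, s.1.headD d) :: s.2)) s).1 ≤ sz s.1 := by
        intro r
        induction r with
        | nil => exact fun s => le_rfl
        | cons a r ih =>
          intro s
          refine (ih _).trans ?_
          rcases s with ⟨_ | ⟨b, m⟩, acc⟩
          · exact le_rfl
          · simp only [List.tail_cons, sz_cons]; lia
      rw [sz_pair, h1, sz_reverse]
      refine Nat.add_le_add_right (Nat.add_le_add (h2 r _) ?_) 1
      refine (sz_list_le (b := sz (l x) + sz (l' x) + 1) fun q hq => ?_).trans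
        (Nat.add_le_add_right (Nat.mul_le_mul_right _ ?_) 1)
      · have i1 := sz_le_of_mem (hr.subset (List.of_mem_zip hq).1)
        have i2 := sz_le_of_mem (List.of_mem_zip hq).2
        rw [sz_pair]
        lia
      · have i1 := hr.length_le
        have i2 := length_le_sz (l x)
        rw [List.length_zip]
        lia)
  have := hfold.snd_comp.reverse
  convert this using 2 with x
  rw [zip_fold d _ _ _ (h x)]
  simp

theorem PolyTime.product {l : X → List A} {l' : X → List B} (hl : PolyTime w l)
    (hl' : PolyTime w l') : PolyTime w (fun x => l x ×ˢ l' x) := by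
  have h : PolyTime sz fun q : List A × List B => q.1.flatMap fun a => q.2.map fun b => (a, b) :=
    PolyTime.fst.flatMap (PolyTime.fst.snd_comp.map (PolyTime.fst.snd_comp.prodMk .snd))
  exact h.comp (hl.prodMk hl')


end Lists

/-- Whether two Boolean vectors have a common entry 1. -/
def dot : List Bool → List Bool → Bool
  | [], _ => false
  | a :: l, l' => (a && l'.headD false) || dot l l'.tail

theorem dot_iff (l l' : List Bool) :
    dot l l' ↔ ∃ i : ℕ, l[i]? = some true ∧ l'[i]? = some true := by
  induction l generalizing l' with
  | nil => simp [dot]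
  | cons a l ih =>
    rw [dot, Bool.or_eq_true, ih, Bool.and_eq_true]
    constructor
    · rintro (⟨rfl, h⟩ | ⟨i, h1, h2⟩)
      · cases l' with
        | nil => simp at h
        | cons b l' => exact ⟨0, by simpa using h⟩
      · exact ⟨i + 1, by simpa using h1, by cases l' <;> simp_all⟩
    · rintro ⟨_ | i, h1, h2⟩
      · left; cases l' <;> simp_all
      · right; exact ⟨i, by simpa using h1, by cases l' <;> simp_all⟩

section Reduction

variable {X : Type} [Enc X] {w : X → ℕ}

theorem PolyTime.dot {l l' : X → List Bool} (hl : PolyTime w l) (hl' : PolyTime w l') :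
    PolyTime w (fun x => dot (l x) (l' x)) := by
  have e : ∀ (l l' : List Bool) (b : Bool), (l.foldl (fun (s : List Bool × Bool) a =>
      (s.1.tail, s.2 || (a && s.1.headD false))) (l', b)).2 = (b || VCHard.dot l l') := by
    intro l
    induction l with
    | nil => simp [VCHard.dot]
    | cons a l ih => intro l' b; rw [List.foldl_cons, ih, VCHard.dot, Bool.or_assoc]
  have h := hl.foldl (S := List Bool × Bool) (s := fun x => (l' x, false))
    (f := fun _ s a => (s.1.tail, s.2 || (a && s.1.headD false)))
    (hl'.prodMk (.const hl.weight _)) (PolyTime.snd.fst_comp.tail.prodMk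
      (PolyTime.snd.snd_comp.or (PolyTime.fst.snd_comp.and (PolyTime.snd.fst_comp.headD rfl))))
    (b := fun x => sz (l' x) + 4) (hl'.size.add (.const w 4)) (by
      intro x r _
      have h2 : ∀ (r : List Bool) (s : List Bool × Bool), sz (r.foldl (fun
          (s : List Bool × Bool) a => (s.1.tail, s.2 || (a && s.1.headD false))) s).1
          ≤ sz s.1 := by
        intro r
        induction r with
        | nil => exact fun s => le_rfl
        | cons a r ih =>
          intro s
          refine (ih _).trans ?_
          rcases s with ⟨_ | ⟨b, m⟩, acc⟩
          · exact le_rfl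
          · simp only [List.tail_cons, sz_cons]; lia
      have h3 := h2 r (l' x, false)
      have h4 := sz_bool (r.foldl (fun (s : List Bool × Bool) a =>
        (s.1.tail, s.2 || (a && s.1.headD false))) (l' x, false)).2
      rw [sz_pair]
      simp only at h3
      lia)
  simpa only [e, Bool.false_or] using h.snd_comp

/-- One more row and column for the identity matrix. -/
def idStep (M : List (List Bool)) : List (List Bool) :=
  (true :: M.map fun _ => false) :: M.map fun r => false :: r

/-- The rows of the identity matrix. -/
def idRows (n : ℕ) : List (List Bool) := idStep^[n] []

theorem idRows_succ (n : ℕ) : idRows (n + 1) = idStep (idRows n) :=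
  Function.iterate_succ_apply' _ _ _

theorem length_idRows (n : ℕ) : (idRows n).length = n := by
  induction n with
  | zero => rfl
  | succ n ih => rw [idRows_succ, idStep]; simp [ih]

theorem idRows_eq (n : ℕ) :
    idRows n = (List.finRange n).map fun i => (List.finRange n).map fun j => decide (i = j) := by
  induction n with
  | zero => rfl
  | succ n ih =>
    rw [idRows_succ, idStep, ih, List.finRange_succ]
    have h0 : ∀ x : Fin n, decide ((0 : Fin (n + 1)) = x.succ) = false := fun x => by
      simp [Fin.ext_iff]
    simp [Function.comp_def, h0]

theorem length_of_mem_idRows {n : ℕ} {r : List Bool} (h : r ∈ idRows n) : r.length = n := by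
  rw [idRows_eq, List.mem_map] at h
  obtain ⟨i, -, rfl⟩ := h
  simp

theorem sz_boolList (l : List Bool) : sz l ≤ l.length * 4 + 1 := sz_list_le fun b _ => sz_bool b

theorem sz_idRows (n : ℕ) : sz (idRows n) ≤ n * (n * 4 + 1 + 1) + 1 := by
  have := sz_list_le (l := idRows n) (b := n * 4 + 1) fun r hr => by
    have h := sz_boolList r
    rwa [length_of_mem_idRows hr] at h
  rwa [length_idRows] at this

theorem PolyTime.idRows {n : X → ℕ} (hn : PolyTime w n) :
    PolyTime w (fun x => idRows (n x)) := by
  have h : PolyTime sz VCHard.idRows := by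
    refine PolyTime.iterate (f := fun _ => idStep) (b := fun n => sz n * (sz n * 4 + 1 + 1) + 1)
      (.id (.self _)) (.const (.self _) _) ?_ ?_ ?_
    · refine PolyTime.cons (PolyTime.cons (.const (.self _) true)
        (PolyTime.snd.map (.const (.self _) false))) (PolyTime.snd.map ?_)
      exact PolyTime.cons (.const (.self _) false) .snd
    · exact ((PolyIn.self _).mul ((((PolyIn.self _).mul (.const _ 4)).add (.const _ 1)).add
        (.const _ 1))).add (.const _ 1)
    · intro n i hi
      have h1 : i ≤ sz n := by rw [sz_nat]; lia
      refine (sz_idRows i).trans ?_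
      gcongr
  exact h.comp hn

section Tuples

variable {A B : Type}

/-- All tuples of a given length with entries in a list. -/
def tuples (l : ℕ) (L : List A) : List (List A) :=
  (fun T => (L ×ˢ T).map fun q => q.1 :: q.2)^[l] [[]]

theorem tuples_succ (l : ℕ) (L : List A) :
    tuples (l + 1) L = (L ×ˢ tuples l L).map fun q => q.1 :: q.2 :=
  Function.iterate_succ_apply' _ _ _

theorem length_tuples (l : ℕ) (L : List A) : (tuples l L).length = L.length ^ l := by
  induction l with
  | zero => rfl
  | succ l ih => rw [tuples_succ, List.length_map, List.length_product, ih, pow_succ, mul_comm]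

theorem mem_tuples {l : ℕ} {L : List A} {t : List A} :
    t ∈ tuples l L ↔ t.length = l ∧ ∀ a ∈ t, a ∈ L := by
  induction l generalizing t with
  | zero =>
    have : tuples 0 L = [[]] := rfl
    rw [this, List.mem_singleton, List.length_eq_zero_iff]
    exact ⟨by rintro rfl; simp, fun h => h.1⟩
  | succ l ih =>
    rw [tuples_succ, List.mem_map]
    constructor
    · rintro ⟨⟨a, r⟩, h, rfl⟩
      obtain ⟨h1, h2⟩ := List.pair_mem_product.1 h
      obtain ⟨h3, h4⟩ := ih.1 h2
      refine ⟨by simp [h3], fun b hb => ?_⟩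
      rcases List.mem_cons.1 hb with rfl | hb
      · exact h1
      · exact h4 b hb
    · rintro ⟨h1, h2⟩
      rcases t with _ | ⟨a, t⟩
      · simp at h1
      · refine ⟨(a, t), List.pair_mem_product.2 ⟨h2 a (by simp), ih.2 ⟨by simpa using h1,
          fun b hb => h2 b (by simp [hb])⟩⟩, rfl⟩

theorem nodup_tuples (l : ℕ) {L : List A} (h : L.Nodup) : (tuples l L).Nodup := by
  induction l with
  | zero => exact List.nodup_singleton _
  | succ l ih =>
    rw [tuples_succ]
    refine (h.product ih).map fun q q' e => ?_
    simp only [List.cons.injEq] at e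
    exact Prod.ext e.1 e.2

theorem tuples_map (f : A → B) (l : ℕ) (L : List A) :
    tuples l (L.map f) = (tuples l L).map (List.map f) := by
  induction l with
  | zero => rfl
  | succ l ih =>
    rw [tuples_succ, tuples_succ, ih]
    simp only [SProd.sprod, List.product, List.map_flatMap, List.flatMap_map, List.map_map]
    rfl

theorem sz_tuples_le [Enc A] {i l : ℕ} (h : i ≤ l) (L : List A) :
    sz (tuples i L) ≤ (L.length ^ l + 1) * (l * (sz L + 1) + 2) + 1 := by
  refine (sz_list_le (b := l * (sz L + 1) + 1) fun t ht => ?_).trans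
    (Nat.add_le_add_right (Nat.mul_le_mul_right _ ?_) 1)
  · obtain ⟨h1, h2⟩ := mem_tuples.1 ht
    refine (sz_list_le (b := sz L) fun a ha => ?_).trans
      (Nat.add_le_add_right (Nat.mul_le_mul_right _ (h1.le.trans h)) 1)
    have := sz_le_of_mem (h2 a ha)
    lia
  · rw [length_tuples]
    rcases Nat.eq_zero_or_pos L.length with h0 | h0
    · rw [h0]
      rcases Nat.eq_zero_or_pos i with rfl | hi
      · simp
      · simp [hi.ne']
    · exact (Nat.pow_le_pow_right h0 h).trans (Nat.le_succ _)

end Tuples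

/-- The number of tuples is not polynomial in the input; this is why weights other than the size are
admitted. -/
theorem PolyTime.tuples {A : Type} [Enc A] {l : X → ℕ} {L : X → List A} (hl : PolyTime w l)
    (hL : PolyTime w L) (hb : PolyIn w fun x => (L x).length ^ l x) :
    PolyTime w (fun x => tuples (l x) (L x)) := by
  -- The list is computed in time polynomial in `w` only, while the body must be polynomial in its
  -- own input. So the list travels in the state.
  set F : List A × List (List A) → List A × List (List A) :=
    fun q => (q.1, (q.1 ×ˢ q.2).map fun q => q.1 :: q.2)
  have e : ∀ (L : List A) i, F^[i] (L, [[]]) = (L, VCHard.tuples i L) := by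
    intro L i
    induction i with
    | zero => rfl
    | succ i ih => rw [Function.iterate_succ_apply', ih, tuples_succ]
  have h := hl.iterate (f := fun _ => F) (s := fun x => (L x, [[]]))
    (hL.prodMk (.const hl.weight [[]]))
    (PolyTime.snd.fst_comp.prodMk ((PolyTime.snd.fst_comp.product PolyTime.snd.snd_comp).map
      (PolyTime.snd.fst_comp.cons PolyTime.snd.snd_comp)))
    (hL.size.add (((((hb.add (.const w 1)).mul (((hl.size).mul (hL.size.add (.const w 1))).add
      (.const w 2))).add (.const w 1))).add (.const w 1))) (by
      intro x i hi
      rw [e, sz_pair, add_assoc]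
      refine Nat.add_le_add_left (Nat.add_le_add_right ((sz_tuples_le hi (L x)).trans ?_) 1) _
      have : l x ≤ sz (l x) := by rw [sz_nat]; lia
      gcongr)
  simpa only [e] using h.snd_comp

end Reduction

end VCHard

/-! ### The random matrix of a graph and the program that produces it. -/

namespace VCHard
open Enc (enc)

/-! ### Random marks -/

/-- A fair coin. -/
noncomputable def coin : PMF Bool := PMF.uniformOfFintype Bool

/-- A coin that shows `true` with probability `2 ^ (-j)`. -/
noncomputable def bern (j : ℕ) : PMF Bool :=
  foldP (fun _ b => if b then coin else PMF.pure false) (List.replicate j ()) true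

/-- Mark each entry of a list independently with a bit that is `true` with probability `2 ^ (-j)`.
The result comes in reversed order. -/
noncomputable def mark {A : Type} (j : ℕ) (l : List A) : PMF (List (Bool × A)) :=
  foldP (fun a acc => (bern j).map fun b => (b, a) :: acc) l []

theorem foldP_mark_support {A : Type} {j : ℕ} {l : List A} {acc m : List (Bool × A)}
    (h : m ∈ (foldP (fun a acc => (bern j).map fun b => (b, a) :: acc) l acc).support) :
    m.map Prod.snd = l.reverse ++ acc.map Prod.snd := by
  induction l generalizing acc with
  | nil => rw [foldP, PMF.mem_support_pure_iff] at h; simp [h]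
  | cons a l ih =>
    rw [foldP, PMF.mem_support_bind_iff] at h
    obtain ⟨r, hr, h⟩ := h
    rw [PMF.mem_support_map_iff] at hr
    obtain ⟨b, -, rfl⟩ := hr
    rw [ih h]
    simp

theorem mark_support {A : Type} {j : ℕ} {l : List A} {m : List (Bool × A)}
    (h : m ∈ (mark j l).support) : m.map Prod.snd = l.reverse := by
  simpa using foldP_mark_support h

theorem mark_map {A B : Type} (f : A → B) (j : ℕ) (l : List A) :
    mark j (l.map f) = (mark j l).map (List.map fun q => (q.1, f q.2)) := by
  have := foldP_map (F := fun a (acc : List (Bool × A)) => (bern j).map fun b => (b, a) :: acc)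
    (G := fun a acc => (bern j).map fun b => (b, a) :: acc) f
    (List.map fun q : Bool × A => (q.1, f q.2)) (fun a s => by
      rw [PMF.map_comp]; rfl) l []
  exact this

section Reduction

variable {X A V : Type} [Enc X] [Enc A] [Enc V] {w : X → ℕ}

theorem PolyTimeR.coin (hw : PolyIn w sz) : PolyTimeR w (fun _ => coin) :=
  ⟨hw, .flip, fun _ => 3, .const w 3, fun x => ⟨(Prog.Computes.flip (enc x)).mono (by norm_num),
    fun b _ => sz_bool b⟩⟩

theorem PolyTimeR.bern {j : X → ℕ} (hj : PolyTime w j) : PolyTimeR w (fun x => bern (j x)) := by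
  have h := PolyTimeR.fold (F := fun _ _ b => if b then VCHard.coin else PMF.pure false)
    hj.units (PolyTime.const hj.weight true) (PolyTimeR.cond PolyTime.snd
      (PolyTimeR.coin (.self _)) (PolyTime.const (.self _) false)) (.const w 3)
    (fun _ _ _ b _ => sz_bool b)
  simp only [PMF.pure_bind] at h
  exact h

theorem PolyTimeR.mark {j : X → ℕ} {l : X → List A} (hj : PolyTime w j) (hl : PolyTime w l) :
    PolyTimeR w (fun x => mark (j x) (l x)) := by
  have hbase : PolyTimeR sz fun q : ℕ × List A => VCHard.mark q.1 q.2 := by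
    have h := PolyTimeR.fold (X := ℕ × List A) (F := fun q a acc => (VCHard.bern q.1).map
      fun b => (b, a) :: acc) (s := fun _ => PMF.pure []) PolyTime.snd
      (PolyTime.const (.self _) []) (by
        have h1 : PolyTimeR sz fun q : ((ℕ × List A) × A) × List (Bool × A) =>
            (VCHard.bern q.1.1.1).bind fun b => (PMF.pure (q.1.2, q.2)).map fun r => (b, r) :=
          (PolyTimeR.bern PolyTime.fst.fst_comp.fst_comp).prodMk
            (PolyTime.fst.snd_comp.prodMk PolyTime.snd)
        have h2 : PolyTime sz fun q : Bool × (A × List (Bool × A)) => (q.1, q.2.1) :: q.2.2 :=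
          (PolyTime.fst.prodMk PolyTime.snd.fst_comp).cons PolyTime.snd.snd_comp
        have h3 := PolyTimeR.map h2 h1
        simp only [PMF.pure_map, PMF.map_bind] at h3
        exact h3)
      (b := fun q => sz q * (sz q + 5) + 1)
      (((PolyIn.self _).mul ((PolyIn.self _).add (.const _ 5))).add (.const _ 1)) (by
        intro q r hr m hm
        rw [PMF.pure_bind] at hm
        have hm := foldP_mark_support hm
        rw [List.map_nil, List.append_nil] at hm
        have hlen : m.length = r.length := by simpa using congrArg List.length hm
        have h2 := sz_prefix hr
        have hq : sz q.2 ≤ sz q := by rw [sz_pair]; lia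
        refine (sz_list_le (b := sz q + 4) fun y hy => ?_).trans
          (Nat.add_le_add_right (Nat.mul_le_mul_right _ ?_) 1)
        · have h1 : y.2 ∈ r := by
            rw [← List.mem_reverse, ← hm]
            exact List.mem_map_of_mem hy
          have h3 := sz_le_of_mem h1
          have h4 := sz_bool y.1
          rw [sz_pair]
          lia
        · have := length_le_sz r
          lia)
    simp only [PMF.pure_bind] at h
    exact h
  exact PolyTime.compR hbase (hj.prodMk hl)

/-! ### The matrix -/

/-- The entry of the matrix for a row and a column: each carries a mark, a Boolean vector, and a
tuple of vertices. -/
def entry (compat : V → V → Bool) (r c : Bool × (List Bool × List V)) : Bool :=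
  r.1 && (c.1 && (dot r.2.1 c.2.1 && r.2.2.all fun u => c.2.2.all fun v => compat u v))

/-- The columns of the matrix, which has an identity matrix at the bottom. -/
def columns (compat : V → V → Bool) (rs cs : List (Bool × (List Bool × List V))) :
    List (List Bool) :=
  (cs.zip (idRows cs.length)).map fun q => rs.map (fun r => entry compat r q.1) ++ q.2

theorem PolyTime.entry {compat : V → V → Bool} (hc : PolyTime sz fun q : V × V => compat q.1 q.2)
    {r c : X → Bool × (List Bool × List V)} (hr : PolyTime w r) (hc' : PolyTime w c) :
    PolyTime w (fun x => entry compat (r x) (c x)) := by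
  have h : PolyTime sz fun q : (Bool × (List Bool × List V)) × (Bool × (List Bool × List V)) =>
      VCHard.entry compat q.1 q.2 := by
    refine PolyTime.fst.fst_comp.and (PolyTime.snd.fst_comp.and
      ((PolyTime.fst.snd_comp.fst_comp.dot PolyTime.snd.snd_comp.fst_comp).and ?_))
    refine PolyTime.fst.snd_comp.snd_comp.all ?_
    refine PolyTime.fst.snd_comp.snd_comp.snd_comp.all ?_
    exact hc.comp (PolyTime.fst.snd_comp.prodMk PolyTime.snd)
  exact h.comp (hr.prodMk hc')

theorem PolyTime.columns {compat : V → V → Bool}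
    (hc : PolyTime sz fun q : V × V => compat q.1 q.2)
    {rs cs : X → List (Bool × (List Bool × List V))} (hr : PolyTime w rs) (hcs : PolyTime w cs) :
    PolyTime w (fun x => columns compat (rs x) (cs x)) := by
  have h : PolyTime sz fun q : List (Bool × (List Bool × List V)) ×
      List (Bool × (List Bool × List V)) => VCHard.columns compat q.1 q.2 := by
    have h1 : PolyTime sz fun q : List (Bool × (List Bool × List V)) ×
      List (Bool × (List Bool × List V)) => q.2.zip (VCHard.idRows q.2.length) :=
      PolyTime.snd.zip PolyTime.snd.length.idRows (d := []) rfl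
        (fun q => by rw [length_idRows])
    refine h1.map (PolyTime.append (PolyTime.fst.fst_comp.map ?_) PolyTime.snd.snd_comp)
    exact .entry hc .snd PolyTime.fst.snd_comp.fst_comp
  exact h.comp (hr.prodMk hcs)

/-- A vertex, as a program sees it: its row of the adjacency matrix and its unit vector. -/
abbrev VRep : Type := List Bool × List Bool

/-- Two vertices are equal or adjacent. -/
def VRep.compat (u v : VRep) : Bool := dot u.1 v.2 || dot u.2 v.2

/-- The vertices of a graph given by its adjacency matrix. -/
def vertices (G : List (List Bool)) : List VRep := G.zip (idRows G.length)

/-- Pairs of a Boolean vector from a list and a tuple of vertices. -/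
def candidates (es : List (List Bool)) (l : ℕ) (vs : List V) : List (List Bool × List V) :=
  es ×ˢ tuples l vs

/-- The random matrix for a list of vertices (together with the dimension). -/
noncomputable def reduction (compat : V → V → Bool) (k l j : ℕ) (vs : List V) :
    PMF (ℕ × List (List Bool)) :=
  (mark j (candidates (idRows k) l vs)).bind fun rs =>
    (mark j (candidates (tuples k [false, true]) l vs)).map fun cs => (k, columns compat rs cs)

/-- The program represents a vertex by two Boolean vectors, whereas the analysis uses the vertex
itself. The matrix depends on vertices only through `compat`, so both views give the same
distribution. -/
theorem reduction_map {V V' : Type} {compat : V → V → Bool} {compat' : V' → V' → Bool}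
    (f : V' → V) (hf : ∀ u v, compat (f u) (f v) = compat' u v) (k l j : ℕ) (vs : List V') :
    reduction compat k l j (vs.map f) = reduction compat' k l j vs := by
  have h1 : ∀ es : List (List Bool), candidates es l (vs.map f)
      = (candidates es l vs).map fun q => (q.1, q.2.map f) := by
    intro es
    simp only [candidates, tuples_map, SProd.sprod, List.product, List.map_flatMap, List.map_map]
    rfl
  have h2 : ∀ rs cs : List (Bool × (List Bool × List V')),
      columns compat (rs.map fun q => (q.1, (q.2.1, q.2.2.map f)))
        (cs.map fun q => (q.1, (q.2.1, q.2.2.map f))) = columns compat' rs cs := by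
    intro rs cs
    simp only [columns, List.length_map, List.zip_map_left, List.map_map]
    refine List.map_congr_left fun q _ => ?_
    simp only [Function.comp_def, entry, List.all_map, hf, Prod.map]
    rfl
  simp only [reduction, h1, mark_map, PMF.bind_map, PMF.map_comp, Function.comp_def, h2]

/-- The numbers `2 ^ k` and `(G x).length ^ l` of vectors and tuples are the only quantities that
need not be polynomial in the input. -/
theorem reduction_polyTime {k l j : X → ℕ} {G : X → List (List Bool)} (hk : PolyTime w k)
    (hl : PolyTime w l) (hj : PolyTime w j) (hG : PolyTime w G)
    (hkw : PolyIn w fun x => 2 ^ k x) (hlw : PolyIn w fun x => (G x).length ^ l x) :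
    PolyTimeR w (fun x => reduction VRep.compat (k x) (l x) (j x) (vertices (G x))) := by
  have hv : PolyTime w fun x => vertices (G x) :=
    hG.zip hG.length.idRows (d := []) rfl (fun q => by rw [length_idRows])
  have ht : PolyTime w fun x => tuples (l x) (vertices (G x)) := hl.tuples hv <| by
    simpa [vertices, length_idRows] using hlw
  have hr : PolyTime w fun x => candidates (idRows (k x)) (l x) (vertices (G x)) :=
    hk.idRows.product ht
  have hc : PolyTime w fun x => candidates (tuples (k x) [false, true]) (l x) (vertices (G x)) :=
    (hk.tuples (L := fun _ => [false, true]) (.const hk.weight _) hkw).product ht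
  have hcompat : PolyTime sz fun q : VRep × VRep => VRep.compat q.1 q.2 :=
    (PolyTime.fst.fst_comp.dot PolyTime.snd.snd_comp).or
      (PolyTime.fst.snd_comp.dot PolyTime.snd.snd_comp)
  have h1 := PolyTimeR.prodMk hk (PolyTimeR.prodMk (PolyTimeR.mark hj hr) (PolyTimeR.mark hj hc))
  have h2 : PolyTime sz fun q : ℕ × (List (Bool × (List Bool × List VRep)) ×
      List (Bool × (List Bool × List VRep))) => (q.1, columns VRep.compat q.2.1 q.2.2) :=
    PolyTime.fst.prodMk (.columns hcompat PolyTime.snd.fst_comp PolyTime.snd.snd_comp)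
  have h3 := PolyTimeR.map h2 h1
  simp only [PMF.pure_bind, PMF.map_bind, PMF.map_comp, Function.comp_def] at h3
  exact h3

end Reduction

end VCHard

/-! ### Combinatorics of the two dimensions and of the matrix. -/

namespace VCHard
open Enc (enc)

/-! ### Bounds for Littlestone's dimension -/

section Littlestone

variable {X : Type*} [DecidableEq X]

/-- The sequence on which an online algorithm errs all the time. -/
def OnlineAlgorithm.adversary {X : Type*} (A : OnlineAlgorithm X) : List (X × Bool) → List X → List (X × Bool)
  | _, [] => []
  | hist, x :: l => (x, !A hist x) :: adversary A (hist ++ [(x, !A hist x)]) l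

theorem OnlineAlgorithm.adversary_spec {X : Type*} (A : OnlineAlgorithm X) (hist : List (X × Bool))
    (l : List X) : (A.adversary hist l).map Prod.fst = l ∧
      A.mistakes hist (A.adversary hist l) = l.length := by
  induction l generalizing hist with
  | nil => exact ⟨rfl, rfl⟩
  | cons x l ih =>
    obtain ⟨h1, h2⟩ := ih (hist ++ [(x, !A hist x)])
    refine ⟨by rw [adversary, List.map_cons, h1], ?_⟩
    rw [adversary, mistakes, h2, if_neg (by cases A hist x <;> simp), List.length_cons, add_comm]

theorem OnlineAlgorithm.mistakes_le_length {X : Type*} (A : OnlineAlgorithm X) (hist l : List (X × Bool)) :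
    A.mistakes hist l ≤ l.length := by
  induction l generalizing hist with
  | nil => exact le_rfl
  | cons q l ih =>
    have := ih (hist ++ [(q.1, q.2)])
    rw [mistakes, List.length_cons]
    split_ifs <;> lia

/-- Distinct points cannot carry contradictory labels, so the points labelled 1 form a subset of `T`
that some concept cuts out. -/
theorem realizable_of_shatters {C : Finset (Finset X)} {T : Finset X} (hT : C.Shatters T)
    {s : List (X × Bool)} (hs : (s.map Prod.fst).Nodup) (hsT : ∀ q ∈ s, q.1 ∈ T) :
    Realizable C s := by
  obtain ⟨c, hc, e⟩ := hT (t := T.filter fun x => (x, true) ∈ s) (Finset.filter_subset _ _)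
  refine ⟨c, hc, fun q hq => ?_⟩
  have h1 : q.1 ∈ c ↔ (q.1, true) ∈ s := by
    have := congrArg (q.1 ∈ ·) e
    simpa [hsT q hq] using this
  rcases q with ⟨x, b⟩
  cases b with
  | true => simp [h1, hq]
  | false =>
    have h2 : (x, true) ∉ s := fun h => by
      have := List.inj_on_of_nodup_map hs hq h rfl
      simp at this
    simp [h1, h2]

/-- On a shattered set an adversary can contradict every prediction, and the resulting sequence is
still realizable. -/
theorem vcDim_le_ldim [Fintype X] (C : Finset (Finset X)) : C.vcDim ≤ ldim C := by
  -- The infimum is over a nonempty set: no algorithm errs more than once per point.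
  refine le_csInf ⟨Fintype.card X, fun _ _ => false, fun s hs _ =>
    (OnlineAlgorithm.mistakes_le_length _ _ _).trans ?_⟩ ?_
  · simpa using hs.length_le_card
  · rintro d ⟨A, hA⟩
    refine Finset.sup_le fun T hT => ?_
    rw [mem_shatterer] at hT
    obtain ⟨h1, h2⟩ := A.adversary_spec [] T.toList
    rw [← Finset.length_toList, ← h2]
    refine hA _ (by rw [h1]; exact T.nodup_toList) (realizable_of_shatters hT
      (by rw [h1]; exact T.nodup_toList) fun q hq => ?_)
    rw [← Finset.mem_toList, ← h1]
    exact List.mem_map_of_mem hq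

/-- The concepts that agree with all the labels of a sequence. -/
def versionSpace (C : Finset (Finset X)) (hist : List (X × Bool)) : Finset (Finset X) :=
  C.filter fun c => ∀ q ∈ hist, q.2 = decide (q.1 ∈ c)

/-- The points with label 1. -/
def positives (hist : List (X × Bool)) : List X := (hist.filter Prod.snd).map Prod.fst

/-- Predict the label 0 until `s` points with label 1 have been seen, then follow the majority of
the remaining concepts. -/
def lazyHalving (C : Finset (Finset X)) (s : ℕ) : OnlineAlgorithm X := fun hist x =>
  if (positives hist).length < s then false else
    decide ((versionSpace C hist).card ≤ 2 * ((versionSpace C hist).filter (x ∈ ·)).card)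

theorem versionSpace_append (C : Finset (Finset X)) (hist : List (X × Bool)) (x : X) (y : Bool) :
    versionSpace C (hist ++ [(x, y)])
      = (versionSpace C hist).filter fun c => y = decide (x ∈ c) := by
  ext c
  simp only [versionSpace, mem_filter, List.mem_append, List.mem_singleton]
  constructor
  · rintro ⟨h1, h2⟩
    exact ⟨⟨h1, fun q hq => h2 q (Or.inl hq)⟩, h2 (x, y) (Or.inr rfl)⟩
  · rintro ⟨⟨h1, h2⟩, h3⟩
    exact ⟨h1, fun q hq => hq.elim (h2 q) fun e => by rw [e]; exact h3⟩

/-- While fewer than `s` ones have been seen, every mistake reveals a further one. Once `s` ones are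
known, every consistent concept contains these points, so at most `s` concepts remain. From then on
each mistake halves the version space, which costs at most `Nat.log 2 s ≤ s` further mistakes. -/
theorem lazyHalving_mistakes {C : Finset (Finset X)} {s : ℕ}
    (hC : ∀ P : Finset X, P.card = s → (C.filter (P ⊆ ·)).card ≤ s) (l hist : List (X × Bool))
    (hl : ((hist ++ l).map Prod.fst).Nodup) (hr : Realizable C (hist ++ l)) :
    (lazyHalving C s).mistakes hist l ≤ if (positives hist).length < s
      then s - (positives hist).length + s else Nat.log 2 (versionSpace C hist).card := by
  induction l generalizing hist with
  | nil => exact Nat.zero_le _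
  | cons q l ih =>
    obtain ⟨x, y⟩ := q
    have happ : hist ++ (x, y) :: l = (hist ++ [(x, y)]) ++ l := by simp
    rw [happ] at hl hr
    have ih := ih _ hl hr
    have hpos : positives (hist ++ [(x, y)]) = positives hist ++ if y then [x] else [] := by
      cases y <;> simp [positives]
    have hsub : versionSpace C (hist ++ [(x, y)]) ⊆ versionSpace C hist := by
      rw [versionSpace_append]; exact Finset.filter_subset _ _
    have hV : 0 < (versionSpace C (hist ++ [(x, y)])).card := by
      obtain ⟨c, hc, h⟩ := hr
      exact Finset.card_pos.2 ⟨c, Finset.mem_filter.2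
        ⟨hc, fun q hq => h q (List.mem_append_left _ hq)⟩⟩
    rw [OnlineAlgorithm.mistakes]
    by_cases hp : (positives hist).length < s
    · have hA : lazyHalving C s hist x = false := if_pos hp
      rw [hA, if_pos hp]
      cases y with
      | false =>
        rw [if_neg Bool.false_ne_true, List.append_nil] at hpos
        rw [hpos, if_pos hp] at ih
        rw [if_pos rfl]
        lia
      | true =>
        rw [if_neg (by simp)]
        rw [if_pos rfl] at hpos
        have hlen : (positives (hist ++ [(x, true)])).length = (positives hist).length + 1 := by
          rw [hpos]; simp
        by_cases hp' : (positives hist).length + 1 < s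
        · rw [hlen, if_pos hp'] at ih
          lia
        · rw [hlen, if_neg hp'] at ih
          have hnd : (positives (hist ++ [(x, true)])).Nodup := by
            have h1 : (positives (hist ++ [(x, true)])).Sublist
                (((hist ++ [(x, true)]) ++ l).map Prod.fst) :=
              (List.filter_sublist.trans (List.sublist_append_left _ _)).map _
            exact hl.sublist h1
          have hcard := hC (positives (hist ++ [(x, true)])).toFinset (by
            rw [List.toFinset_card_of_nodup hnd]; lia)
          have hle : (versionSpace C (hist ++ [(x, true)])).card ≤ s := by
            refine (Finset.card_le_card fun c hc => ?_).trans hcard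
            obtain ⟨h1, h2⟩ := Finset.mem_filter.1 hc
            refine Finset.mem_filter.2 ⟨h1, fun z hz => ?_⟩
            rw [List.mem_toFinset, positives, List.mem_map] at hz
            obtain ⟨q, hq, rfl⟩ := hz
            obtain ⟨h3, h4⟩ := List.mem_filter.1 hq
            have := h2 q h3
            rw [h4] at this
            simpa using this.symm
          have := Nat.log_le_self 2 (versionSpace C (hist ++ [(x, true)])).card
          lia
    · have hp' : ¬ (positives (hist ++ [(x, y)])).length < s := by
        rw [hpos, List.length_append]; lia
      rw [if_neg hp'] at ih
      rw [if_neg hp]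
      have hA : lazyHalving C s hist x = decide ((versionSpace C hist).card ≤
        2 * ((versionSpace C hist).filter (x ∈ ·)).card) := if_neg hp
      rw [hA]
      split_ifs with h
      · rw [zero_add]
        exact ih.trans (Nat.log_mono_right (Finset.card_le_card hsub))
      · have h2 : (versionSpace C (hist ++ [(x, y)])).card * 2 ≤ (versionSpace C hist).card := by
          have h3 := Finset.card_filter_add_card_filter_not (s := versionSpace C hist) (x ∈ ·)
          rw [versionSpace_append]
          cases y with
          | true =>
            rw [decide_eq_true_eq, not_le] at h
            simp only [eq_comm (a := true), decide_eq_true_eq]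
            lia
          | false =>
            rw [decide_eq_false_iff_not, not_not] at h
            simp only [eq_comm (a := false), decide_eq_false_iff_not]
            lia
        have h4 := Nat.log_mono_right (b := 2) h2
        rw [Nat.log_mul_base (by norm_num) hV.ne'] at h4
        lia

theorem ldim_le {C : Finset (Finset X)} {s : ℕ}
    (hC : ∀ P : Finset X, P.card = s → (C.filter (P ⊆ ·)).card ≤ s) (hs : 0 < s) :
    ldim C ≤ 2 * s := by
  refine Nat.sInf_le ⟨lazyHalving C s, fun l hl hr => ?_⟩
  have := lazyHalving_mistakes hC l [] hl hr
  rw [if_pos (by simpa [positives] using hs)] at this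
  simp only [positives, List.filter_nil, List.map_nil, List.length_nil] at this
  lia

end Littlestone

/-! ### The concept class of the matrix -/

section Matrix

variable {V : Type} (compat : V → V → Bool) (rs cs : List (Bool × (List Bool × List V)))

/-- The matrix with the given columns. -/
def matrixOf : Matrix (Fin (rs.length + cs.length)) (Fin cs.length) Bool := fun i j =>
  if h : i.1 < rs.length then entry compat (rs[i.1]) (cs[j.1]) else decide (i.1 = rs.length + j.1)

theorem columns_eq : columns compat rs cs = (List.finRange cs.length).map fun j =>
    (List.finRange (rs.length + cs.length)).map fun i => matrixOf compat rs cs i j := by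
  refine List.ext_getElem (by simp [columns, length_idRows]) fun j h1 h2 => ?_
  have hj : j < cs.length := by simpa using h2
  simp only [columns, List.getElem_map, List.getElem_zip, List.getElem_finRange, idRows_eq]
  refine List.ext_getElem (by simp) fun i h3 h4 => ?_
  simp only [List.getElem_map, List.getElem_finRange, matrixOf, List.getElem_append,
    List.length_map]
  by_cases hi : i < rs.length
  · simp [hi]
  · simp only [hi, dite_false, Fin.cast_mk, Fin.mk.injEq, Fin.val_mk]
    congr 1
    simp
    lia

theorem ofList_map {A B : Type*} (f : B → Data) (g : A → B) (l : List A) :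
    Data.ofList f (l.map g) = Data.ofList (fun a => f (g a)) l := by
  induction l with
  | nil => rfl
  | cons a l ih => rw [List.map_cons, Data.ofList, Data.ofList, ih]

theorem enc_columns (k : ℕ) :
    enc (k, columns compat rs cs) = encodeInstance k (matrixOf compat rs cs) := by
  change Data.cons (Data.ofNat k) (Data.ofList (Data.ofList Data.ofBool) _) = _
  rw [columns_eq, ofList_map]
  simp only [ofList_map]
  rfl

/-- The identity block separates the columns. -/
theorem matrixOf_transpose_injective : Function.Injective (matrixOf compat rs cs).transpose := by
  intro j j' h
  have := congrFun h ⟨rs.length + j.1, by lia⟩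
  simp only [Matrix.transpose_apply, matrixOf] at this
  rw [dif_neg (by simp), dif_neg (by simp)] at this
  simpa [Fin.ext_iff] using this

variable {compat rs cs}

/-- For rows and columns with pairwise compatible tuples only the vectors matter: the entry for the
`i`-th unit vector and `T` is the `i`-th bit of `T`, and `T` runs through all patterns. -/
theorem le_vcDim {k : ℕ} (rowTuple : Fin k → List V) (colTuple : List Bool → List V)
    (hr : ∀ i, (true, ((List.finRange k).map fun j => decide (i = j), rowTuple i)) ∈ rs)
    (hc : ∀ T : List Bool, T.length = k → (true, (T, colTuple T)) ∈ cs)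
    (hcompat : ∀ i T, T.length = k → ∀ u ∈ rowTuple i, ∀ v ∈ colTuple T, compat u v) :
    k ≤ (conceptClass (matrixOf compat rs cs)).vcDim := by
  choose r hr1 hr2 using fun i => List.mem_iff_getElem.1 (hr i)
  set p : Fin k → Fin (rs.length + cs.length) := fun i => ⟨r i, (hr1 i).trans_le (by lia)⟩
  have hp : Function.Injective p := by
    intro i i' h
    have h1 : r i = r i' := congrArg Fin.val h
    have h2 := hr2 i
    simp only [h1] at h2
    rw [hr2 i'] at h2
    have h3 := List.map_inj_left.1 (congrArg (fun q => q.2.1) h2) i (List.mem_finRange _)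
    simpa [eq_comm] using h3
  have hsh : (conceptClass (matrixOf compat rs cs)).Shatters (univ.image p) := by
    intro t ht
    set T : List Bool := (List.finRange k).map fun i => decide (p i ∈ t)
    have hT : T.length = k := by simp [T]
    obtain ⟨j, hj, hj2⟩ := List.mem_iff_getElem.1 (hc T hT)
    refine ⟨_, Finset.mem_image.2 ⟨⟨j, hj⟩, Finset.mem_univ _, rfl⟩, ?_⟩
    have hM : ∀ i, matrixOf compat rs cs (p i) ⟨j, hj⟩ = decide (p i ∈ t) := by
      intro i
      have h1 : matrixOf compat rs cs (p i) ⟨j, hj⟩ = entry compat (rs[r i]'(hr1 i)) cs[j] :=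
        dif_pos (hr1 i)
      rw [h1, hr2, hj2, entry, Bool.true_and, Bool.true_and]
      have h2 : ((rowTuple i).all fun u => (colTuple T).all fun v => compat u v) = true := by
        rw [List.all_eq_true]
        intro u hu
        rw [List.all_eq_true]
        exact fun v hv => hcompat i T hT u hu v hv
      simp only [h2, Bool.and_true]
      rw [Bool.eq_iff_iff, dot_iff]
      simp only [T, List.getElem?_map, Option.map_eq_some_iff, decide_eq_true_eq]
      constructor
      · rintro ⟨n, ⟨a, ha, rfl⟩, ⟨b, hb, h⟩⟩
        rw [ha] at hb
        cases hb
        exact h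
      · intro h
        have : (List.finRange k)[i.1]? = some i := by
          rw [List.getElem?_eq_getElem (by simp)]; simp
        exact ⟨i.1, ⟨i, this, rfl⟩, ⟨i, this, h⟩⟩
    ext x
    simp only [mem_inter, mem_image, mem_univ, true_and, mem_filter]
    constructor
    · rintro ⟨⟨i, rfl⟩, h⟩
      rw [hM] at h
      simpa using h
    · intro hx
      obtain ⟨i, -, rfl⟩ := Finset.mem_image.1 (ht hx)
      exact ⟨⟨i, rfl⟩, by rw [hM]; simpa using hx⟩
  have := hsh.card_le_vcDim
  rwa [Finset.card_image_of_injective _ hp, Finset.card_univ, Fintype.card_fin] at this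

/-- If `s` points lay in more than `s` common concepts, none of them could be a row of the identity
block, because such a row has a single 1. The points and `s` of the concepts would form an all-1
block of marked and compatible rows and columns. -/
theorem ldim_matrixOf_le [DecidableEq V] {s : ℕ} (hs : 0 < s) (hrs : rs.Nodup) (hcs : cs.Nodup)
    (h : ∀ R S : Finset (Bool × (List Bool × List V)), R.card = s → S.card = s →
      (∀ r ∈ R, r ∈ rs ∧ r.1 = true) → (∀ c ∈ S, c ∈ cs ∧ c.1 = true) →
      ¬ ∀ r ∈ R, ∀ c ∈ S, ∀ u ∈ r.2.2, ∀ v ∈ c.2.2, compat u v) :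
    ldim (conceptClass (matrixOf compat rs cs)) ≤ 2 * s := by
  refine ldim_le (fun P hP => ?_) hs
  by_contra hlt
  rw [not_le] at hlt
  set J : Finset (Fin cs.length) := univ.filter fun j => ∀ i ∈ P, matrixOf compat rs cs i j = true
  have hJ : s < J.card := by
    refine hlt.trans_le ((Finset.card_le_card (t := J.image fun j =>
      univ.filter fun i => matrixOf compat rs cs i j = true) fun c hc => ?_).trans
      Finset.card_image_le)
    obtain ⟨h1, h2⟩ := Finset.mem_filter.1 hc
    obtain ⟨j, -, rfl⟩ := Finset.mem_image.1 h1
    refine Finset.mem_image.2 ⟨j, Finset.mem_filter.2 ⟨Finset.mem_univ _, fun i hi => ?_⟩, rfl⟩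
    exact (Finset.mem_filter.1 (h2 hi)).2
  have hPr : ∀ i ∈ P, i.1 < rs.length := by
    intro i hi
    by_contra hi'
    have h1 : ∀ j ∈ J, i.1 = rs.length + j.1 := fun j hj => by
      have := (Finset.mem_filter.1 hj).2 i hi
      rw [matrixOf, dif_neg hi'] at this
      simpa using this
    have h2 : J.card ≤ 1 := Finset.card_le_one.2 fun a ha b hb => by
      have := h1 a ha
      have := h1 b hb
      exact Fin.ext (by lia)
    lia
  obtain ⟨J', hJ', hJc⟩ := Finset.exists_subset_card_eq hJ.le
  set fr : P → Bool × (List Bool × List V) := fun i => rs[i.1.1]'(hPr i.1 i.2)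
  set fc : Fin cs.length → Bool × (List Bool × List V) := fun j => cs[j.1]
  have hfr : Function.Injective fr := fun a b e => by
    have := (hrs.getElem_inj_iff).1 e
    exact Subtype.ext (Fin.ext this)
  have hfc : Function.Injective fc := fun a b e => Fin.ext ((hcs.getElem_inj_iff).1 e)
  have hent : ∀ i : P, ∀ j ∈ J', entry compat (fr i) (fc j) = true := by
    intro i j hj
    have := (Finset.mem_filter.1 (hJ' hj)).2 i.1 i.2
    rwa [matrixOf, dif_pos (hPr i.1 i.2)] at this
  have hent' : ∀ r c : Bool × (List Bool × List V), entry compat r c = true →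
      r.1 = true ∧ c.1 = true ∧ ∀ u ∈ r.2.2, ∀ v ∈ c.2.2, compat u v := by
    intro r c h
    simp only [entry, Bool.and_eq_true, List.all_eq_true] at h
    exact ⟨h.1, h.2.1, h.2.2.2⟩
  have hJne : J'.Nonempty := Finset.card_pos.1 (by lia)
  have hPne : P.Nonempty := Finset.card_pos.1 (by lia)
  obtain ⟨j₀, hj₀⟩ := hJne
  obtain ⟨i₀, hi₀⟩ := hPne
  refine h (univ.image fr) (J'.image fc) ?_ ?_ ?_ ?_ ?_
  · rw [Finset.card_image_of_injective _ hfr, Finset.card_univ, Fintype.card_coe, hP]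
  · rw [Finset.card_image_of_injective _ hfc, hJc]
  · intro r hr
    obtain ⟨i, -, rfl⟩ := Finset.mem_image.1 hr
    exact ⟨List.getElem_mem _, (hent' _ _ (hent i j₀ hj₀)).1⟩
  · intro c hc
    obtain ⟨j, hj, rfl⟩ := Finset.mem_image.1 hc
    exact ⟨List.getElem_mem _, (hent' _ _ (hent ⟨i₀, hi₀⟩ j hj)).2.1⟩
  · intro r hr c hc
    obtain ⟨i, -, rfl⟩ := Finset.mem_image.1 hr
    obtain ⟨j, hj, rfl⟩ := Finset.mem_image.1 hc
    exact (hent' _ _ (hent i j hj)).2.2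

end Matrix

end VCHard

/-! ### Probability estimates for the marks and for random graphs. -/

namespace VCHard
open Enc (enc)

/-! ### Probabilities of marks -/

theorem coin_apply (b : Bool) : coin b = 2⁻¹ := by
  simp [coin, PMF.uniformOfFintype_apply]

theorem toOuterMeasure_bind_bool (P : PMF Bool) {B : Type*} (F : Bool → PMF B) (E : Set B) :
    (P.bind F).toOuterMeasure E = P true * (F true).toOuterMeasure E
      + P false * (F false).toOuterMeasure E := by
  rw [PMF.toOuterMeasure_bind_apply, tsum_bool, add_comm]

theorem toOuterMeasure_pure {B : Type*} (b : B) (E : Set B) [Decidable (b ∈ E)] :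
    (PMF.pure b).toOuterMeasure E = if b ∈ E then 1 else 0 := by
  rw [PMF.toOuterMeasure_pure_apply]; congr

theorem bern_true (j : ℕ) : bern j true = 2⁻¹ ^ j := by
  have h0 : ∀ j, foldP (fun (_ : Unit) b => if b then coin else PMF.pure false)
      (List.replicate j ()) false = PMF.pure false := by
    intro j
    induction j with
    | zero => rfl
    | succ j ih => rw [List.replicate_succ, foldP, if_neg (by simp), PMF.pure_bind, ih]
  induction j with
  | zero => simp [bern, foldP]
  | succ j ih =>
    rw [bern, List.replicate_succ, foldP, if_pos rfl, ← PMF.toOuterMeasure_apply_singleton,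
      toOuterMeasure_bind_bool, h0, ← bern, PMF.toOuterMeasure_apply_singleton, ih, coin_apply,
      pow_succ, mul_comm]
    simp

/-- This expresses the independence of the marks: conditions on single entries multiply. -/
theorem foldP_mark_forall {A : Type} (Q : A → Set Bool) (j : ℕ) (l : List A)
    (acc : List (Bool × A)) :
    (foldP (fun a acc => (bern j).map fun b => (b, a) :: acc) l acc).toOuterMeasure
      {m | ∀ q ∈ m, q.1 ∈ Q q.2} = (PMF.pure acc).toOuterMeasure {m | ∀ q ∈ m, q.1 ∈ Q q.2} *
        (l.map fun x => (bern j).toOuterMeasure (Q x)).prod := by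
  classical
  induction l generalizing acc with
  | nil => simp [foldP]
  | cons a l ih =>
    have hb : (bern j).toOuterMeasure (Q a) = bern j true * (if true ∈ Q a then 1 else 0)
        + bern j false * (if false ∈ Q a then 1 else 0) := by
      conv_lhs => rw [← PMF.bind_pure (bern j)]
      rw [toOuterMeasure_bind_bool, toOuterMeasure_pure, toOuterMeasure_pure]
    rw [foldP, PMF.bind_map, toOuterMeasure_bind_bool, Function.comp, Function.comp, ih, ih,
      List.map_cons, List.prod_cons, hb]
    simp only [toOuterMeasure_pure, Set.mem_ofPred_eq, List.forall_mem_cons]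
    by_cases h : ∀ q ∈ acc, q.1 ∈ Q q.2
    · have e : ∀ b, (b ∈ Q a ∧ ∀ q ∈ acc, q.1 ∈ Q q.2) ↔ b ∈ Q a := fun b => and_iff_left h
      rw [if_congr (e true) rfl rfl, if_congr (e false) rfl rfl, if_pos h]
      ring
    · have e : ∀ b, ¬ (b ∈ Q a ∧ ∀ q ∈ acc, q.1 ∈ Q q.2) := fun b hb => h hb.2
      rw [if_neg (e true), if_neg (e false), if_neg h]
      ring

theorem mark_forall {A : Type} (Q : A → Set Bool) (j : ℕ) (l : List A) :
    (mark j l).toOuterMeasure {m | ∀ q ∈ m, q.1 ∈ Q q.2}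
      = (l.map fun x => (bern j).toOuterMeasure (Q x)).prod := by
  classical
  rw [mark, foldP_mark_forall, toOuterMeasure_pure, if_pos (by simp), one_mul]

theorem mark_forall_mem {A : Type} [DecidableEq A] (q : Bool) (j : ℕ) {l : List A} (hl : l.Nodup)
    (I : Finset A) (hI : ∀ a ∈ I, a ∈ l) :
    (mark j l).toOuterMeasure {m | ∀ r ∈ m, r.2 ∈ I → r.1 = q} = bern j q ^ I.card := by
  have h := mark_forall (fun x => {b | x ∈ I → b = q}) j l
  have h1 : ∀ x, (bern j).toOuterMeasure {b | x ∈ I → b = q} = if x ∈ I then bern j q else 1 := by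
    intro x
    split_ifs with hx
    · simp only [hx, true_imp_iff]
      exact PMF.toOuterMeasure_apply_singleton _ _
    · simp only [hx, false_imp_iff]
      rw [PMF.toOuterMeasure_apply_eq_one_iff]
      exact fun _ _ => trivial
  simp only [Set.mem_ofPred_eq, h1] at h
  rw [h, ← List.prod_toFinset _ hl, Finset.prod_ite, Finset.prod_const, Finset.prod_const_one,
    mul_one]
  congr 2
  ext a
  simpa using hI a

/-- The probability that all of given entries get the mark. -/
theorem mark_all_le {A : Type} [DecidableEq A] (j : ℕ) {l : List A} (hl : l.Nodup)
    (I : Finset A) (hI : ∀ a ∈ I, a ∈ l) :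
    (mark j l).toOuterMeasure {m | ∀ a ∈ I, (true, a) ∈ m} ≤ (2⁻¹ ^ j) ^ I.card := by
  rw [← bern_true, ← mark_forall_mem true j hl I hI]
  refine PMF.toOuterMeasure_mono _ ?_
  rintro m ⟨hm, hs⟩ r hr hrI
  have hnd : (m.map Prod.snd).Nodup := by
    rw [mark_support hs]; exact List.nodup_reverse.2 hl
  have := List.inj_on_of_nodup_map hnd hr (hm _ hrI) rfl
  rw [this]

/-- The probability that none of given entries gets the mark. -/
theorem mark_none_le {A : Type} [DecidableEq A] (j : ℕ) {l : List A} (hl : l.Nodup)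
    (I : Finset A) (hI : ∀ a ∈ I, a ∈ l) :
    (mark j l).toOuterMeasure {m | ∀ a ∈ I, (true, a) ∉ m} ≤ (1 - 2⁻¹ ^ j) ^ I.card := by
  have hb : bern j false = 1 - 2⁻¹ ^ j := by
    have h := (bern j).tsum_coe
    rw [tsum_bool, bern_true] at h
    rw [← h, ENNReal.add_sub_cancel_right (by finiteness)]
  rw [← hb, ← mark_forall_mem false j hl I hI]
  refine PMF.toOuterMeasure_mono _ ?_
  rintro m ⟨hm, hs⟩ r hr hrI
  by_contra hne
  rw [Bool.not_eq_false] at hne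
  exact hm _ hrI (by rw [← hne]; exact hr)

theorem toOuterMeasure_exists_le {A ι : Type*} (P : PMF A) (s : Finset ι) (E : ι → Set A)
    {c : ENNReal} (h : ∀ i ∈ s, P.toOuterMeasure (E i) ≤ c) :
    P.toOuterMeasure {a | ∃ i ∈ s, a ∈ E i} ≤ s.card * c := by
  have e : {a | ∃ i ∈ s, a ∈ E i} = ⋃ i ∈ s, E i := by ext; simp
  rw [e]
  refine (MeasureTheory.measure_biUnion_finset_le s E).trans ?_
  refine (Finset.sum_le_sum h).trans ?_
  rw [Finset.sum_const, nsmul_eq_mul]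

/-! ### Marked tuples -/

section Candidates

variable {V : Type} {es : List (List Bool)} {l j : ℕ} {vs : List V}

theorem mem_candidates {q : List Bool × List V} :
    q ∈ candidates es l vs ↔ q.1 ∈ es ∧ q.2.length = l ∧ ∀ a ∈ q.2, a ∈ vs := by
  rw [candidates, ← mem_tuples]
  exact List.pair_mem_product

theorem nodup_candidates (h : es.Nodup) (hv : vs.Nodup) : (candidates es l vs).Nodup :=
  h.product (nodup_tuples l hv)

theorem length_candidates : (candidates es l vs).length = es.length * vs.length ^ l := by
  rw [candidates, List.length_product, length_tuples]

variable [DecidableEq V]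

/-- It is unlikely that `s` marked tuples are contained in a set of `m` vertices. -/
theorem mark_crowded_le (h : es.Nodup) (hv : vs.Nodup) (m s : ℕ) :
    (mark j (candidates es l vs)).toOuterMeasure {r | ∃ A ∈ powersetCard m vs.toFinset,
      ∃ R : Finset (Bool × (List Bool × List V)), R.card = s ∧
        ∀ q ∈ R, q ∈ r ∧ q.1 = true ∧ ∀ v ∈ q.2.2, v ∈ A} ≤
      vs.length ^ m * ((es.length * m ^ l) ^ s * (2⁻¹ ^ j) ^ s) := by
  -- For fixed `A`, a union bound over the `s`-sets of candidates with tuples in `A`; there are at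
  -- most `es.length * m ^ l` such candidates. A second union bound runs over `A`.
  have h1 : ∀ A ∈ powersetCard m vs.toFinset, (mark j (candidates es l vs)).toOuterMeasure
      {r | ∃ I ∈ powersetCard s (candidates es l A.toList).toFinset,
        r ∈ {r | ∀ a ∈ I, (true, a) ∈ r}} ≤ (es.length * m ^ l) ^ s * (2⁻¹ ^ j) ^ s := by
    intro A hA
    obtain ⟨hA1, hA2⟩ := Finset.mem_powersetCard.1 hA
    refine (toOuterMeasure_exists_le _ _ _ (c := (2⁻¹ ^ j) ^ s) fun I hI => ?_).trans ?_
    · obtain ⟨hI1, hI2⟩ := Finset.mem_powersetCard.1 hI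
      rw [← hI2]
      refine mark_all_le j (nodup_candidates h hv) I fun a ha => ?_
      obtain ⟨h1, h2, h3⟩ := mem_candidates.1 (List.mem_toFinset.1 (hI1 ha))
      exact mem_candidates.2 ⟨h1, h2, fun v hv => List.mem_toFinset.1 (hA1 (by simpa using h3 v hv))⟩
    · gcongr
      rw [Finset.card_powersetCard]
      refine (Nat.cast_le.2 (Nat.choose_le_pow _ _)).trans ?_
      push_cast
      gcongr
      have := (candidates es l A.toList).toFinset_card_le
      rw [length_candidates, Finset.length_toList, hA2] at this
      exact_mod_cast this
  have h2 := toOuterMeasure_exists_le (mark j (candidates es l vs)) (powersetCard m vs.toFinset)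
    (fun A => {r | ∃ I ∈ powersetCard s (candidates es l A.toList).toFinset,
        r ∈ {r | ∀ a ∈ I, (true, a) ∈ r}}) h1
  refine (PMF.toOuterMeasure_mono _ ?_).trans (h2.trans ?_)
  · rintro r ⟨⟨A, hA, R, hR, hRq⟩, hs⟩
    refine ⟨A, hA, R.image Prod.snd, Finset.mem_powersetCard.2 ⟨fun a ha => ?_, ?_⟩, fun a ha => ?_⟩
    · obtain ⟨q, hq, rfl⟩ := Finset.mem_image.1 ha
      obtain ⟨h3, h4, h5⟩ := hRq q hq
      have h6 : q.2 ∈ candidates es l vs := by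
        rw [← List.mem_reverse, ← mark_support hs]
        exact List.mem_map_of_mem h3
      obtain ⟨h7, h8, h9⟩ := mem_candidates.1 h6
      rw [List.mem_toFinset]
      exact mem_candidates.2 ⟨h7, h8, fun v hv => by simpa using h5 v hv⟩
    · rw [Finset.card_image_of_injOn, hR]
      intro q hq q' hq' e
      exact Prod.ext ((hRq q hq).2.1.trans (hRq q' hq').2.1.symm) e
    · obtain ⟨q, hq, rfl⟩ := Finset.mem_image.1 ha
      obtain ⟨h3, h4, h5⟩ := hRq q hq
      rw [← h4]; exact h3
  · gcongr
    rw [Finset.card_powersetCard]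
    refine (Nat.cast_le.2 (Nat.choose_le_pow _ _)).trans ?_
    push_cast
    gcongr
    exact vs.toFinset_card_le

/-- It is unlikely that for some vector no tuple from a large set is marked. -/
theorem mark_missing_le (h : es.Nodup) (hv : vs.Nodup) {S : Finset V} (hS : S ⊆ vs.toFinset) :
    (mark j (candidates es l vs)).toOuterMeasure {r | ∃ e ∈ es.toFinset,
      ∀ t : List V, t.length = l → (∀ v ∈ t, v ∈ S) → (true, (e, t)) ∉ r} ≤
      es.length * (1 - 2⁻¹ ^ j) ^ (S.card ^ l) := by
  refine (toOuterMeasure_exists_le _ es.toFinset (fun e => {r | ∀ t : List V, t.length = l →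
    (∀ v ∈ t, v ∈ S) → (true, (e, t)) ∉ r}) (c := (1 - 2⁻¹ ^ j) ^ (S.card ^ l))
    fun e he => ?_).trans ?_
  · set I : Finset (List Bool × List V) := ((tuples l S.toList).map fun t => (e, t)).toFinset
    have hI : I.card = S.card ^ l := by
      rw [List.toFinset_card_of_nodup, List.length_map, length_tuples, Finset.length_toList]
      exact (nodup_tuples l S.nodup_toList).map fun t t' e => (Prod.ext_iff.1 e).2
    have hmem : ∀ a, a ∈ I ↔ a.1 = e ∧ a.2.length = l ∧ ∀ v ∈ a.2, v ∈ S := by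
      intro a
      simp only [I, List.mem_toFinset, List.mem_map, mem_tuples, Finset.mem_toList]
      constructor
      · rintro ⟨t, h, rfl⟩; exact ⟨rfl, h⟩
      · rintro ⟨rfl, h⟩; exact ⟨a.2, h, rfl⟩
    rw [← hI]
    refine le_trans (PMF.toOuterMeasure_mono _ ?_) (mark_none_le j (nodup_candidates h hv) I ?_)
    · rintro r ⟨hr, -⟩ a ha
      obtain ⟨rfl, h1, h2⟩ := (hmem a).1 ha
      exact hr _ h1 h2
    · intro a ha
      obtain ⟨rfl, h1, h2⟩ := (hmem a).1 ha
      exact mem_candidates.2 ⟨List.mem_toFinset.1 he, h1,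
        fun v hv => List.mem_toFinset.1 (hS (h2 v hv))⟩
  · gcongr
    exact es.toFinset_card_le

end Candidates

/-! ### Bicliques of random graphs -/

section Graph

variable {N : ℕ}

/-- With edge probability one half the distribution is uniform, so probabilities can be found by
counting. -/
theorem randomGraph_singleton (G G' : SimpleGraph (Fin N)) :
    randomGraph N {G} = randomGraph N {G'} := by
  have h : ∀ G : SimpleGraph (Fin N), randomGraph N {G} = 2⁻¹ ^ ((Nat.card (Fin N)).choose 2) := by
    intro G
    rw [randomGraph, SimpleGraph.binomialRandom_singleton]
    have h1 : unitInterval.toNNReal ⟨1 / 2, by norm_num, by norm_num⟩ = 2⁻¹ := by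
      ext; simp only [unitInterval.coe_toNNReal]; norm_num
    have h2 : unitInterval.toNNReal (unitInterval.symm ⟨1 / 2, by norm_num, by norm_num⟩) = 2⁻¹ := by
      ext; simp only [unitInterval.coe_toNNReal, unitInterval.coe_symm_eq]; norm_num
    rw [h1, h2, ← pow_add, Nat.add_sub_cancel']
    · simp
    · classical
      have := G.card_edgeFinset_le_card_choose_two
      rw [← SimpleGraph.coe_edgeFinset, Set.ncard_coe_finset]
      simpa using this
  rw [h, h]

/-- The vertices of `A` are adjacent to the vertices of `B`. -/
def Biclique (G : SimpleGraph (Fin N)) (A B : Finset (Fin N)) : Prop :=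
  ∀ a ∈ A, ∀ b ∈ B, G.Adj a b

/-- From a graph in which `A` and `B` are completely joined, delete any set of edges between them.
The resulting graphs are all different: the deleted set consists of the pairs that are missing
between `A` and `B`, and restoring it gives back the graph. By disjointness each edge occurs only
once in `A ×ˢ B`. -/
theorem card_biclique_mul_le {A B : Finset (Fin N)} (h : Disjoint A B) :
    Nat.card {G : SimpleGraph (Fin N) // Biclique G A B} * 2 ^ (A.card * B.card)
      ≤ Nat.card (SimpleGraph (Fin N)) := by
  classical
  rw [← Finset.card_product, ← Finset.card_powerset, ← Nat.card_eq_finsetCard, ← Nat.card_prod]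
  set φ : {G : SimpleGraph (Fin N) // Biclique G A B} × (A ×ˢ B).powerset →
      SimpleGraph (Fin N) := fun q =>
    { Adj := fun u v => q.1.1.Adj u v ∧ (u, v) ∉ q.2.1 ∧ (v, u) ∉ q.2.1
      symm := ⟨fun u v h => ⟨h.1.symm, h.2.2, h.2.1⟩⟩
      loopless := ⟨fun u h => q.1.1.loopless.irrefl u h.1⟩ } with hφ
  refine Nat.card_le_card_of_injective φ ?_
  rintro ⟨⟨G, hG⟩, ⟨F, hF⟩⟩ ⟨⟨G', hG'⟩, ⟨F', hF'⟩⟩ e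
  rw [Finset.mem_powerset] at hF hF'
  have hadj : ∀ u v, (G.Adj u v ∧ (u, v) ∉ F ∧ (v, u) ∉ F) ↔
      (G'.Adj u v ∧ (u, v) ∉ F' ∧ (v, u) ∉ F') := fun u v => by
    have := congrArg (fun H => H.Adj u v) e
    simpa [hφ] using this
  have hswap : ∀ {F : Finset (Fin N × Fin N)}, F ⊆ A ×ˢ B → ∀ {u v}, u ∈ A → v ∈ B →
      (v, u) ∉ F := fun hF u v hu hv hvu =>
    Finset.disjoint_left.1 h hu (Finset.mem_product.1 (hF hvu)).2 |>.elim
  have hFF : F = F' := by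
    have key : ∀ {G G' : SimpleGraph (Fin N)} {F F' : Finset (Fin N × Fin N)}, Biclique G A B →
        Biclique G' A B → F ⊆ A ×ˢ B → F' ⊆ A ×ˢ B →
        (∀ u v, (G.Adj u v ∧ (u, v) ∉ F ∧ (v, u) ∉ F) ↔
          (G'.Adj u v ∧ (u, v) ∉ F' ∧ (v, u) ∉ F')) → F ⊆ F' := by
      intro G G' F F' hG hG' hF hF' hadj q hq
      obtain ⟨h1, h2⟩ := Finset.mem_product.1 (hF hq)
      by_contra hq'
      have := (hadj q.1 q.2).2 ⟨hG' _ h1 _ h2, hq', hswap hF' h1 h2⟩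
      exact this.2.1 hq
    exact (key hG hG' hF hF' hadj).antisymm (key hG' hG hF' hF fun u v => (hadj u v).symm)
  subst hFF
  have hGG : G = G' := by
    ext u v
    by_cases h1 : (u, v) ∈ F
    · obtain ⟨h2, h3⟩ := Finset.mem_product.1 (hF h1)
      exact iff_of_true (hG _ h2 _ h3) (hG' _ h2 _ h3)
    · by_cases h1' : (v, u) ∈ F
      · obtain ⟨h2, h3⟩ := Finset.mem_product.1 (hF h1')
        exact iff_of_true (hG _ h2 _ h3).symm (hG' _ h2 _ h3).symm
      · have := hadj u v
        simpa [h1, h1'] using this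
  subst hGG
  rfl

instance : MeasurableSingletonClass (SimpleGraph (Fin N)) :=
  ⟨fun G => by
    rw [← SimpleGraph.measurableEmbedding_edgeSet.measurableSet_image, Set.image_singleton]
    exact measurableSet_singleton _⟩

instance : MeasureTheory.IsProbabilityMeasure (randomGraph N) := by
  unfold randomGraph; infer_instance

theorem randomGraph_biclique_le {A B : Finset (Fin N)} (h : Disjoint A B) :
    randomGraph N {G | Biclique G A B} ≤ 2⁻¹ ^ (A.card * B.card) := by
  classical
  have : Fintype (SimpleGraph (Fin N)) := Fintype.ofFinite _
  have hE : ∀ E : Finset (SimpleGraph (Fin N)),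
      randomGraph N E = E.card * randomGraph N {⊥} := by
    intro E
    rw [← MeasureTheory.sum_measure_singleton, Finset.sum_congr rfl fun G _ =>
      randomGraph_singleton G ⊥, Finset.sum_const, nsmul_eq_mul]
  have h1 := hE univ
  rw [Finset.coe_univ, MeasureTheory.measure_univ, Finset.card_univ, ← Nat.card_eq_fintype_card]
    at h1
  have h2 := hE (univ.filter fun G => Biclique G A B)
  rw [Finset.coe_filter] at h2
  simp only [Finset.mem_univ, true_and] at h2
  have h3 := card_biclique_mul_le h
  rw [Nat.card_eq_fintype_card, Fintype.card_subtype] at h3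
  have h4 : ((univ.filter fun G : SimpleGraph (Fin N) => Biclique G A B).card : ENNReal)
      * 2 ^ (A.card * B.card) ≤ Nat.card (SimpleGraph (Fin N)) := by exact_mod_cast h3
  rw [h2, ← ENNReal.inv_pow, ENNReal.le_inv_iff_mul_le, mul_right_comm, h1]
  gcongr

theorem randomGraph_exists_biclique_le (h : ℕ) :
    randomGraph N {G | ∃ A B : Finset (Fin N), A.card = h ∧ B.card = h ∧ Disjoint A B ∧
      Biclique G A B} ≤ N ^ (2 * h) * 2⁻¹ ^ (h * h) := by
  classical
  set s : Finset (Finset (Fin N) × Finset (Fin N)) :=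
    (powersetCard h univ ×ˢ powersetCard h univ).filter fun q => Disjoint q.1 q.2
  have e : {G : SimpleGraph (Fin N) | ∃ A B : Finset (Fin N), A.card = h ∧ B.card = h ∧
      Disjoint A B ∧ Biclique G A B} ⊆ ⋃ q ∈ s, {G | Biclique G q.1 q.2} := by
    rintro G ⟨A, B, hA, hB, hd, hG⟩
    simp only [Set.mem_iUnion]
    exact ⟨(A, B), by simp [s, Finset.mem_powersetCard, hA, hB, hd], hG⟩
  refine (MeasureTheory.measure_mono e).trans
    ((MeasureTheory.measure_biUnion_finset_le s _).trans ?_)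
  refine (Finset.sum_le_card_nsmul s _ (2⁻¹ ^ (h * h)) fun q hq => ?_).trans ?_
  · simp only [s, Finset.mem_filter, Finset.mem_product, Finset.mem_powersetCard] at hq
    have := randomGraph_biclique_le hq.2
    rwa [hq.1.1.2, hq.1.2.2] at this
  · rw [nsmul_eq_mul]
    gcongr
    have h1 := Finset.card_filter_le (powersetCard h (univ : Finset (Fin N)) ×ˢ
      powersetCard h univ) fun q => Disjoint q.1 q.2
    rw [Finset.card_product, Finset.card_powersetCard, Finset.card_univ, Fintype.card_fin] at h1
    have h2 := Nat.choose_le_pow N h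
    have h3 : s.card ≤ N ^ (2 * h) := by
      rw [two_mul, pow_add]
      exact h1.trans (Nat.mul_le_mul h2 h2)
    exact_mod_cast h3

theorem le_integral_randomGraph {f : SimpleGraph (Fin N) → ℝ} {c : ℝ} (h : ∀ G, c ≤ f G) :
    c ≤ ∫ G, f G ∂(randomGraph N) := by
  have := MeasureTheory.integral_mono (μ := randomGraph N) (f := fun _ => c) (g := f)
    (.of_finite) (.of_finite) h
  simpa using this

theorem integral_randomGraph_le {f : SimpleGraph (Fin N) → ℝ} {c : ℝ} (hc : 0 ≤ c)
    (E : Set (SimpleGraph (Fin N))) (h1 : ∀ G, f G ≤ 1) (h : ∀ G, G ∉ E → f G ≤ c) :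
    ∫ G, f G ∂(randomGraph N) ≤ (randomGraph N).real E + c := by
  classical
  have hE : MeasurableSet E := E.toFinite.measurableSet
  have := MeasureTheory.integral_mono (μ := randomGraph N) (f := f)
    (g := fun G => E.indicator 1 G + c) (.of_finite) (.of_finite) (fun G => by
      by_cases hG : G ∈ E
      · simp only [Set.indicator_of_mem hG, Pi.one_apply]
        linarith [h1 G]
      · simp only [Set.indicator_of_notMem hG, zero_add]
        exact h G hG)
  rwa [MeasureTheory.integral_add .of_finite .of_finite, MeasureTheory.integral_indicator_one hE,
    MeasureTheory.integral_const, MeasureTheory.probReal_univ, one_smul] at this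

end Graph

end VCHard

namespace VCHard
open Enc (enc)

/-! ### Majority of three runs -/

/-- The majority of three runs of a program. -/
def Prog.majority (p : Prog) : Prog :=
  .ite p (.ite p (.pair .nil .nil) p) (.ite p p .nil)

/-- The outcome of the majority of three runs. -/
noncomputable def majority (P : PMF Data) : PMF Data :=
  P.bind fun x => if x = .nil then P.bind fun y => if y = .nil then PMF.pure .nil else P
    else P.bind fun y => if y = .nil then P else PMF.pure (.cons .nil .nil)

theorem Prog.Computes.majority {p : Prog} {x : Data} {P : PMF Data} {t : ℕ}
    (h : p.Computes x P t) : p.majority.Computes x (VCHard.majority P) (3 * t + 10) := by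
  have hK := (Prog.Computes.nil x).pair (.nil x)
  rw [PMF.pure_bind, PMF.pure_map] at hK
  refine Prog.Computes.mono (h.ite (h.ite hK h) (h.ite h (.nil x))) ?_
  lia

theorem toOuterMeasure_compl {A : Type*} (P : PMF A) (E : Set A) :
    P.toOuterMeasure Eᶜ = 1 - P.toOuterMeasure E := by
  let _ : MeasurableSpace A := ⊤
  have := MeasureTheory.prob_compl_eq_one_sub (μ := P.toMeasure) (s := E) trivial
  rwa [PMF.toMeasure_apply_eq_toOuterMeasure, PMF.toMeasure_apply_eq_toOuterMeasure] at this

theorem toOuterMeasure_le_one {A : Type*} (P : PMF A) (E : Set A) : P.toOuterMeasure E ≤ 1 := by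
  let _ : MeasurableSpace A := ⊤
  rw [← PMF.toMeasure_apply_eq_toOuterMeasure]
  exact MeasureTheory.prob_le_one

theorem toOuterMeasure_bind_ite {A B : Type*} (P : PMF A) (a : A) [DecidableEq A]
    (Q Q' : PMF B) (E : Set B) :
    (P.bind fun x => if x = a then Q else Q').toOuterMeasure E
      = P a * Q.toOuterMeasure E + (1 - P a) * Q'.toOuterMeasure E := by
  have e : (P.bind fun x => if x = a then Q else Q')
      = (P.map fun x => decide (x = a)).bind fun b => if b then Q else Q' := by
    rw [PMF.bind_map]
    congr 1
    funext x
    by_cases h : x = a <;> simp [h]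
  have h1 : (P.map fun x => decide (x = a)) true = P a := by
    rw [← PMF.toOuterMeasure_apply_singleton, PMF.toOuterMeasure_map_apply,
      ← PMF.toOuterMeasure_apply_singleton]
    congr 1
    ext x; simp
  have h2 := (P.map fun x => decide (x = a)).tsum_coe
  rw [tsum_bool, h1] at h2
  have h3 : (P.map fun x => decide (x = a)) false = 1 - P a := by
    rw [← h2, ENNReal.add_sub_cancel_right (P.apply_ne_top a)]
  rw [e, toOuterMeasure_bind_bool, h1, h3]
  simp

/-- The left side is `3 * a ^ 2 - 2 * a ^ 3`, the probability that at least two of three independent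
runs err. It increases on the interval in question and equals `7 / 27` at `1 / 3`. -/
theorem majority_bound {a : ENNReal} (ha : a ≤ 1 / 3) :
    (1 - a) * (a * a) + a * ((1 - a) * a + a) ≤ 7 / 27 := by
  have h1 : a ≠ ⊤ := ne_top_of_le_ne_top (by finiteness) ha
  lift a to NNReal using h1
  have ha' : (a : ℝ) ≤ 1 / 3 := by
    have := ENNReal.toReal_mono (by finiteness) ha
    simpa using this
  have h2 : (1 - (a : ENNReal)) = ENNReal.ofReal (1 - a) := by
    rw [ENNReal.ofReal_sub _ (NNReal.coe_nonneg a)]; simp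
  have h3 : (a : ENNReal) = ENNReal.ofReal a := by simp
  have h0 : (0 : ℝ) ≤ a := a.2
  have h4 : (7 / 27 : ENNReal) = ENNReal.ofReal (7 / 27) := by
    rw [ENNReal.ofReal_div_of_pos (by norm_num)]; norm_num
  rw [h2, h3, h4, ← ENNReal.ofReal_mul h0, ← ENNReal.ofReal_mul (by linarith),
    ← ENNReal.ofReal_mul (by linarith), ← ENNReal.ofReal_add (by nlinarith) h0,
    ← ENNReal.ofReal_mul h0, ← ENNReal.ofReal_add (by nlinarith [mul_nonneg h0 h0])
    (mul_nonneg h0 (by nlinarith))]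
  refine ENNReal.ofReal_le_ofReal ?_
  nlinarith [mul_nonneg h0 h0, mul_nonneg (mul_nonneg h0 h0) h0,
    mul_nonneg (sub_nonneg.2 ha') (sub_nonneg.2 ha'), mul_nonneg h0 (sub_nonneg.2 ha')]

theorem majority_accept_le {P : PMF Data} (h : P.toOuterMeasure {y | y ≠ .nil} ≤ 1 / 3) :
    (majority P).toOuterMeasure {y | y ≠ .nil} ≤ 7 / 27 := by
  have h1 : P .nil = 1 - P.toOuterMeasure {y | y ≠ .nil} := by
    rw [← toOuterMeasure_compl, ← PMF.toOuterMeasure_apply_singleton]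
    congr 1
    ext y; simp
  have h2 : 1 - P .nil = P.toOuterMeasure {y | y ≠ .nil} := by
    rw [← PMF.toOuterMeasure_apply_singleton, ← toOuterMeasure_compl]
    congr 1
  rw [majority, toOuterMeasure_bind_ite, toOuterMeasure_bind_ite, toOuterMeasure_bind_ite, h2, h1]
  refine le_trans (le_of_eq ?_) (majority_bound h)
  simp [PMF.toOuterMeasure_pure_apply]

theorem majority_reject_le {P : PMF Data} (h : P.toOuterMeasure {.nil} ≤ 1 / 3) :
    (majority P).toOuterMeasure {.nil} ≤ 7 / 27 := by
  rw [PMF.toOuterMeasure_apply_singleton] at h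
  rw [majority, toOuterMeasure_bind_ite, toOuterMeasure_bind_ite, toOuterMeasure_bind_ite]
  refine le_trans (le_of_eq ?_) (majority_bound h)
  simp only [PMF.toOuterMeasure_apply_singleton, PMF.pure_apply]
  simp
  ring

theorem toOuterMeasure_bind_le {A B : Type*} (P : PMF A) (F : A → PMF B) (E : Set B) (W : Set A)
    {c : ENNReal} (h : ∀ a ∈ P.support, a ∉ W → (F a).toOuterMeasure E ≤ c) :
    (P.bind F).toOuterMeasure E ≤ P.toOuterMeasure W + c := by
  classical
  rw [PMF.toOuterMeasure_bind_apply, PMF.toOuterMeasure_apply]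
  have : c = ∑' a, P a * c := by rw [ENNReal.tsum_mul_right, P.tsum_coe, one_mul]
  rw [this, ← ENNReal.tsum_add]
  refine ENNReal.tsum_le_tsum fun a => ?_
  by_cases ha : a ∈ W
  · rw [Set.indicator_of_mem ha]
    refine le_trans ?_ le_self_add
    exact mul_le_of_le_one_right' (toOuterMeasure_le_one _ _)
  · rw [Set.indicator_of_notMem ha, zero_add]
    by_cases h0 : P a = 0
    · simp [h0]
    · gcongr
      exact h a ((PMF.mem_support_iff _ _).2 h0) ha

/-- Run `p` three times on a random input. -/
theorem Prog.Computes.seq_majority {Y : Type} [Enc Y] {R p : Prog} {x : Data} {Q : PMF Y}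
    {b t : ℕ} (hR : R.Computes x (Q.map enc) b)
    (hp : ∀ y ∈ Q.support, p.HaltsWithin (enc y) t) :
    ∃ D : PMF Data, (Prog.seq R p.majority).Computes x D (b + 3 * t + 11) ∧
      (∀ W : Set Y, (∀ y ∈ Q.support, y ∉ W → p.acceptProb (enc y) t ≤ 1 / 3) →
        D.toOuterMeasure {y | y ≠ .nil} ≤ Q.toOuterMeasure W + 7 / 27) ∧
      (∀ W : Set Y, (∀ y ∈ Q.support, y ∉ W → 2 / 3 ≤ p.acceptProb (enc y) t) →
        D.toOuterMeasure {.nil} ≤ Q.toOuterMeasure W + 7 / 27) := by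
  classical
  set F : Data → PMF Data := fun d => if h : ∃ P, p.Computes d P t then h.choose else PMF.pure .nil
  have hF : ∀ y ∈ Q.support, p.Computes (enc y) (F (enc y)) t := by
    intro y hy
    have h := (hp y hy).computes
    simp only [F]
    rw [dif_pos h]
    exact h.choose_spec
  refine ⟨(Q.map enc).bind fun d => VCHard.majority (F d), ?_, fun W hW => ?_, fun W hW => ?_⟩
  · refine (hR.seq (t := 3 * t + 10) fun d hd => ?_).mono (by lia)
    rw [PMF.mem_support_map_iff] at hd
    obtain ⟨y, hy, rfl⟩ := hd
    exact (hF y hy).majority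
  · rw [PMF.bind_map]
    refine toOuterMeasure_bind_le _ _ _ W fun y hy hyW => majority_accept_le ?_
    have := hW y hy hyW
    rw [(hF y hy).acceptProb] at this
    rw [← ENNReal.toReal_le_toReal (ne_top_of_le_ne_top ENNReal.one_ne_top
      (toOuterMeasure_le_one _ _)) (by finiteness)]
    simpa using this
  · rw [PMF.bind_map]
    refine toOuterMeasure_bind_le _ _ _ W fun y hy hyW => majority_reject_le ?_
    have h1 := hW y hy hyW
    have h2 := toOuterMeasure_compl (F (enc y)) {y | y ≠ .nil}
    have h3 : ({y | y ≠ .nil} : Set Data)ᶜ = {.nil} := by ext; simp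
    rw [(hF y hy).acceptProb] at h1
    have h4 := toOuterMeasure_le_one (F (enc y)) {y | y ≠ .nil}
    have h5 := ne_top_of_le_ne_top ENNReal.one_ne_top h4
    rw [h3] at h2
    rw [h2, ← ENNReal.toReal_le_toReal (by finiteness) (by finiteness),
      ENNReal.toReal_sub_of_le h4 (by finiteness)]
    simp only [ENNReal.toReal_one, ENNReal.toReal_div, ENNReal.toReal_ofNat]
    linarith

end VCHard

namespace VCHard
open Enc (enc)

/-! ### The reduction on graphs -/

section Graph

open Classical in
/-- The rows of the adjacency matrix. -/
noncomputable def adjList {N : ℕ} (G : SimpleGraph (Fin N)) : List (List Bool) :=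
  (List.finRange N).map fun i => (List.finRange N).map fun j => decide (G.Adj i j)

open Classical in
/-- Two vertices are equal or adjacent. -/
noncomputable def adjOrEq {N : ℕ} (G : SimpleGraph (Fin N)) (u v : Fin N) : Bool :=
  decide (u = v ∨ G.Adj u v)

variable {N : ℕ} (G : SimpleGraph (Fin N))

theorem adjOrEq_iff {u v : Fin N} : adjOrEq G u v = true ↔ u = v ∨ G.Adj u v := by
  classical simp [adjOrEq]

theorem encodeGraph_eq : encodeGraph G = enc (adjList G) := by
  change _ = Data.ofList (Data.ofList Data.ofBool) _
  simp only [adjList, ofList_map]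
  rfl

theorem length_adjList : (adjList G).length = N := by simp [adjList]

theorem sz_adjList : sz (adjList G) ≤ N * (N * 4 + 1 + 1) + 1 := by
  have := sz_list_le (l := adjList G) (b := N * 4 + 1) fun r hr => by
    obtain ⟨i, -, rfl⟩ := List.mem_map.1 hr
    refine (sz_boolList _).trans ?_
    simp
  rwa [length_adjList] at this

open Classical in
theorem vertices_adjList : vertices (adjList G) = (List.finRange N).map fun v =>
    ((List.finRange N).map fun j => decide (G.Adj v j),
      (List.finRange N).map fun j => decide (v = j)) := by
  rw [vertices, length_adjList, idRows_eq, adjList, List.zip_map']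

theorem dot_finRange (f g : Fin N → Bool) :
    dot ((List.finRange N).map f) ((List.finRange N).map g) ↔ ∃ i, f i = true ∧ g i = true := by
  rw [dot_iff]
  simp only [List.getElem?_map, Option.map_eq_some_iff]
  constructor
  · rintro ⟨n, ⟨a, ha, h1⟩, ⟨b, hb, h2⟩⟩
    rw [ha] at hb
    cases hb
    exact ⟨a, h1, h2⟩
  · rintro ⟨i, h1, h2⟩
    have : (List.finRange N)[i.1]? = some i := by
      rw [List.getElem?_eq_getElem (by simp)]; simp
    exact ⟨i.1, ⟨i, this, h1⟩, ⟨i, this, h2⟩⟩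

theorem reduction_adjList (k l j : ℕ) :
    reduction VRep.compat k l j (vertices (adjList G))
      = reduction (adjOrEq G) k l j (List.finRange N) := by
  classical
  rw [vertices_adjList]
  refine reduction_map _ (fun u v => ?_) k l j _
  rw [Bool.eq_iff_iff, VRep.compat, Bool.or_eq_true, dot_finRange, dot_finRange, adjOrEq]
  simp only [decide_eq_true_eq]
  constructor
  · rintro (⟨i, h1, rfl⟩ | ⟨i, rfl, h⟩)
    · exact Or.inr h1
    · exact Or.inl h.symm
  · rintro (rfl | h)
    · exact Or.inr ⟨u, rfl, rfl⟩
    · exact Or.inl ⟨v, h, rfl⟩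

theorem nodup_idRows (k : ℕ) : (idRows k).Nodup := by
  rw [idRows_eq]
  refine (List.nodup_finRange k).map fun i i' h => ?_
  have := List.map_inj_left.1 h i (List.mem_finRange _)
  simpa [eq_comm] using this

theorem nodup_boolTuples (k : ℕ) : (tuples k [false, true]).Nodup := nodup_tuples k (by simp)

theorem nodup_of_mark {A : Type} {j : ℕ} {l : List A} (hl : l.Nodup) {m : List (Bool × A)}
    (h : m ∈ (mark j l).support) : m.Nodup := by
  refine List.Nodup.of_map Prod.snd ?_
  rw [mark_support h]
  exact List.nodup_reverse.2 hl

theorem length_of_mark {A : Type} {j : ℕ} {l : List A} {m : List (Bool × A)}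
    (h : m ∈ (mark j l).support) : m.length = l.length := by
  have := congrArg List.length (mark_support h)
  simpa using this

/-- The instances which the reduction produces from marked rows and columns with a given
property. -/
def Instances (k l : ℕ)
    (Q : List (Bool × (List Bool × List (Fin N))) → List (Bool × (List Bool × List (Fin N))) → Prop) :
    Set (ℕ × List (List Bool)) :=
  {y | ∃ rs cs, rs.length = k * N ^ l ∧ cs.length = 2 ^ k * N ^ l ∧
    y = (k, columns (adjOrEq G) rs cs) ∧ Q rs cs}

theorem reduction_instances (k l j : ℕ) {y : ℕ × List (List Bool)}
    (hy : y ∈ (reduction (adjOrEq G) k l j (List.finRange N)).support) :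
    y ∈ Instances G k l fun _ _ => True := by
  rw [reduction, PMF.mem_support_bind_iff] at hy
  obtain ⟨rs, hrs, hy⟩ := hy
  rw [PMF.mem_support_map_iff] at hy
  obtain ⟨cs, hcs, rfl⟩ := hy
  refine ⟨rs, cs, ?_, ?_, rfl, trivial⟩
  · rw [length_of_mark hrs, length_candidates, length_idRows, List.length_finRange]
  · rw [length_of_mark hcs, length_candidates, length_tuples, List.length_finRange]
    rfl

/-- A union bound over a bad event `E` for the rows and a bad event `E'` for the columns. -/
theorem reduction_le (k l j : ℕ) {E E' : Set (List (Bool × (List Bool × List (Fin N))))}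
    {Q : List (Bool × (List Bool × List (Fin N))) → List (Bool × (List Bool × List (Fin N))) → Prop}
    {c : ENNReal}
    (hE : (mark j (candidates (idRows k) l (List.finRange N))).toOuterMeasure E ≤ c)
    (hE' : (mark j (candidates (tuples k [false, true]) l (List.finRange N))).toOuterMeasure E' ≤ c)
    (hQ : ∀ rs ∈ (mark j (candidates (idRows k) l (List.finRange N))).support, rs ∉ E →
      ∀ cs ∈ (mark j (candidates (tuples k [false, true]) l (List.finRange N))).support, cs ∉ E' →
      Q rs cs) :
    (reduction (adjOrEq G) k l j (List.finRange N)).toOuterMeasure (Instances G k l Q)ᶜ ≤ c + c := by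
  rw [reduction]
  refine (toOuterMeasure_bind_le _ _ _ E (c := c) fun rs hrs hE1 => ?_).trans
    (add_le_add_left hE _)
  refine (toOuterMeasure_bind_le _ _ _ E' (c := 0) fun cs hcs hE2 => ?_).trans ?_
  · rw [nonpos_iff_eq_zero, Function.comp, PMF.toOuterMeasure_apply_eq_zero_iff, PMF.support_pure,
      Set.disjoint_singleton_left]
    intro h
    refine h ⟨rs, cs, ?_, ?_, rfl, hQ rs hrs hE1 cs hcs hE2⟩
    · rw [length_of_mark hrs, length_candidates, length_idRows, List.length_finRange]
    · rw [length_of_mark hcs, length_candidates, length_tuples, List.length_finRange]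
      rfl
  · rw [add_zero]; exact hE'

/-- Unless some vector lacks a marked tuple inside `S`, choose such a tuple for each vector; all of
them are compatible because `S` is a clique. Nothing is assumed about the rest of the graph. -/
theorem reduction_complete {S : Finset (Fin N)} (hS : ∀ u ∈ S, ∀ v ∈ S, u = v ∨ G.Adj u v)
    (k l j : ℕ) :
    (reduction (adjOrEq G) k l j (List.finRange N)).toOuterMeasure (Instances G k l fun rs cs =>
      k ≤ (conceptClass (matrixOf (adjOrEq G) rs cs)).vcDim)ᶜ ≤
      2 * (2 ^ k * (1 - 2⁻¹ ^ j) ^ (S.card ^ l)) := by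
  have hk : ((idRows k).length : ENNReal) ≤ 2 ^ k := by
    rw [length_idRows]
    exact_mod_cast (Nat.lt_two_pow_self (n := k)).le
  have h2 : ((tuples k [false, true]).length : ENNReal) = 2 ^ k := by
    rw [length_tuples]; simp
  have hSv : S ⊆ (List.finRange N).toFinset := fun v _ => by simp
  have h1 := mark_missing_le (j := j) (l := l) (nodup_idRows k) (List.nodup_finRange N) hSv
  have h3 := mark_missing_le (j := j) (l := l) (nodup_boolTuples k) (List.nodup_finRange N) hSv
  rw [h2] at h3
  rw [two_mul]
  refine reduction_le G k l j (h1.trans (by gcongr)) h3 fun rs _ hrs cs _ hcs => ?_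
  simp only [Set.mem_ofPred_eq, not_exists, not_and, not_forall, not_not, List.mem_toFinset]
    at hrs hcs
  have hrow : ∀ i : Fin k, ∃ t : List (Fin N), (∀ v ∈ t, v ∈ S) ∧
      (true, ((List.finRange k).map fun j => decide (i = j), t)) ∈ rs := by
    intro i
    obtain ⟨t, -, h2, h3⟩ := hrs ((List.finRange k).map fun j => decide (i = j)) (by
      rw [idRows_eq]; exact List.mem_map_of_mem (List.mem_finRange i))
    exact ⟨t, h2, h3⟩
  have hcol : ∀ T : List Bool, ∃ t : List (Fin N), T.length = k → (∀ v ∈ t, v ∈ S) ∧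
      (true, (T, t)) ∈ cs := by
    intro T
    by_cases hT : T.length = k
    · obtain ⟨t, -, h2, h3⟩ := hcs T (mem_tuples.2 ⟨hT, fun b _ => by cases b <;> simp⟩)
      exact ⟨t, fun _ => ⟨h2, h3⟩⟩
    · exact ⟨[], fun h => absurd h hT⟩
  choose rt hrt using hrow
  choose ct hct using hcol
  refine le_vcDim rt ct (fun i => (hrt i).2) (fun T hT => (hct T hT).2) fun i T hT u hu v hv => ?_
  rw [adjOrEq_iff]
  exact hS u ((hrt i).1 u hu) v ((hct T hT).1 v hv)

/-- Compatible sets may overlap, as equality is allowed. Take `h` elements of `A` and then `h`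
elements of `B` among the at least `h` that remain. -/
theorem exists_biclique {h : ℕ} {A B : Finset (Fin N)} (hA : 2 * h ≤ A.card) (hB : 2 * h ≤ B.card)
    (hAB : ∀ a ∈ A, ∀ b ∈ B, a = b ∨ G.Adj a b) :
    ∃ A B : Finset (Fin N), A.card = h ∧ B.card = h ∧ Disjoint A B ∧ Biclique G A B := by
  obtain ⟨A', hA', hAc⟩ := Finset.exists_subset_card_eq (show h ≤ A.card by lia)
  have h1 := Finset.le_card_sdiff A' B
  obtain ⟨B', hB', hBc⟩ := Finset.exists_subset_card_eq (show h ≤ (B \ A').card by lia)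
  have hd : Disjoint A' B' := Finset.disjoint_left.2 fun a ha hb => (Finset.mem_sdiff.1 (hB' hb)).2 ha
  refine ⟨A', B', hAc, hBc, hd, fun a ha b hb => ?_⟩
  rcases hAB a (hA' ha) b (Finset.mem_sdiff.1 (hB' hb)).1 with rfl | h
  · exact absurd hb (Finset.disjoint_left.1 hd ha)
  · exact h

/-- Unless `s` marked tuples crowd into `2 * h` vertices, the tuples of any `s` marked rows cover at
least `2 * h` vertices, and likewise for columns. An all-1 block would then produce the biclique
that `hG` excludes. -/
theorem reduction_sound {h s : ℕ} (hs : 0 < s) (hN : 2 * h ≤ N)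
    (hG : ¬ ∃ A B : Finset (Fin N), A.card = h ∧ B.card = h ∧ Disjoint A B ∧ Biclique G A B)
    (k l j : ℕ) :
    (reduction (adjOrEq G) k l j (List.finRange N)).toOuterMeasure (Instances G k l fun rs cs =>
      ldim (conceptClass (matrixOf (adjOrEq G) rs cs)) ≤ 2 * s)ᶜ ≤
      2 * (N ^ (2 * h) * ((2 ^ k * (2 * h : ℕ) ^ l) ^ s * (2⁻¹ ^ j) ^ s)) := by
  have hk : ((idRows k).length : ENNReal) ≤ 2 ^ k := by
    rw [length_idRows]
    exact_mod_cast (Nat.lt_two_pow_self (n := k)).le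
  have h2 : ((tuples k [false, true]).length : ENNReal) = 2 ^ k := by
    rw [length_tuples]; simp
  have h1 := mark_crowded_le (j := j) (l := l) (nodup_idRows k) (List.nodup_finRange N) (2 * h) s
  have h3 := mark_crowded_le (j := j) (l := l) (nodup_boolTuples k) (List.nodup_finRange N) (2 * h) s
  rw [h2, List.length_finRange] at h3
  rw [List.length_finRange] at h1
  rw [two_mul (_ * _ : ENNReal)]
  refine reduction_le G k l j (h1.trans (by gcongr)) h3 fun rs hrs hrs' cs hcs hcs' => ?_
  refine ldim_matrixOf_le hs
    (nodup_of_mark (nodup_candidates (nodup_idRows k) (List.nodup_finRange N)) hrs)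
    (nodup_of_mark (nodup_candidates (nodup_boolTuples k) (List.nodup_finRange N)) hcs) ?_
  intro R C hR hC hR1 hC1 hcompat
  have key : ∀ {rs : List (Bool × (List Bool × List (Fin N)))}
      {R : Finset (Bool × (List Bool × List (Fin N)))}, R.card = s →
      (∀ r ∈ R, r ∈ rs ∧ r.1 = true) →
      rs ∉ {r | ∃ A ∈ powersetCard (2 * h) (List.finRange N).toFinset,
        ∃ R : Finset (Bool × (List Bool × List (Fin N))), R.card = s ∧
          ∀ q ∈ R, q ∈ r ∧ q.1 = true ∧ ∀ v ∈ q.2.2, v ∈ A} →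
      2 * h ≤ (R.biUnion fun r => r.2.2.toFinset).card := by
    intro rs R hR hR1 hrs
    by_contra hlt
    obtain ⟨A, hA1, hA2⟩ := Finset.exists_superset_card_eq (s := R.biUnion fun r => r.2.2.toFinset)
      (n := 2 * h) (by lia)
      (show 2 * h ≤ Fintype.card (Fin N) by simpa using hN)
    refine hrs ⟨A, Finset.mem_powersetCard.2 ⟨fun v _ => by simp, hA2⟩, R, hR, fun q hq =>
      ⟨(hR1 q hq).1, (hR1 q hq).2, fun v hv => hA1 ?_⟩⟩
    exact Finset.mem_biUnion.2 ⟨q, hq, by simpa using hv⟩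
  refine hG (exists_biclique G (key hR hR1 hrs') (key hC hC1 hcs') fun a ha b hb => ?_)
  obtain ⟨r, hr, ha⟩ := Finset.mem_biUnion.1 ha
  obtain ⟨c, hc, hb⟩ := Finset.mem_biUnion.1 hb
  have := hcompat r hr c hc a (by simpa using ha) b (by simpa using hb)
  rwa [adjOrEq_iff] at this

end Graph

end VCHard

namespace VCHard
open Enc (enc)

/-! ### Arithmetic of the parameters -/

section Arithmetic

variable {X : Type} [Enc X] {w : X → ℕ}

theorem div_iterate (m n i : ℕ) :
    (fun q => if (q + 1) * (n + 1) ≤ m then q + 1 else q)^[i] 0 = min i (m / (n + 1)) := by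
  induction i with
  | zero => simp
  | succ i ih =>
    rw [Function.iterate_succ_apply', ih]
    simp only [← Nat.le_div_iff_mul_le n.succ_pos]
    split_ifs <;> lia

theorem PolyTime.div {m n : X → ℕ} (hm : PolyTime w m) (hn : PolyTime w n) :
    PolyTime w (fun x => m x / (n x + 1)) := by
  have h1 : PolyTime sz fun q : (ℕ × ℕ) × ℕ =>
      (fun (p : ℕ × ℕ) q => if (q + 1) * (p.2 + 1) ≤ p.1 then q + 1 else q) q.1 q.2 := by
    have := PolyTime.cond ((PolyTime.snd.succ.mul (PolyTime.fst.snd_comp.succ)).le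
      (PolyTime.fst (A := ℕ × ℕ) (B := ℕ)).fst_comp) PolyTime.snd.succ PolyTime.snd
    simpa only [Bool.cond_eq_ite, decide_eq_true_eq] using this
  have h2 : PolyTime sz fun q : ℕ × ℕ => q.1 / (q.2 + 1) := by
    have := (PolyTime.fst (A := ℕ) (B := ℕ)).iterate (s := fun _ => 0)
      (f := fun p q => if (q + 1) * (p.2 + 1) ≤ p.1 then q + 1 else q) (.const (.self _) 0) h1
      (b := sz) (.self _) fun x i hi => by
        simp only [div_iterate, sz_pair, sz_nat]
        lia
    simpa only [div_iterate, min_eq_right (Nat.div_le_self _ _)] using this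
  exact h2.comp (hm.prodMk hn)

theorem log_iterate (n i : ℕ) :
    (fun q : ℕ × ℕ => if q.2 + q.2 ≤ n then (q.1 + 1, q.2 + q.2) else q)^[i] (0, 1)
      = (min i (Nat.log 2 n), 2 ^ min i (Nat.log 2 n)) := by
  induction i with
  | zero => simp
  | succ i ih =>
    rw [Function.iterate_succ_apply', ih]
    rcases n.eq_zero_or_pos with rfl | hn
    · simp
    · have := Nat.le_log_iff_pow_le (b := 2) one_lt_two hn.ne' (x := min i (Nat.log 2 n) + 1)
      simp only [← two_mul, ← pow_succ', ← this]
      split_ifs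
      · rw [show min (i + 1) (Nat.log 2 n) = min i (Nat.log 2 n) + 1 by lia]
      · rw [show min (i + 1) (Nat.log 2 n) = min i (Nat.log 2 n) by lia]

theorem PolyTime.log {n : X → ℕ} (hn : PolyTime w n) : PolyTime w (fun x => Nat.log 2 (n x)) := by
  have h1 : PolyTime sz fun q : ℕ × (ℕ × ℕ) => (fun (n : ℕ) (q : ℕ × ℕ) =>
      if q.2 + q.2 ≤ n then (q.1 + 1, q.2 + q.2) else q) q.1 q.2 := by
    have h3 := (PolyTime.snd (A := ℕ) (B := ℕ × ℕ)).snd_comp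
    have := PolyTime.cond ((h3.add h3).le PolyTime.fst)
      (PolyTime.snd.fst_comp.succ.prodMk (h3.add h3)) PolyTime.snd
    simpa only [Bool.cond_eq_ite, decide_eq_true_eq] using this
  have h2 : PolyTime sz fun n : ℕ => Nat.log 2 n := by
    have := (PolyTime.id (X := ℕ) (.self _)).iterate (s := fun _ => ((0 : ℕ), 1))
      (f := fun n q => if q.2 + q.2 ≤ n then (q.1 + 1, q.2 + q.2) else q) (.const (.self _) _) h1 (b := fun n => 8 * sz n)
      ((PolyIn.const _ 8).mul (.self _)) fun n i hi => by
        simp only [log_iterate, sz_pair, sz_nat]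
        have h2 : 2 ^ min i (Nat.log 2 n) ≤ n + 1 := by
          rcases n.eq_zero_or_pos with rfl | hn
          · simp
          · exact (Nat.pow_le_pow_right two_pos (min_le_right _ _)).trans
              ((Nat.pow_log_le_self 2 hn.ne').trans n.le_succ)
        lia
    have h4 : ∀ n, min n (Nat.log 2 n) = Nat.log 2 n := fun n =>
      min_eq_right (Nat.log_le_self 2 n)
    simp only [log_iterate, h4] at this
    exact this.fst_comp
  exact h2.comp hn

theorem pow_two_le_of_log {N L : ℕ} (h : Nat.log 2 N ≤ L) : N ≤ 2 ^ (L + 1) :=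
  ((Nat.lt_pow_succ_log_self one_lt_two N).trans_le
    (Nat.pow_le_pow_right two_pos (by lia))).le

/-- This reduces estimates in `ENNReal` to inequalities of natural numbers. The choice `r = 5` fits
`c = 1 / 27`, because `27 ≤ 2 ^ 5`. -/
theorem mul_inv_pow_le {a r t : ℕ} (c : ENNReal) (hc : 1 ≤ c * 2 ^ r) (h : a * 2 ^ r ≤ 2 ^ t) :
    (a : ENNReal) * 2⁻¹ ^ t ≤ c := by
  have h1 : (a : ENNReal) * 2 ^ r ≤ 2 ^ t := by exact_mod_cast h
  have h3 : (2 : ENNReal) ^ t * 2⁻¹ ^ t = 1 := by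
    rw [← mul_pow, ENNReal.mul_inv_cancel (by simp) (by simp), one_pow]
  have h4 : (2 : ENNReal) ^ r * 2⁻¹ ^ r = 1 := by
    rw [← mul_pow, ENNReal.mul_inv_cancel (by simp) (by simp), one_pow]
  calc (a : ENNReal) * 2⁻¹ ^ t = a * 2⁻¹ ^ t * (2 ^ r * 2⁻¹ ^ r) := by rw [h4, mul_one]
    _ = (a * 2 ^ r) * 2⁻¹ ^ t * 2⁻¹ ^ r := by ring
    _ ≤ 2 ^ t * 2⁻¹ ^ t * 2⁻¹ ^ r := by gcongr
    _ = 1 * 2⁻¹ ^ r := by rw [h3]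
    _ ≤ c * 2 ^ r * 2⁻¹ ^ r := by gcongr
    _ = c := by rw [mul_assoc, h4, mul_one]

theorem one_le_inv_mul : (1 : ENNReal) ≤ 1 / 27 * 2 ^ 5 := by
  rw [mul_comm, ← ENNReal.mul_comm_div, mul_one, ENNReal.le_div_iff_mul_le (by simp) (by simp)]
  norm_num

/-- Multiply `n * q ≤ (1 + q) ^ n` by `(1 - q) ^ n` and use `(1 - q) * (1 + q) ≤ 1`. This replaces
an exponential estimate. -/
theorem one_sub_pow_mul_le (q : ENNReal) (hq : q ≤ 1) (n : ℕ) : (1 - q) ^ n * (n * q) ≤ 1 := by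
  have h1 : (1 - q) * (1 + q) ≤ 1 := by
    calc (1 - q) * (1 + q) = (1 - q) + (1 - q) * q := by ring
      _ ≤ (1 - q) + 1 * q := by gcongr; exact tsub_le_self
      _ = 1 := by rw [one_mul, tsub_add_cancel_of_le hq]
  calc (1 - q) ^ n * (n * q) ≤ (1 - q) ^ n * (1 + q) ^ n := by
        gcongr
        clear h1 hq
        induction n with
        | zero => simp
        | succ n ih =>
          have h2 : 1 ≤ (1 + q) ^ n := one_le_pow₀ le_self_add
          calc ((n + 1 : ℕ) : ENNReal) * q = n * q + 1 * q := by push_cast; ring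
            _ ≤ (1 + q) ^ n + (1 + q) ^ n * q := by gcongr
            _ = (1 + q) ^ (n + 1) := by ring
    _ = ((1 - q) * (1 + q)) ^ n := (mul_pow _ _ _).symm
    _ ≤ 1 := pow_le_one' h1 n

/-- The expected number of marked tuples inside the clique, for one vector, is at least `2 ^ (M * l)
≥ 2 ^ (k + 5)`. So a vector fails with probability at most `2 ^ (-(k + 5))`, and `2 ^ k` vectors
leave `2 ^ (-5) ≤ 1 / 27`. -/
theorem missing_bound {k l M κ : ℕ} (hκ : 2 ^ (2 * M) ≤ κ) (hl : 1 ≤ l) (hk : k + 6 ≤ M) :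
    2 * (2 ^ k * (1 - 2⁻¹ ^ (M * l)) ^ (κ ^ l)) ≤ (2 / 27 : ENNReal) := by
  have hq : (2⁻¹ : ENNReal) ^ (M * l) ≤ 1 := pow_le_one' (by simp) _
  have h1 := one_sub_pow_mul_le _ hq (κ ^ l)
  have h2 : (2 : ENNReal) ^ (k + 5) ≤ ((κ ^ l : ℕ) : ENNReal) * 2⁻¹ ^ (M * l) := by
    have h3 : (2 : ENNReal) ^ (M * l) * 2⁻¹ ^ (M * l) = 1 := by
      rw [← mul_pow, ENNReal.mul_inv_cancel (by simp) (by simp), one_pow]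
    have h4 : 2 ^ (k + 5) * 2 ^ (M * l) ≤ κ ^ l := by
      calc 2 ^ (k + 5) * 2 ^ (M * l) = 2 ^ (k + 5 + M * l) := (pow_add _ _ _).symm
        _ ≤ 2 ^ (2 * M * l) := Nat.pow_le_pow_right two_pos (by nlinarith)
        _ = (2 ^ (2 * M)) ^ l := pow_mul _ _ _
        _ ≤ κ ^ l := Nat.pow_le_pow_left hκ l
    calc (2 : ENNReal) ^ (k + 5) = 2 ^ (k + 5) * (2 ^ (M * l) * 2⁻¹ ^ (M * l)) := by
          rw [h3, mul_one]
      _ = ((2 ^ (k + 5) * 2 ^ (M * l) : ℕ) : ENNReal) * 2⁻¹ ^ (M * l) := by push_cast; ring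
      _ ≤ _ := by gcongr
  set y := (1 - (2⁻¹ : ENNReal) ^ (M * l)) ^ (κ ^ l)
  have h5 : 2 ^ k * y * 2 ^ 5 ≤ 1 := by
    calc 2 ^ k * y * 2 ^ 5 = y * 2 ^ (k + 5) := by ring
      _ ≤ _ := (mul_le_mul_right h2 y).trans h1
  have h6 : 2 ^ k * y ≤ 1 / 27 := by
    rw [ENNReal.le_div_iff_mul_le (by simp) (by simp)]
    exact le_trans (by gcongr; norm_num) h5
  calc 2 * (2 ^ k * y) ≤ 2 * (1 / 27) := by gcongr
    _ = 2 / 27 := by rw [mul_one_div]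

/-- Compare exponents of 2. The choice of vectors and tuples costs `(u + u * l) * s`, at most half
of `M * l * s` since `4 * u ≤ M`. The choice of vertices costs at most `16 * L ^ 2`, and the other
half is at least `17 * L ^ 2` because `136 = 4 * 34`. The difference `L ^ 2` covers the constant 6.
-/
theorem crowded_bound {N L D M l k s u : ℕ} (hN : Nat.log 2 N ≤ L) (hM : L ≤ 4 * D * M)
    (hls : 136 * D * L ≤ l * s) (hL : 6 ≤ L) (hk : k ≤ u) (hu : 4 * u ≤ M) (hl : 1 ≤ l)
    (hLu : 8 * L ≤ 2 ^ u) :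
    2 * (N ^ (2 * (4 * L)) * ((2 ^ k * (2 * (4 * L) : ℕ) ^ l) ^ s * (2⁻¹ ^ (M * l)) ^ s))
      ≤ (1 / 27 : ENNReal) := by
  rw [← pow_mul, show (2 : ENNReal) * (N ^ (2 * (4 * L)) *
      ((2 ^ k * (2 * (4 * L) : ℕ) ^ l) ^ s * (2⁻¹ ^ (M * l * s))))
    = ((2 * (N ^ (2 * (4 * L)) * (2 ^ k * (2 * (4 * L)) ^ l) ^ s) : ℕ) : ENNReal)
      * (2⁻¹ ^ (M * l * s)) by push_cast; ring]
  refine mul_inv_pow_le (r := 5) _ one_le_inv_mul ?_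
  have h1 : N ^ (2 * (4 * L)) ≤ 2 ^ (2 * L * (8 * L)) := by
    rw [show 2 * (4 * L) = 8 * L by ring, pow_mul 2]
    exact Nat.pow_le_pow_left ((pow_two_le_of_log hN).trans
      (Nat.pow_le_pow_right two_pos (by lia))) _
  have h2 : (2 ^ k * (2 * (4 * L)) ^ l) ^ s ≤ 2 ^ ((u + u * l) * s) := by
    rw [pow_mul, pow_add, pow_mul, show 2 * (4 * L) = 8 * L by ring]
    gcongr
    exact one_le_two
  calc 2 * (N ^ (2 * (4 * L)) * (2 ^ k * (2 * (4 * L)) ^ l) ^ s) * 2 ^ 5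
      ≤ 2 * (2 ^ (2 * L * (8 * L)) * 2 ^ ((u + u * l) * s)) * 2 ^ 5 := by gcongr
    _ = 2 ^ (1 + (2 * L * (8 * L) + (u + u * l) * s) + 5) := by simp only [pow_add]; ring
    _ ≤ 2 ^ (M * l * s) := Nat.pow_le_pow_right two_pos ?_
  have h3 : (u + u * l) * s * 2 ≤ M * l * s := by
    have : (u + u * l) * 2 ≤ M * l := by nlinarith
    nlinarith
  have h4 : 34 * (L * L) ≤ M * l * s := by
    rcases D.eq_zero_or_pos with rfl | hD
    · lia
    have h5 : 136 * D * L * L ≤ l * s * (4 * D * M) := Nat.mul_le_mul hls hM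
    have h6 : 4 * D * (34 * (L * L)) ≤ 4 * D * (M * l * s) := by linarith
    exact Nat.le_of_mul_le_mul_left h6 (by lia)
  have h5 : 6 ≤ L * L := by nlinarith
  lia

theorem biclique_bound {N L : ℕ} (hN : Nat.log 2 N ≤ L) (hL : 2 ≤ L) :
    (N : ENNReal) ^ (2 * (4 * L)) * 2⁻¹ ^ (4 * L * (4 * L)) ≤ 1 / 27 := by
  rw [← Nat.cast_pow]
  refine mul_inv_pow_le (r := 5) _ one_le_inv_mul ?_
  calc N ^ (2 * (4 * L)) * 2 ^ 5 ≤ (2 ^ (L + 1)) ^ (2 * (4 * L)) * 2 ^ 5 := by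
        gcongr; exact pow_two_le_of_log hN
    _ = 2 ^ ((L + 1) * (2 * (4 * L)) + 5) := by rw [← pow_mul, ← pow_add]
    _ ≤ _ := Nat.pow_le_pow_right two_pos (by nlinarith)

/-- Raise both sides to the power `D`: `2 ^ (2 * M * D) ≤ N ≤ N ^ (δ * D)`. -/
theorem two_pow_le_ceil_rpow {δ : ℝ} {D M N : ℕ} (hD : 0 < D) (hδ : 1 ≤ D * δ) (hN : 0 < N)
    (hM : M = Nat.log 2 N / (2 * D)) : 2 ^ (2 * M) ≤ ⌈(N : ℝ) ^ δ⌉₊ := by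
  have h1 : (1 : ℝ) ≤ N := by exact_mod_cast hN
  have h2 : ((2 : ℝ) ^ (2 * M)) ^ D ≤ ((N : ℝ) ^ δ) ^ D := by
    rw [← Real.rpow_natCast ((N : ℝ) ^ δ) D, ← Real.rpow_mul (by positivity), mul_comm δ]
    refine le_trans ?_ (Real.rpow_le_rpow_of_exponent_le h1 hδ)
    rw [Real.rpow_one, ← pow_mul]
    have h3 : 2 * M * D ≤ Nat.log 2 N := by
      rw [hM, mul_comm 2, mul_assoc]
      exact Nat.div_mul_le_self _ _
    exact_mod_cast (Nat.pow_le_pow_right two_pos h3).trans (Nat.pow_log_le_self 2 hN.ne')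
  have h4 := (pow_le_pow_iff_left₀ (by positivity) (by positivity) hD.ne').1 h2
  exact_mod_cast h4.trans (Nat.le_ceil _)

theorem ceil_rpow_le {δ : ℝ} (hδ : δ ≤ 1) {N : ℕ} (hN : 0 < N) : ⌈(N : ℝ) ^ δ⌉₊ ≤ N := by
  refine Nat.ceil_le.2 ?_
  have h1 : (1 : ℝ) ≤ N := by exact_mod_cast hN
  simpa using Real.rpow_le_rpow_of_exponent_le h1 hδ

end Arithmetic

end VCHard

namespace VCHard
open Enc (enc)

/-! ### Choice of the parameters -/

section Parameters

/-- Half of the gap between `k` and the approximation factor, minus one. -/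
theorem exists_gap {α : ℕ → ℝ} (hα_ge : ∀ k, 1 ≤ α k) (hα_comp : ComputableSeq α)
    (hα : α =o[atTop] (fun k : ℕ => (k : ℝ))) :
    ∃ σ : ℕ → ℕ, Computable σ ∧ Tendsto σ atTop atTop ∧
      ∀ᶠ k in atTop, (2 * (σ k + 1) : ℝ) < k / α k := by
  obtain ⟨a, ha, hα_app⟩ := hα_comp
  have h1 : ∀ k, α k ≤ a k 0 + 1 := fun k => by
    have := abs_le.1 (hα_app k 0)
    norm_num at this
    linarith [this.2]
  have h2 : ∀ k, (a k 0 : ℝ) ≤ α k + 1 := fun k => by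
    have := abs_le.1 (hα_app k 0)
    norm_num at this
    linarith [this.1]
  have hten : Tendsto (fun k : ℕ => (k - 1) / (2 * (a k 0 + 1))) atTop atTop := by
    refine tendsto_atTop.2 fun b => ?_
    -- The denominator satisfies `2 * (a k 0 + 1) ≤ 2 * α k + 4 ≤ 6 * α k`, since `α k ≥ 1`.
    have hc : (0 : ℝ) < 1 / (6 * (b + 1)) := by positivity
    filter_upwards [hα.bound hc, eventually_ge_atTop 2] with k hk hk2
    rw [Nat.le_div_iff_mul_le (by lia)]
    have hk0 : (2 : ℝ) ≤ k := by exact_mod_cast hk2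
    have h3 := hα_ge k
    rw [Real.norm_of_nonneg (by linarith), Real.norm_of_nonneg (by linarith)] at hk
    have h4 : α k * (6 * (b + 1)) ≤ k := by
      rw [one_div_mul_eq_div, le_div_iff₀ (by positivity)] at hk
      exact hk
    have h5 : (b * (2 * (a k 0 + 1)) + 1 : ℝ) ≤ k := by
      have h6 := h2 k
      have h7 : (0 : ℝ) ≤ b := by positivity
      have h8 : (b : ℝ) * a k 0 ≤ b * (α k + 1) := by gcongr
      nlinarith
    have h6 : b * (2 * (a k 0 + 1)) + 1 ≤ k := by exact_mod_cast h5
    lia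
  -- Since `α k ≤ a k 0 + 1`, the quotient times `2 * α k` is at most `k - 1 < k`. The final
  -- subtraction is undone by the `+ 1` in `σ k + 1`, which keeps the size of the block positive.
  refine ⟨fun k => (k - 1) / (2 * (a k 0 + 1)) - 1, ?_, ?_, ?_⟩
  · have h3 : Computable fun k => a k 0 := ha.comp Computable.id (Computable.const 0)
    have h4 : Computable fun k => 2 * (a k 0 + 1) :=
      Primrec.nat_mul.to_comp.comp (Computable.const 2) (Computable.succ.comp h3)
    have h5 : Computable fun k => (k - 1) / (2 * (a k 0 + 1)) :=
      Primrec.nat_div.to_comp.comp Computable.pred h4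
    exact Computable.pred.comp h5
  · exact tendsto_atTop.2 fun b => (hten.eventually_ge_atTop (b + 1)).mono fun k hk => by lia
  · filter_upwards [hten.eventually_ge_atTop 1, eventually_ge_atTop 1] with k hk hk1
    rw [lt_div_iff₀ (by linarith [hα_ge k])]
    have h3 : ((k - 1) / (2 * (a k 0 + 1))) * (2 * (a k 0 + 1)) ≤ k - 1 := Nat.div_mul_le_self _ _
    obtain ⟨d, hd⟩ : ∃ d, (k - 1) / (2 * (a k 0 + 1)) = d + 1 := ⟨_, (Nat.sub_add_cancel hk).symm⟩
    rw [hd] at h3 ⊢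
    have h4 : (d + 1) * (2 * (a k 0 + 1)) < k := by lia
    have h5 : ((d + 1) * (2 * (a k 0 + 1)) : ℝ) < k := by exact_mod_cast h4
    have h6 := h1 k
    rw [Nat.add_sub_cancel]
    have h7 : (2 * (d + 1) : ℝ) * α k ≤ 2 * (d + 1) * (a k 0 + 1) := by gcongr
    linarith

theorem tendsto_log_two : Tendsto (fun N : ℕ => Nat.log 2 N) atTop atTop :=
  tendsto_atTop.2 fun b => (eventually_ge_atTop (2 ^ b)).mono fun N hN =>
    (Nat.le_log_iff_pow_le one_lt_two (by have := Nat.two_pow_pos b; lia)).2 hN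

theorem log_two_le (N : ℕ) : (Nat.log 2 N : ℝ) ≤ 2 * Real.log N := by
  rcases N.eq_zero_or_pos with rfl | hN
  · simp
  have h1 : ((2 : ℝ) ^ Nat.log 2 N) ≤ N := by exact_mod_cast Nat.pow_log_le_self 2 hN.ne'
  have h2 := Real.log_le_log (by positivity) h1
  rw [Real.log_pow] at h2
  have h3 := Real.log_two_gt_d9
  have h4 : (0 : ℝ) ≤ Nat.log 2 N := by positivity
  nlinarith

theorem tendsto_log_nat : Tendsto (fun N : ℕ => Real.log N) atTop atTop :=
  Real.tendsto_log_atTop.comp tendsto_natCast_atTop_atTop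

/-- Division by a quantity that tends to infinity is what brings the running time `N ^ O(l)` below
the threshold of the hypothesis. -/
theorem isLittleO_length (C : ℕ) {s : ℕ → ℕ} (hs : Tendsto s atTop atTop) :
    (fun N => ((C * Nat.log 2 N / (s N + 1) + 1 : ℕ) : ℝ)) =o[atTop] fun N : ℕ => Real.log N := by
  have h1 : (fun _ : ℕ => (1 : ℝ)) =o[atTop] fun N : ℕ => Real.log N :=
    isLittleO_const_left.2 (Or.inr (tendsto_norm_atTop_atTop.comp tendsto_log_nat))
  have h2 : (fun N => ((C * Nat.log 2 N / (s N + 1) : ℕ) : ℝ)) =o[atTop]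
      fun N : ℕ => Real.log N := by
    refine isLittleO_iff.2 fun c hc => ?_
    have h3 := (tendsto_natCast_atTop_atTop (R := ℝ)).comp hs
    filter_upwards [h3.eventually_ge_atTop (2 * C / c)] with N hN
    rw [Real.norm_of_nonneg (by positivity), Real.norm_of_nonneg (Real.log_natCast_nonneg N)]
    refine (Nat.cast_div_le).trans ?_
    rw [div_le_iff₀ (by positivity)]
    rw [Function.comp, div_le_iff₀ hc] at hN
    have h4 := log_two_le N
    have h5 := Real.log_natCast_nonneg N
    push_cast
    calc (C : ℝ) * Nat.log 2 N ≤ C * (2 * Real.log N) := by gcongr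
      _ = 2 * C * Real.log N := by ring
      _ ≤ s N * c * Real.log N := by gcongr
      _ ≤ c * Real.log N * (s N + 1) := by nlinarith [mul_nonneg hc.le h5]
  push_cast
  exact h2.add h1

theorem eventually_mul_le_two_pow (C : ℕ) : ∀ᶠ u : ℕ in atTop, C * (u + 1) ≤ 2 ^ u := by
  have h := isLittleO_coe_const_pow_of_one_lt (R := ℝ) (r := 2) one_lt_two
  have hc : (0 : ℝ) < 1 / (2 * (C + 1)) := by positivity
  filter_upwards [h.bound hc, eventually_ge_atTop 1] with u hu h1
  rw [Real.norm_of_nonneg (by positivity), Real.norm_of_nonneg (by positivity),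
    one_div_mul_eq_div, le_div_iff₀ (by positivity)] at hu
  have h2 : u * (2 * (C + 1)) ≤ 2 ^ u := by exact_mod_cast hu
  nlinarith

/-- With `L = Nat.log 2 N` and `D ≥ 1 / δ`, take `M = L / (2 * D)` and `j = M * l`. Then a clique of
size `N ^ δ ≥ 2 ^ (2 * M)` contains many marked tuples, while a set of `8 * L` vertices contains
few. -/
theorem exists_parameters {δ : ℝ} (hδ0 : 0 < δ) {f : ℕ → ℕ} (hf : Computable f)
    {σ : ℕ → ℕ} (hσ : Computable σ) (hσt : Tendsto σ atTop atTop) :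
    ∃ κ l j : ℕ → ℕ, PolyTime sz κ ∧ PolyTime sz l ∧ PolyTime sz j ∧ Tendsto κ atTop atTop ∧
      (fun N => (l N : ℝ)) =o[atTop] (fun N : ℕ => Real.log N) ∧
      ∀ᶠ N in atTop, 2 ^ κ N ≤ N ∧ f (κ N) ≤ N ∧ 2 * (4 * Nat.log 2 N) ≤ N ∧
        (2 * (2 ^ κ N * (1 - 2⁻¹ ^ j N) ^ (⌈(N : ℝ) ^ δ⌉₊ ^ l N)) ≤ (2 / 27 : ENNReal)) ∧
        (2 * (N ^ (2 * (4 * Nat.log 2 N)) * ((2 ^ κ N * (2 * (4 * Nat.log 2 N) : ℕ) ^ l N)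
          ^ (σ (κ N) + 1) * (2⁻¹ ^ j N) ^ (σ (κ N) + 1))) ≤ (1 / 27 : ENNReal)) ∧
        (N : ENNReal) ^ (2 * (4 * Nat.log 2 N)) * 2⁻¹ ^ (4 * Nat.log 2 N * (4 * Nat.log 2 N))
          ≤ 1 / 27 := by
  -- The extra summand forces `κ N * κ N ≤ Nat.log 2 N`, so that `κ N` is eventually smaller than
  -- any fixed fraction of the logarithm.
  have hF : Computable fun k => f k + 2 ^ (k * k) := by
    have h1 : Computable fun k : ℕ => 2 ^ (k * k) :=
      (Primrec₂.unpaired'.1 Nat.Primrec.pow).to_comp.comp (Computable.const 2)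
        (Primrec.nat_mul.to_comp.comp Computable.id Computable.id)
    exact Primrec.nat_add.to_comp.comp hf h1
  obtain ⟨κ, hκ, hs, hκt, hκN⟩ := exists_slow hF hσ
  obtain ⟨D, hD⟩ := exists_nat_ge (1 / δ)
  have hD1 : 1 ≤ D * δ := by rwa [div_le_iff₀ hδ0] at hD
  have hD0 : 0 < D := by
    rcases D.eq_zero_or_pos with rfl | h
    · norm_num at hD1
    · exact h
  have hL : PolyTime sz fun N => Nat.log 2 N := (PolyTime.id (X := ℕ) (.self _)).log
  have hM : PolyTime sz fun N => Nat.log 2 N / (2 * D) := by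
    have := hL.div (n := fun _ => 2 * D - 1) (.const (.self _) _)
    simpa only [show 2 * D - 1 + 1 = 2 * D by lia] using this
  -- The quotient plus one guarantees `l ≥ 1` and `l * s ≥ 136 * D * L` for `s = σ (κ N) + 1`, as
  -- `crowded_bound` requires.
  have hl : PolyTime sz fun N => 136 * D * Nat.log 2 N / (σ (κ N) + 1) + 1 :=
    (((PolyTime.const (.self _) _).mul hL).div hs).succ
  refine ⟨κ, _, _, hκ, hl, hM.mul hl, hκt, isLittleO_length _ (hσt.comp hκt), ?_⟩
  have hut : Tendsto (fun N => Nat.log 2 N / (2 * D) / 4) atTop atTop := by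
    simp only [Nat.div_div_eq_div_mul]
    exact (Nat.tendsto_div_const_atTop (by lia)).comp tendsto_log_two
  filter_upwards [hκN, hκt.eventually_ge_atTop (16 * D), eventually_gt_atTop 0,
    tendsto_log_two.eventually_ge_atTop (6 + 2 * D), hut.eventually_ge_atTop 6,
    hut.eventually (eventually_mul_le_two_pow (64 * D)),
    tendsto_log_two.eventually (eventually_mul_le_two_pow 8)] with N h1 h2 h3 h4 h5 h6 h7
  set L := Nat.log 2 N with hLdef
  set M := L / (2 * D) with hMdef
  set u := M / 4 with hudef
  have hLN : 2 ^ L ≤ N := Nat.pow_log_le_self 2 h3.ne'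
  have hkk : κ N * κ N ≤ L :=
    (Nat.le_log_iff_pow_le one_lt_two h3.ne').2 ((Nat.le_add_left _ _).trans h1)
  have hk1 : κ N ≤ L := by nlinarith
  have hLM : L < 2 * D * (M + 1) := by
    rw [mul_comm]; exact Nat.lt_mul_of_div_lt (by lia) (by lia)
  have hu4 : M < 4 * (u + 1) := by lia
  have hM1 : 1 ≤ M := by lia
  have hLM' : L ≤ 4 * D * M := by nlinarith
  have hku : κ N ≤ u := by
    have h8 : 16 * D * κ N ≤ L := (Nat.mul_le_mul_right _ h2).trans hkk
    have h9 : 4 * D * (4 * κ N) ≤ 4 * D * M := by linarith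
    have := Nat.le_of_mul_le_mul_left h9 (by lia)
    lia
  have hLu : 8 * L ≤ 2 ^ u := by
    refine le_trans ?_ h6
    have : M + 1 ≤ 4 * (u + 1) := hu4
    nlinarith
  refine ⟨?_, by lia, by nlinarith, ?_, ?_, biclique_bound le_rfl (by lia)⟩
  · exact (Nat.pow_le_pow_right two_pos hk1).trans hLN
  · exact missing_bound (two_pow_le_ceil_rpow hD0 hD1 h3 rfl) (by lia) (by lia)
  · refine crowded_bound (D := D) (u := u) le_rfl hLM' ?_ (by lia) hku (by lia) (by lia) hLu
    have := Nat.lt_mul_div_succ (136 * D * L) (σ (κ N)).succ_pos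
    rw [mul_comm (_ / _ + 1)]
    exact this.le

end Parameters

end VCHard

namespace VCHard
open Enc (enc)

/-! ### Distinguishing planted cliques by approximating a dimension -/

section Distinguisher

/-- The reduction with parameters that depend on the number of vertices. -/
theorem exists_reduction {k l j : ℕ → ℕ} (hk : PolyTime sz k) (hl : PolyTime sz l)
    (hj : PolyTime sz j) :
    ∃ (R : Prog) (c : ℕ), ∀ (N : ℕ) (G : SimpleGraph (Fin N)), R.Computes (encodeGraph G)
      ((reduction (adjOrEq G) (k N) (l N) (j N) (List.finRange N)).map enc)
      ((N * (N * 4 + 1 + 1) + 1 + 2 ^ k N + N ^ l N + 2) ^ c) := by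
  set w : List (List Bool) → ℕ := fun G => sz G + 2 ^ k G.length + G.length ^ l G.length with hw
  have hwsz : PolyIn w sz := (PolyIn.self w).mono fun G => by simp only [hw]; lia
  have hG : PolyTime w fun G : List (List Bool) => G := .id hwsz
  obtain ⟨-, R, b, ⟨c, hc⟩, hR⟩ := reduction_polyTime (hk.comp hG.length) (hl.comp hG.length)
    (hj.comp hG.length) hG ((PolyIn.self w).mono fun G => by simp only [hw]; lia)
    ((PolyIn.self w).mono fun G => by simp only [hw]; lia)
  refine ⟨R, c, fun N G => ?_⟩
  have h1 := (hR (adjList G)).1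
  simp only [length_adjList] at h1
  rw [reduction_adjList, ← encodeGraph_eq] at h1
  refine h1.mono ((hc _).trans (Nat.pow_le_pow_left ?_ c))
  have := sz_adjList G
  simp only [hw, length_adjList]
  lia

variable {dim : ∀ {m : ℕ}, Finset (Finset (Fin m)) → ℕ} {α : ℕ → ℝ} {p : Prog} {f : ℕ → ℕ} {e : ℕ}

/-- The running time of an FPT algorithm on the instances of the reduction. -/
def instanceTime (f : ℕ → ℕ) (e N k l : ℕ) : ℕ :=
  f k * ((k * N ^ l + 2 ^ k * N ^ l) * (2 ^ k * N ^ l) + 1) ^ e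

/-- The algorithm `p` solves the gap problem of `dim` in time `f k * (m * c + 1) ^ e`. -/
def SolvesGap (dim : ∀ {m : ℕ}, Finset (Finset (Fin m)) → ℕ) (α : ℕ → ℝ) (p : Prog) (f : ℕ → ℕ)
    (e : ℕ) : Prop :=
  ∀ (k m c : ℕ) (M : Matrix (Fin m) (Fin c) Bool), 0 < c → Function.Injective M.transpose →
    p.HaltsWithin (encodeInstance k M) (f k * (m * c + 1) ^ e) ∧
    (k ≤ dim (conceptClass M) →
      2 / 3 ≤ p.acceptProb (encodeInstance k M) (f k * (m * c + 1) ^ e)) ∧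
    ((dim (conceptClass M) : ℝ) < k / α k →
      p.acceptProb (encodeInstance k M) (f k * (m * c + 1) ^ e) ≤ 1 / 3)

/-- The dimensions of the matrix depend on `N`, `k` and `l` only, so one time bound is valid for all
outcomes of the marks. -/
theorem SolvesGap.instance (hp : SolvesGap dim α p f e) {N : ℕ} (hN : 0 < N)
    {compat : Fin N → Fin N → Bool} {k l : ℕ}
    {rs cs : List (Bool × (List Bool × List (Fin N)))} (hrs : rs.length = k * N ^ l)
    (hcs : cs.length = 2 ^ k * N ^ l) :
    p.HaltsWithin (enc (k, columns compat rs cs)) (instanceTime f e N k l) ∧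
    (k ≤ dim (conceptClass (matrixOf compat rs cs)) →
      2 / 3 ≤ p.acceptProb (enc (k, columns compat rs cs)) (instanceTime f e N k l)) ∧
    ((dim (conceptClass (matrixOf compat rs cs)) : ℝ) < k / α k →
      p.acceptProb (enc (k, columns compat rs cs)) (instanceTime f e N k l) ≤ 1 / 3) := by
  have h1 := hp k _ _ (matrixOf compat rs cs) (by rw [hcs]; positivity)
    (matrixOf_transpose_injective ..)
  have h2 : f k * ((rs.length + cs.length) * cs.length + 1) ^ e = instanceTime f e N k l := by
    rw [hrs, hcs, instanceTime]
  rw [h2, ← enc_columns] at h1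
  exact h1

theorem le_acceptProb {x : Data} {D : PMF Data} {t : ℕ} (h : p.Computes x D t)
    (hD : D.toOuterMeasure {.nil} ≤ 1 / 3) : 2 / 3 ≤ p.acceptProb x t := by
  have h2 := toOuterMeasure_compl D {y | y ≠ .nil}
  have h3 : ({y | y ≠ .nil} : Set Data)ᶜ = {.nil} := by ext; simp
  have h4 := toOuterMeasure_le_one D {y | y ≠ .nil}
  have h5 := ne_top_of_le_ne_top ENNReal.one_ne_top h4
  rw [h3] at h2
  rw [h2, ← ENNReal.toReal_le_toReal (by finiteness) (by finiteness),
    ENNReal.toReal_sub_of_le h4 (by finiteness)] at hD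
  rw [h.acceptProb]
  simp only [ENNReal.toReal_one, ENNReal.toReal_div, ENNReal.toReal_ofNat] at hD
  linarith

theorem acceptProb_le {x : Data} {D : PMF Data} {t : ℕ} (h : p.Computes x D t) {c : ENNReal}
    (hc : c ≠ ⊤) (hD : D.toOuterMeasure {y | y ≠ .nil} ≤ c) : p.acceptProb x t ≤ c.toReal := by
  rw [h.acceptProb]
  exact ENNReal.toReal_mono hc hD

/-- The error budget is `1 / 3 = 9 / 27`. The majority vote takes `7 / 27`. For planted cliques `2 /
27` remain for missing tuples, and the estimate holds for every graph and every `S`. For random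
graphs `1 / 27` each remain for crowded tuples and for bicliques. -/
theorem distinguishes (hdim : ∀ {m : ℕ} (C : Finset (Finset (Fin m))), C.vcDim ≤ dim C)
    (hdim' : ∀ {m : ℕ} (C : Finset (Finset (Fin m))), dim C ≤ ldim C)
    (hp : SolvesGap dim α p f e) {R : Prog} {N k l j s h κ b T : ℕ} (hN : 0 < N)
    (hR : ∀ G : SimpleGraph (Fin N), R.Computes (encodeGraph G)
      ((reduction (adjOrEq G) k l j (List.finRange N)).map enc) b)
    (hT : b + 3 * instanceTime f e N k l + 11 ≤ T) (hs : 0 < s) (hsk : (2 * s : ℝ) < k / α k)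
    (hκ : κ ≤ N) (hh : 2 * h ≤ N)
    (hmiss : 2 * (2 ^ k * (1 - 2⁻¹ ^ j) ^ (κ ^ l)) ≤ (2 / 27 : ENNReal))
    (hcrowd : 2 * (N ^ (2 * h) * ((2 ^ k * (2 * h : ℕ) ^ l) ^ s * (2⁻¹ ^ j) ^ s))
      ≤ (1 / 27 : ENNReal))
    (hbicl : (N : ENNReal) ^ (2 * h) * 2⁻¹ ^ (h * h) ≤ 1 / 27) :
    (∀ G : SimpleGraph (Fin N), (Prog.seq R p.majority).HaltsWithin (encodeGraph G) T) ∧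
      2 / 3 ≤ acceptProbPlanted (Prog.seq R p.majority) N κ T ∧
      acceptProbRandom (Prog.seq R p.majority) N T ≤ 1 / 3 := by
  have key := fun G : SimpleGraph (Fin N) => (hR G).seq_majority
    (p := p) (t := instanceTime f e N k l) fun y hy => by
      obtain ⟨rs, cs, hrs, hcs, rfl, -⟩ := reduction_instances G k l j hy
      exact (hp.instance hN hrs hcs).1
  choose D hD hrand hplant using key
  replace hD := fun G => (hD G).mono hT
  refine ⟨fun G => (hD G).haltsWithin, ?_, ?_⟩
  · have hne : (powersetCard κ (univ : Finset (Fin N))).Nonempty :=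
      powersetCard_nonempty.2 (by simpa using hκ)
    refine Finset.le_expect hne fun S hS => le_integral_randomGraph fun G => ?_
    set G' := plantClique G S with hG'
    refine le_acceptProb (hD G') ?_
    have hclique : ∀ u ∈ S, ∀ v ∈ S, u = v ∨ G'.Adj u v := fun u hu v hv => by
      by_cases huv : u = v
      · exact Or.inl huv
      · refine Or.inr ?_
        simp [hG', plantClique, SimpleGraph.fromRel_adj, huv, hu, hv]
    have h1 := reduction_complete G' hclique k l j
    rw [(Finset.mem_powersetCard.1 hS).2] at h1
    refine (hplant G' _ fun y _ hy => ?_).trans ((add_le_add_left (h1.trans hmiss) _).trans ?_)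
    · obtain ⟨rs, cs, hrs, hcs, rfl, h2⟩ := not_not.1 hy
      exact (hp.instance hN hrs hcs).2.1 (h2.trans (hdim _))
    · rw [← ENNReal.toReal_le_toReal (by finiteness) (by finiteness),
        ENNReal.toReal_add (by finiteness) (by finiteness)]
      norm_num
  · have hone : ∀ G : SimpleGraph (Fin N),
        (Prog.seq R p.majority).acceptProb (encodeGraph G) T ≤ 1 := fun G => by
      simpa using acceptProb_le (hD G) ENNReal.one_ne_top (toOuterMeasure_le_one _ _)
    refine (integral_randomGraph_le (c := 8 / 27) (by norm_num) {G | ∃ A B : Finset (Fin N),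
      A.card = h ∧ B.card = h ∧ Disjoint A B ∧ Biclique G A B} hone fun G hG => ?_).trans ?_
    · have h1 := reduction_sound G hs hh hG k l j
      have h2 : (D G).toOuterMeasure {y | y ≠ .nil} ≤ 1 / 27 + 7 / 27 := by
        refine (hrand G _ fun y _ hy => ?_).trans (add_le_add_left (h1.trans hcrowd) _)
        obtain ⟨rs, cs, hrs, hcs, rfl, h2⟩ := not_not.1 hy
        refine (hp.instance hN hrs hcs).2.2 (lt_of_le_of_lt ?_ hsk)
        exact_mod_cast (hdim' _).trans h2
      refine (acceptProb_le (hD G) (by finiteness) h2).trans (le_of_eq ?_)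
      rw [ENNReal.toReal_add (by finiteness) (by finiteness)]
      norm_num
    · have h1 := (randomGraph_exists_biclique_le (N := N) h).trans hbicl
      have h2 := ENNReal.toReal_mono (by finiteness) h1
      rw [ENNReal.toReal_div, ENNReal.toReal_one, ENNReal.toReal_ofNat] at h2
      rw [MeasureTheory.measureReal_def]
      linarith

theorem instanceTime_le {N k l : ℕ} (hN : 2 ≤ N) (hk : 2 ^ k ≤ N) (hf : f k ≤ N) :
    instanceTime f e N k l ≤ N ^ ((2 * l + 4) * e + 1) := by
  have h1 : k * N ^ l + 2 ^ k * N ^ l ≤ N ^ (l + 2) := by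
    have h2 : k ≤ N := Nat.lt_two_pow_self.le.trans hk
    calc k * N ^ l + 2 ^ k * N ^ l ≤ N * N ^ l + N * N ^ l := by gcongr
      _ = 2 * (N * N ^ l) := by ring
      _ ≤ N * (N * N ^ l) := by gcongr
      _ = N ^ (l + 2) := by ring
  have h2 : 2 ^ k * N ^ l ≤ N ^ (l + 1) := by
    calc 2 ^ k * N ^ l ≤ N * N ^ l := by gcongr
      _ = _ := by ring
  have h3 : (k * N ^ l + 2 ^ k * N ^ l) * (2 ^ k * N ^ l) + 1 ≤ N ^ (2 * l + 4) := by
    have h4 : 1 ≤ N ^ (l + 2) * N ^ (l + 1) := by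
      have : 0 < N := by lia
      exact Nat.one_le_iff_ne_zero.2 (by positivity)
    calc _ ≤ N ^ (l + 2) * N ^ (l + 1) + N ^ (l + 2) * N ^ (l + 1) := by gcongr
      _ = 2 * (N ^ (l + 2) * N ^ (l + 1)) := by ring
      _ ≤ N * (N ^ (l + 2) * N ^ (l + 1)) := by gcongr
      _ = _ := by ring
  calc instanceTime f e N k l ≤ N * (N ^ (2 * l + 4)) ^ e := by unfold instanceTime; gcongr
    _ = _ := by ring

theorem time_le {N k l c : ℕ} (hN : 16 ≤ N) (hk : 2 ^ k ≤ N) (hf : f k ≤ N) :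
    (N * (N * 4 + 1 + 1) + 1 + 2 ^ k + N ^ l + 2) ^ c + 3 * instanceTime f e N k l + 11
      ≤ N ^ ((2 * c + 2 * e) * l + (5 * c + 4 * e + 3)) := by
  have hN0 : 0 < N := by lia
  have h1 : N * (N * 4 + 1 + 1) + 1 + 2 ^ k + N ^ l + 2 ≤ N ^ (2 * l + 5) := by
    have h2 : 1 ≤ N ^ l := Nat.one_le_iff_ne_zero.2 (by positivity)
    have h3 : N ^ l ≤ N ^ (2 * l) := Nat.pow_le_pow_right hN0 (by lia)
    have h4 : N ^ (2 * l + 5) = N ^ (2 * l) * (N * N * N * N * N) := by ring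
    have h5 : 4096 ≤ N * N * N := by nlinarith
    have h6 : N * (N * 4 + 1 + 1) + 1 + N + 2 + 1 ≤ N * N * N * N * N := by nlinarith
    rw [h4]
    have h7 : N * (N * 4 + 1 + 1) + 1 + 2 ^ k + 2 ≤ N ^ (2 * l) * (N * (N * 4 + 1 + 1) + 1 + N + 2) :=
      (Nat.le_mul_of_pos_left _ (by positivity)).trans' (by lia)
    calc _ ≤ N ^ (2 * l) * (N * (N * 4 + 1 + 1) + 1 + N + 2) + N ^ (2 * l) := by lia
      _ = N ^ (2 * l) * (N * (N * 4 + 1 + 1) + 1 + N + 2 + 1) := by ring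
      _ ≤ _ := by gcongr
  set E := (2 * l + 5) * c + ((2 * l + 4) * e + 1) with hE
  have h2 : (N * (N * 4 + 1 + 1) + 1 + 2 ^ k + N ^ l + 2) ^ c ≤ N ^ E := by
    refine (Nat.pow_le_pow_left h1 c).trans ?_
    rw [← pow_mul]
    exact Nat.pow_le_pow_right hN0 (by lia)
  have h3 : instanceTime f e N k l ≤ N ^ E :=
    (instanceTime_le (by lia) hk hf).trans (Nat.pow_le_pow_right hN0 (by lia))
  have h4 : 1 ≤ N ^ E := Nat.one_le_iff_ne_zero.2 (by positivity)
  -- The three summands contribute at most `1 + 3 + 11 = 15` copies of `N ^ E`.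
  calc _ ≤ 16 * N ^ E := by lia
    _ ≤ N * N ^ E := by gcongr
    _ = N ^ (E + 1) := by ring
    _ ≤ _ := Nat.pow_le_pow_right hN0 (by rw [hE]; nlinarith)

/-- The argument applies to any `dim` between the VC dimension and Littlestone's dimension:
completeness bounds the former from below, soundness the latter from above. -/
theorem not_isFPTApprox (hSPC : StrongishPlantedCliqueHypothesis)
    (hdim : ∀ {m : ℕ} (C : Finset (Finset (Fin m))), C.vcDim ≤ dim C)
    (hdim' : ∀ {m : ℕ} (C : Finset (Finset (Fin m))), dim C ≤ ldim C)
    (hα_ge : ∀ k, 1 ≤ α k) (hα_comp : ComputableSeq α)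
    (hα : α =o[atTop] (fun k : ℕ => (k : ℝ))) :
    ¬ ∃ p : Prog, IsFPTApprox dim α p := by
  rintro ⟨p, f, e, hf, hp⟩
  obtain ⟨δ, hδ0, hδ1, hno⟩ := hSPC
  obtain ⟨σ, hσ, hσt, hσk⟩ := exists_gap hα_ge hα_comp hα
  obtain ⟨κ, l, j, hκ, hl, hj, hκt, hlo, hev⟩ := exists_parameters hδ0 hf hσ hσt
  obtain ⟨R, c, hR⟩ := exists_reduction hκ hl hj
  refine hno ⟨Prog.seq R p.majority,
    fun N => N ^ ((2 * c + 2 * e) * l N + (5 * c + 4 * e + 3)),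
    fun N => (2 * c + 2 * e : ℕ) * (l N : ℝ) + (5 * c + 4 * e + 3 : ℕ), ?_, ?_⟩
  · exact (hlo.const_mul_left _).add
      (isLittleO_const_left.2 (Or.inr (tendsto_norm_atTop_atTop.comp tendsto_log_nat)))
  · filter_upwards [hev, hκt.eventually hσk, eventually_ge_atTop 16]
      with N ⟨h1, h2, h3, h4, h5, h6⟩ h7 h8
    refine ⟨le_of_eq ?_, distinguishes (s := σ (κ N) + 1) hdim hdim' hp (by lia) (hR N)
      (time_le h8 h1 h2) (Nat.succ_pos _) (by exact_mod_cast h7)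
      (ceil_rpow_le hδ1.le (by lia)) h3 h4 h5 h6⟩
    rw [Nat.cast_pow, ← Real.rpow_natCast]
    push_cast
    rfl

end Distinguisher

end VCHard

theorem mainTheorem11 (hSPC : VCHard.StrongishPlantedCliqueHypothesis)
    (α : ℕ → ℝ) (hα_ge : ∀ k, 1 ≤ α k) (hα_comp : VCHard.ComputableSeq α)
    (hα : α =o[atTop] (fun k : ℕ => (k : ℝ))) :
    (¬ ∃ p : VCHard.Prog, VCHard.IsFPTApprox (fun C => C.vcDim) α p) ∧
    (¬ ∃ p : VCHard.Prog, VCHard.IsFPTApprox (fun C => VCHard.ldim C) α p) :=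
  ⟨VCHard.not_isFPTApprox hSPC (fun _ => le_rfl) (fun C => VCHard.vcDim_le_ldim C)
      hα_ge hα_comp hα,
    VCHard.not_isFPTApprox hSPC (fun C => VCHard.vcDim_le_ldim C) (fun _ => le_rfl)
      hα_ge hα_comp hα⟩
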